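/- Let $n\ge 3$ be an integer, $1\le a\le 2$, and let $2\le p,q\le\infty$ with $p\neq\infty$ and $\frac2q+\frac2p=1$. Put $s=n\left(\frac12-\frac1p\right)-\frac{a+1}{q}$. Let $S_a(t)$, $t\in\mathbb R$, denote the linear propagator of $\partial_t u+\partial_{x_1}(-\Delta)^{a/2}u=0$ on $\mathbb R^n$, that is $$\widehat{S_a(t)f}(\xi)=e^{-it\xi_1|\xi|^a}\hat f(\xi).$$ Let $\dot H^s(\mathbb R^n)$ be the space of tempered distributions $f$ whose Fourier transform is a (locally integrable) function with $\|f\|_{\dot H^s}=\||\xi|^s\hat f\|_{L^2}<\infty$, and $H^s(\mathbb R^n)$ the usual Sobolev space with $\|f\|_{H^s}=\|(1+|\xi|^2)^{s/2}\hat f\|_{L^2}$. Then: (i) there is a constant $C<\infty$, depending only on $n,a,p,q$, such that for all $f\in\dot H^s(\mathbb R^n)$ $$\|S_a(t)f\|_{L^q_t(\mathbb R;L^p_x(\mathbb R^n))}\le C\,\|f\|_{\dot H^s(\mathbb R^n)};$$ (ii) for every $T>0$ there is a constant $C_T<\infty$, depending only on $n,a,p,q,T$, such that for all $f\in H^s(\mathbb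 R^n)$ $$\|S_a(t)f\|_{L^q_t([0,T];L^p_x(\mathbb R^n))}\le C_T\,\|f\|_{H^s(\mathbb R^n)}.$$ -/

import Mathlib

open MeasureTheory FourierTransform
open scoped ENNReal NNReal SchwartzMap

noncomputable section

namespace FractionalZK

/-- Functions that define a tempered distribution by integration: measurable functions whose
absolute value is integrable against some negative power of `1 + ‖x‖`. -/
def IsTemperedFun {n : ℕ} (g : EuclideanSpace ℝ (Fin n) → ℂ) : Prop :=
  AEStronglyMeasurable g volume ∧
    ∃ k : ℕ, Integrable (fun x => (1 + ‖x‖) ^ (-(k : ℝ)) * ‖g x‖) volume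

theorem schwartz_norm_le {n : ℕ} (k : ℕ) (φ : 𝓢(EuclideanSpace ℝ (Fin n), ℂ))
    (x : EuclideanSpace ℝ (Fin n)) :
    ‖φ x‖ ≤ (1 + ‖x‖) ^ (-(k : ℝ)) * (2 ^ k *
      (Finset.Iic (k, 0)).sup (schwartzSeminormFamily ℂ (EuclideanSpace ℝ (Fin n)) ℂ) φ) := by
  have hx : (0 : ℝ) < 1 + ‖x‖ := by positivity
  rw [Real.rpow_neg hx.le, Real.rpow_natCast, ← div_eq_inv_mul, le_div_iff₀ (by positivity),
    mul_comm]
  have h := SchwartzMap.one_add_le_sup_seminorm_apply (𝕜 := ℂ) (m := (k, 0)) (k := k) (n := 0)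
    le_rfl le_rfl φ x
  rw [norm_iteratedFDeriv_zero] at h
  exact h

theorem IsTemperedFun.integrable {n : ℕ} {g : EuclideanSpace ℝ (Fin n) → ℂ}
    (hg : IsTemperedFun g) (φ : 𝓢(EuclideanSpace ℝ (Fin n), ℂ)) :
    Integrable (fun x => φ x * g x) volume := by
  obtain ⟨hm, k, hk⟩ := hg
  refine (hk.mul_const (2 ^ k * (Finset.Iic (k, 0)).sup
    (schwartzSeminormFamily ℂ (EuclideanSpace ℝ (Fin n)) ℂ) φ)).mono'
    (φ.continuous.aestronglyMeasurable.mul hm) (Filter.Eventually.of_forall fun x => ?_)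
  rw [norm_mul]
  calc ‖φ x‖ * ‖g x‖ ≤ _ := mul_le_mul_of_nonneg_right (schwartz_norm_le k φ x) (norm_nonneg _)
    _ = _ := by ring

/-- The tempered distribution `φ ↦ ∫ φ g` defined by a function `g` with `IsTemperedFun g`. -/
def distOfTempered {n : ℕ} (g : EuclideanSpace ℝ (Fin n) → ℂ) (hg : IsTemperedFun g) :
    𝓢'(EuclideanSpace ℝ (Fin n), ℂ) :=
  ContinuousLinearMap.toPointwiseConvergenceCLM _ _ _ _ <|
    SchwartzMap.mkCLMtoNormedSpace (σ := RingHom.id ℂ) (fun φ => ∫ x, φ x * g x)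
      (fun φ ψ => by
        simp only [add_apply, add_mul]
        exact integral_add (hg.integrable φ) (hg.integrable ψ))
      (fun c φ => by
        simp only [smul_apply, smul_eq_mul, mul_assoc, RingHom.id_apply]
        exact integral_const_mul c _)
      (by
        obtain ⟨hm, k, hk⟩ := id hg
        refine ⟨Finset.Iic (k, 0), (∫ x, (1 + ‖x‖) ^ (-(k : ℝ)) * ‖g x‖) * 2 ^ k, ?_, ?_⟩
        · refine mul_nonneg (integral_nonneg fun x => ?_) (by positivity)
          positivity
        · intro φ
          refine (norm_integral_le_integral_norm _).trans ?_
          rw [mul_assoc, ← integral_mul_const]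
          refine integral_mono (hg.integrable φ).norm (hk.mul_const _) fun x => ?_
          simp only [norm_mul]
          calc ‖φ x‖ * ‖g x‖ ≤ _ :=
                mul_le_mul_of_nonneg_right (schwartz_norm_le k φ x) (norm_nonneg _)
            _ = _ := by ring)

theorem distOfTempered_apply {n : ℕ} (g : EuclideanSpace ℝ (Fin n) → ℂ) (hg : IsTemperedFun g)
    (φ : 𝓢(EuclideanSpace ℝ (Fin n), ℂ)) : distOfTempered g hg φ = ∫ x, φ x * g x := rfl

open Classical in
/-- The tempered distribution `φ ↦ ∫ φ g`; the value `0` for functions `g` without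
`IsTemperedFun g` is never relevant. -/
def distOf {n : ℕ} (g : EuclideanSpace ℝ (Fin n) → ℂ) : 𝓢'(EuclideanSpace ℝ (Fin n), ℂ) :=
  if hg : IsTemperedFun g then distOfTempered g hg else 0

/-- The Fourier transform of the tempered distribution `f` is (given by) a function. -/
def FourierIsFun {n : ℕ} (f : 𝓢'(EuclideanSpace ℝ (Fin n), ℂ)) : Prop :=
  ∃ g : EuclideanSpace ℝ (Fin n) → ℂ, IsTemperedFun g ∧ 𝓕 f = distOf g

open Classical in
/-- The function (unique up to null sets) that gives the Fourier transform of `f`, when there is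
one. The Fourier transform is Mathlib's, `∫ exp (-2 π i ⟨x, η⟩) f x dx`, so that the angular
frequency is `ξ = 2 π η`. -/
def fourierFun {n : ℕ} (f : 𝓢'(EuclideanSpace ℝ (Fin n), ℂ)) : EuclideanSpace ℝ (Fin n) → ℂ :=
  if h : FourierIsFun f then h.choose else 0

/-- The homogeneous Sobolev norm `‖ |ξ|^s f̂ ‖_{L²}`, where `ξ = 2 π η`. -/
def homSobolevNorm {n : ℕ} (s : ℝ) (f : 𝓢'(EuclideanSpace ℝ (Fin n), ℂ)) : ℝ≥0∞ :=
  eLpNorm (fun η => (2 * Real.pi * ‖η‖) ^ s • fourierFun f η) 2 volume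

/-- Membership in the homogeneous Sobolev space: `f` is a tempered distribution whose Fourier
transform is a function with `|ξ|^s f̂ ∈ L²`. -/
def MemHomSobolev {n : ℕ} (s : ℝ) (f : 𝓢'(EuclideanSpace ℝ (Fin n), ℂ)) : Prop :=
  FourierIsFun f ∧ MemLp (fun η => (2 * Real.pi * ‖η‖) ^ s • fourierFun f η) 2 volume

/-- The inhomogeneous Sobolev norm `‖ (1 + |ξ|²)^(s/2) f̂ ‖_{L²}`, where `ξ = 2 π η`. -/
def sobolevNorm {n : ℕ} (s : ℝ) (f : 𝓢'(EuclideanSpace ℝ (Fin n), ℂ)) : ℝ≥0∞ :=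
  eLpNorm (fun η => (1 + (2 * Real.pi * ‖η‖) ^ 2) ^ (s / 2) • fourierFun f η) 2 volume

/-- The linear propagator `S_a(t)`, given by `(S_a(t) f)^(ξ) = exp (-i t ξ₁ |ξ|^a) f̂(ξ)`, where
`ξ = 2 π η`. -/
def propagator {n : ℕ} [NeZero n] (a t : ℝ) (f : 𝓢'(EuclideanSpace ℝ (Fin n), ℂ)) :
    𝓢'(EuclideanSpace ℝ (Fin n), ℂ) :=
  𝓕⁻ (distOf fun η =>
    Complex.exp (-(Complex.I * ((t * (2 * Real.pi * η 0) * (2 * Real.pi * ‖η‖) ^ a : ℝ) : ℂ))) *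
      fourierFun f η)

/-- The norm of a time-dependent tempered distribution `U` in `L^q(I; L^p(ℝⁿ))`: the norm of the
strongly measurable function `u : I → L^p` that agrees with `U` almost everywhere on `I` (it is
unique up to null sets), and `∞` if there is none. -/
def mixedNorm {n : ℕ} (q p : ℝ≥0∞) [Fact (1 ≤ p)] (I : Set ℝ)
    (U : ℝ → 𝓢'(EuclideanSpace ℝ (Fin n), ℂ)) : ℝ≥0∞ :=
  ⨅ (u : ℝ → Lp ℂ p (volume : Measure (EuclideanSpace ℝ (Fin n))))
    (_ : AEStronglyMeasurable u (volume.restrict I))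
    (_ : ∀ᵐ t ∂(volume.restrict I), Lp.toTemperedDistribution (u t) = U t),
    eLpNorm u q (volume.restrict I)

end FractionalZK

end

noncomputable section

namespace FractionalZK

/-! ### A one-dimensional oscillatory integral -/

/-! Write n = m + 1. The relation between p and q says 1/2 − 1/p = 1/q, so s = (m − a)/q; with θ =
2/q this reads p = 2/(1 − θ) and 2s = θ(m − a). The theorem is a TT* argument resting on one
dispersive bound: the kernel of S_a(t) composed with the multiplier |ξ|^(−(m−a)+iγ) is O((1 +
|γ|)/|t|), uniformly in x and in the radii of a sharp frequency cutoff (`exists_kernel_bound`).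
Because of this uniformity no dyadic decomposition is needed.

The kernel bound holds because, up to factors 2π, the phase at ξ = rθ is rθ·(x − t r^a e₁), which is
linear in the spherical variable. The angular integral is thus exactly the Fourier transform of the
sphere, and this is an average of sinc functions of the modulus (`exists_sphere_fourier`). The
modulus is |t| r times the distance from r^a e₁ to x/t, while the Jacobian r^m and the weight
r^(−(m−a)) leave r^a. The substitution y ~ r^a turns what remains into the scale-free integral of
`oscIntegrand` with b = 1/a. It is bounded uniformly in the position c and the height h
(`intervalBound_oscIntegrand`): by integration by parts where the phase is far enough from
stationary, by the size of the integrand elsewhere.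

Stein interpolation of the kernel bound with Plancherel gives decay |t|^(−θ) from L^{p'} to L^p for
the multiplier |ξ|^(−θ(m−a)) (`exists_fixed_time_bound`). The Hardy–Littlewood–Sobolev inequality
`hls` sums this in time and bounds the transpose in L² (`exists_dualWave_bound`); testing against
truncated extremizers returns the mixed norm (`exists_wave_bound`). The endpoint q = ∞ is Plancherel
alone.

General data are approximated by bounded functions supported in annuli, the solutions converge in
L^q(L^p), and the limit is identified with the propagator by testing against Schwartz functions
(`mixedNorm_propagator_le`). Part (ii) follows from part (i) because s ≥ 0. -/

/-- All integrals of `f` over compact intervals contained in `s` are bounded by `C`. -/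
def IntervalBound (f : ℝ → ℂ) (s : Set ℝ) (C : ℝ) : Prop :=
  ∀ α β, α ≤ β → Set.Icc α β ⊆ s → ‖∫ y in α..β, f y‖ ≤ C

theorem IntervalBound.mono {f : ℝ → ℂ} {s t : Set ℝ} {C C' : ℝ} (h : IntervalBound f s C)
    (hst : t ⊆ s) (hC : C ≤ C') : IntervalBound f t C' :=
  fun α β hαβ hs => (h α β hαβ (hs.trans hst)).trans hC

theorem IntervalBound.split {f : ℝ → ℂ} {s : Set ℝ} {C₁ C₂ : ℝ} (hf : ContinuousOn f s) (p : ℝ)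
    (h₁ : IntervalBound f (s ∩ Set.Iic p) C₁) (h₂ : IntervalBound f (s ∩ Set.Ici p) C₂)
    (hC₁ : 0 ≤ C₁) (hC₂ : 0 ≤ C₂) : IntervalBound f s (C₁ + C₂) := by
  intro α β hαβ hs
  rcases le_total β p with hβ | hβ
  · exact (h₁ α β hαβ fun y hy => ⟨hs hy, hy.2.trans hβ⟩).trans (by linarith)
  rcases le_total p α with hα | hα
  · exact (h₂ α β hαβ fun y hy => ⟨hs hy, hα.trans hy.1⟩).trans (by linarith)
  have i₁ : IntervalIntegrable f volume α p :=
    (hf.mono (by rw [Set.uIcc_of_le hα]; exact (Set.Icc_subset_Icc_right hβ).trans hs)).intervalIntegrable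
  have i₂ : IntervalIntegrable f volume p β :=
    (hf.mono (by rw [Set.uIcc_of_le hβ]; exact (Set.Icc_subset_Icc_left hα).trans hs)).intervalIntegrable
  rw [← intervalIntegral.integral_add_adjacent_intervals i₁ i₂]
  refine (norm_add_le _ _).trans (add_le_add (h₁ _ _ hα ?_) (h₂ _ _ hβ ?_))
  · exact fun y hy => ⟨hs ⟨hy.1, hy.2.trans hβ⟩, hy.2⟩
  · exact fun y hy => ⟨hs ⟨hα.trans hy.1, hy.2⟩, hy.1⟩

theorem IntervalBound.of_norm_le {f : ℝ → ℂ} {s : Set ℝ} {B l : ℝ}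
    (hf : ∀ y ∈ s, ‖f y‖ ≤ B) (hB : 0 ≤ B) (hl : ∀ α β, α ≤ β → Set.Icc α β ⊆ s → β - α ≤ l) :
    IntervalBound f s (B * l) := by
  intro α β hαβ hs
  refine (intervalIntegral.norm_integral_le_of_norm_le_const (C := B) fun y hy => hf y (hs ?_)).trans ?_
  · rw [Set.uIoc_of_le hαβ] at hy
    exact Set.Ioc_subset_Icc_self hy
  · rw [abs_of_nonneg (by linarith)]
    exact mul_le_mul_of_nonneg_left (hl α β hαβ hs) hB

/-- The distance `√((y - c)² + h²)`. -/
def dist2 (c h y : ℝ) : ℝ := Real.sqrt ((y - c) ^ 2 + h ^ 2)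

/-- The integrand `y^(iγ) y^b sinc (y^b D(y))` with `D = dist2 c h`. -/
def oscIntegrand (b γ c h y : ℝ) : ℂ :=
  (y : ℂ) ^ (Complex.I * γ) * ((y ^ b * Real.sinc (y ^ b * dist2 c h y) : ℝ) : ℂ)

/-- The quadratic polynomial that governs the derivative of `y^b D(y)`. -/
def oscQuad (b c h y : ℝ) : ℝ := b * ((y - c) ^ 2 + h ^ 2) + y * (y - c)

theorem norm_ofReal_cpow_I {y : ℝ} (hy : 0 < y) (γ : ℝ) : ‖(y : ℂ) ^ (Complex.I * γ)‖ = 1 := by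
  rw [Complex.norm_cpow_eq_rpow_re_of_pos hy]
  simp

theorem continuousOn_oscIntegrand (b γ c h : ℝ) :
    ContinuousOn (oscIntegrand b γ c h) (Set.Ioi 0) := by
  unfold oscIntegrand dist2
  have h1 : ContinuousOn (fun y : ℝ => y ^ b) (Set.Ioi 0) := fun y hy =>
    (Real.continuousAt_rpow_const _ _ (Or.inl (ne_of_gt hy))).continuousWithinAt
  refine ContinuousOn.mul ?_ (Complex.continuous_ofReal.comp_continuousOn ?_)
  · intro y hy
    refine ContinuousAt.continuousWithinAt ?_
    exact (continuousAt_cpow_const (Complex.ofReal_mem_slitPlane.2 hy)).comp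
      Complex.continuous_ofReal.continuousAt
  · refine h1.mul (Real.continuous_sinc.comp_continuousOn (h1.mul ?_))
    fun_prop

theorem norm_oscIntegrand_le {b γ c h y : ℝ} (hy : 0 < y) : ‖oscIntegrand b γ c h y‖ ≤ y ^ b := by
  unfold oscIntegrand
  rw [norm_mul, norm_ofReal_cpow_I hy, one_mul, Complex.norm_real, Real.norm_eq_abs, abs_mul,
    abs_of_nonneg (by positivity)]
  exact mul_le_of_le_one_right (by positivity) (Real.abs_sinc_le_one _)

theorem oscIntegrand_eq {b γ c h y : ℝ} (hy : 0 < y) (hD : 0 < dist2 c h y) :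
    oscIntegrand b γ c h y = (y : ℂ) ^ (Complex.I * γ) *
      ((Real.sin (y ^ b * dist2 c h y) / dist2 c h y : ℝ) : ℂ) := by
  unfold oscIntegrand
  have : 0 < y ^ b := by positivity
  rw [Real.sinc_of_ne_zero (by positivity)]
  congr 2
  field_simp

theorem norm_oscIntegrand_le_inv {b γ c h y B : ℝ} (hy : 0 < y) (hB : 0 < B)
    (hD : B ≤ dist2 c h y) : ‖oscIntegrand b γ c h y‖ ≤ 1 / B := by
  have hD0 := hB.trans_le hD
  rw [oscIntegrand_eq hy hD0, norm_mul, norm_ofReal_cpow_I hy, one_mul, Complex.norm_real,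
    Real.norm_eq_abs, abs_div, abs_of_pos hD0]
  gcongr
  exact Real.abs_sin_le_one _

theorem abs_sub_le_dist2 (c h y : ℝ) : |y - c| ≤ dist2 c h y := by
  rw [dist2, ← Real.sqrt_sq_eq_abs]
  exact Real.sqrt_le_sqrt (by nlinarith [sq_nonneg h])

theorem abs_le_dist2 (c h y : ℝ) : |h| ≤ dist2 c h y := by
  rw [dist2, ← Real.sqrt_sq_eq_abs]
  exact Real.sqrt_le_sqrt (by nlinarith [sq_nonneg (y - c)])

/-- If D vanishes then y = c and h = 0, and Q vanishes too. So Q ≠ 0 alone makes the phase both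
smooth and non-stationary. -/
theorem dist2_pos_of_oscQuad_ne {b c h y : ℝ} (hQ : oscQuad b c h y ≠ 0) : 0 < dist2 c h y := by
  rw [dist2, Real.sqrt_pos]
  by_contra! hle
  have h1 : (y - c) = 0 := by nlinarith [sq_nonneg (y - c), sq_nonneg h]
  have h2 : h = 0 := by nlinarith [sq_nonneg (y - c), sq_nonneg h]
  exact hQ (by simp [oscQuad, h1, h2])

/-- The product rule gives y^(b−1)(bD² + y(y−c))/D. The factor 1/D also occurs in the amplitude, so
it cancels when the integrand is divided by the phase derivative and only the polynomial Q remains.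
-/
theorem hasDerivAt_oscPhase {b c h y : ℝ} (hy : 0 < y) (hD : 0 < dist2 c h y) :
    HasDerivAt (fun y => y ^ b * dist2 c h y) (y ^ (b - 1) * oscQuad b c h y / dist2 c h y) y := by
  have hpos : 0 < (y - c) ^ 2 + h ^ 2 := Real.sqrt_pos.1 hD
  have h1 : HasDerivAt (fun y => (y - c) ^ 2 + h ^ 2) (2 * (y - c)) y := by
    have := (((hasDerivAt_id y).sub_const c).pow 2).add_const (h ^ 2)
    simpa using this
  have h2 := h1.sqrt hpos.ne'
  have h3 := (Real.hasDerivAt_rpow_const (p := b) (Or.inl hy.ne')).mul h2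
  refine h3.congr_deriv ?_
  have hsq : dist2 c h y ^ 2 = (y - c) ^ 2 + h ^ 2 := Real.sq_sqrt hpos.le
  have hyb : y ^ b = y ^ (b - 1) * y := by
    rw [← Real.rpow_add_one hy.ne']; congr 1; ring
  change b * y ^ (b - 1) * dist2 c h y + y ^ b * (2 * (y - c) / (2 * dist2 c h y)) = _
  rw [hyb, oscQuad, ← hsq]
  field_simp

/-- Derivative of `oscQuad`. -/
def oscQuadDeriv (b c y : ℝ) : ℝ := 2 * (1 + b) * y - (1 + 2 * b) * c

theorem hasDerivAt_oscQuad (b c h y : ℝ) :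
    HasDerivAt (oscQuad b c h) (oscQuadDeriv b c y) y := by
  have h1 := ((((hasDerivAt_id y).sub_const c).pow 2).add_const (h ^ 2)).const_mul b
  have h2 := (hasDerivAt_id y).mul ((hasDerivAt_id y).sub_const c)
  refine (h1.add h2).congr_deriv ?_
  simp [oscQuadDeriv]; ring

/-- The hypothesis keeps e outside [α, β], so the antiderivative −1/(y − e) has no pole. On either
side of e one endpoint value has the favourable sign and the other is at most 1/δ. -/
theorem integral_inv_sub_sq_le {α β e δ : ℝ} (hαβ : α ≤ β) (hδ : 0 < δ)
    (he : ∀ y ∈ Set.Icc α β, δ ≤ |y - e|) :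
    IntervalIntegrable (fun y => 1 / (y - e) ^ 2) volume α β ∧
      ∫ y in α..β, 1 / (y - e) ^ 2 ≤ 1 / δ := by
  have hne : ∀ y ∈ Set.Icc α β, y - e ≠ 0 := fun y hy h0 => by
    have := he y hy; rw [h0, abs_zero] at this; linarith
  have hint : IntervalIntegrable (fun y => 1 / (y - e) ^ 2) volume α β := by
    refine ContinuousOn.intervalIntegrable ?_
    rw [Set.uIcc_of_le hαβ]
    exact continuousOn_const.div (by fun_prop) fun y hy => pow_ne_zero _ (hne y hy)
  refine ⟨hint, ?_⟩
  have hd : ∀ y ∈ Set.uIcc α β, HasDerivAt (fun y => -(y - e)⁻¹) (1 / (y - e) ^ 2) y := by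
    intro y hy
    rw [Set.uIcc_of_le hαβ] at hy
    have := (((hasDerivAt_id y).sub_const e).inv (hne y hy)).neg
    refine this.congr_deriv ?_
    simp [neg_div]
  rw [intervalIntegral.integral_eq_sub_of_hasDerivAt hd hint]
  have hα := he α ⟨le_rfl, hαβ⟩
  have hβ := he β ⟨hαβ, le_rfl⟩
  rcases lt_or_ge e α with hlt | hge
  · rw [abs_of_pos (by linarith)] at hα hβ
    have := one_div_le_one_div_of_le hδ hα
    have h3 : 0 < (β - e)⁻¹ := inv_pos.2 (by linarith)
    rw [one_div, one_div] at this
    rw [one_div]; linarith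
  rcases lt_or_ge β e with hlt' | hge'
  · rw [abs_of_neg (by linarith)] at hα hβ
    have := one_div_le_one_div_of_le hδ hβ
    have h3 : 0 < (-(α - e))⁻¹ := inv_pos.2 (by linarith)
    rw [one_div, one_div, inv_neg] at this
    rw [inv_neg] at h3
    rw [one_div]; linarith
  · have := he e ⟨hge, hge'⟩
    simp at this; linarith

/-- Non-stationary phase by one integration by parts. `M₁` controls the boundary terms; `M₂`
dominates the derivative of the new amplitude by a multiple of (y − e)^(−2), so that no monotonicity
of the phase derivative is required. -/
theorem norm_integral_oscIntegrand_le {b γ c h α β e δ M₁ M₂ : ℝ} (hb₀ : 0 ≤ b) (hb₁ : b ≤ 1)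
    (hα : 0 < α) (hαβ : α ≤ β)
    (hδ : 0 < δ) (he : ∀ y ∈ Set.Icc α β, δ ≤ |y - e|)
    (hQ : ∀ y ∈ Set.Icc α β, oscQuad b c h y ≠ 0)
    (hM₁ : ∀ y ∈ Set.Icc α β, y ^ (1 - b) / |oscQuad b c h y| ≤ M₁)
    (hM₂ : ∀ y ∈ Set.Icc α β, (1 + |γ|) * y ^ (-b) / |oscQuad b c h y| +
      y ^ (1 - b) * |oscQuadDeriv b c y| / |oscQuad b c h y| ^ 2 ≤ M₂ * (1 / (y - e) ^ 2)) :
    ‖∫ y in α..β, oscIntegrand b γ c h y‖ ≤ 2 * M₁ + M₂ * (1 / δ) := by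
  have huI : Set.uIcc α β = Set.Icc α β := Set.uIcc_of_le hαβ
  have hpos : ∀ y ∈ Set.Icc α β, 0 < y := fun y hy => hα.trans_le hy.1
  -- Division by the phase derivative replaces y^(iγ)/D by `G` = y^(1−b+iγ)/Q; the integrand is then
  -- `G * v'`.
  set z : ℂ := 1 - b + Complex.I * γ with hz
  set G : ℝ → ℂ := fun y => (y : ℂ) ^ z / (oscQuad b c h y : ℂ) with hG
  set G' : ℝ → ℂ := fun y => (z * (y : ℂ) ^ (z - 1) * (oscQuad b c h y : ℂ) -
    (y : ℂ) ^ z * (oscQuadDeriv b c y : ℂ)) / (oscQuad b c h y : ℂ) ^ 2 with hG'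
  set v : ℝ → ℂ := fun y => ((-Real.cos (y ^ b * dist2 c h y) : ℝ) : ℂ) with hv
  set v' : ℝ → ℂ := fun y => ((Real.sin (y ^ b * dist2 c h y) *
    (y ^ (b - 1) * oscQuad b c h y / dist2 c h y) : ℝ) : ℂ) with hv'
  have dG : ∀ y ∈ Set.uIcc α β, HasDerivAt G (G' y) y := by
    rw [huI]
    intro y hy
    have hy0 := hpos y hy
    have h1 : HasDerivAt (fun y : ℝ => (y : ℂ) ^ z) (z * (y : ℂ) ^ (z - 1) * 1) y :=
      ((hasDerivAt_id (y : ℂ)).cpow_const (Complex.ofReal_mem_slitPlane.2 hy0)).comp_ofReal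
    have h2 := (hasDerivAt_oscQuad b c h y).ofReal_comp
    refine (h1.div h2 (by exact_mod_cast hQ y hy)).congr_deriv ?_
    rw [hG', mul_one]
  have dv : ∀ y ∈ Set.uIcc α β, HasDerivAt v (v' y) y := by
    rw [huI]
    intro y hy
    have h1 := (hasDerivAt_oscPhase (b := b) (hpos y hy) (dist2_pos_of_oscQuad_ne (hQ y hy))).cos.neg
    refine h1.ofReal_comp.congr_deriv ?_
    rw [hv']; push_cast; ring
  have cpc : ∀ w : ℂ, ContinuousOn (fun y : ℝ => (y : ℂ) ^ w) (Set.Icc α β) := fun w y hy =>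
    ((continuousAt_cpow_const (Complex.ofReal_mem_slitPlane.2 (hpos y hy))).comp
      Complex.continuous_ofReal.continuousAt).continuousWithinAt
  have rpc : ∀ w : ℝ, ContinuousOn (fun y : ℝ => y ^ w) (Set.Icc α β) := fun w y hy =>
    (Real.continuousAt_rpow_const _ _ (Or.inl (hpos y hy).ne')).continuousWithinAt
  have cQ : Continuous (oscQuad b c h) := by unfold oscQuad; fun_prop
  have cQ' : Continuous (oscQuadDeriv b c) := by unfold oscQuadDeriv; fun_prop
  have cD : Continuous (dist2 c h) := by unfold dist2; fun_prop
  have iG' : ContinuousOn G' (Set.Icc α β) := by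
    refine ContinuousOn.div ?_ (by fun_prop) fun y hy => pow_ne_zero _ (by exact_mod_cast hQ y hy)
    have := cpc z; have := cpc (z - 1)
    fun_prop
  have iv' : ContinuousOn v' (Set.Icc α β) := by
    refine Complex.continuous_ofReal.comp_continuousOn ?_
    refine ContinuousOn.mul ?_ (ContinuousOn.div ?_ cD.continuousOn
      fun y hy => (dist2_pos_of_oscQuad_ne (hQ y hy)).ne')
    · exact Real.continuous_sin.comp_continuousOn ((rpc b).mul cD.continuousOn)
    · exact (rpc (b - 1)).mul cQ.continuousOn
  have hfe : ∫ y in α..β, oscIntegrand b γ c h y = ∫ y in α..β, G y * v' y := by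
    refine intervalIntegral.integral_congr fun y hy => ?_
    rw [huI] at hy
    have hy0 := hpos y hy
    have hD := dist2_pos_of_oscQuad_ne (hQ y hy)
    have hQ0 : (oscQuad b c h y : ℂ) ≠ 0 := by exact_mod_cast hQ y hy
    have hyC : (y : ℂ) ≠ 0 := by exact_mod_cast hy0.ne'
    have e1 : (y : ℂ) ^ (Complex.I * γ) = (y : ℂ) ^ z * ((y ^ (b - 1) : ℝ) : ℂ) := by
      rw [Complex.ofReal_cpow hy0.le, ← Complex.cpow_add _ _ hyC]
      congr 1; rw [hz]; push_cast; ring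
    simp only [hG, hv']
    rw [oscIntegrand_eq hy0 hD, e1]
    push_cast
    field_simp
  rw [hfe, intervalIntegral.integral_mul_deriv_eq_deriv_mul dG dv
    (iG'.mono huI.le).intervalIntegrable (iv'.mono huI.le).intervalIntegrable]
  have nv : ∀ y, ‖v y‖ ≤ 1 := fun y => by
    rw [hv]; simp only [Complex.norm_real, norm_neg, Real.norm_eq_abs]
    exact Real.abs_cos_le_one _
  have nz : ∀ y ∈ Set.Icc α β, ‖(y : ℂ) ^ z‖ = y ^ (1 - b) := fun y hy => by
    rw [Complex.norm_cpow_eq_rpow_re_of_pos (hpos y hy)]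
    simp [hz]
  have nz' : ∀ y ∈ Set.Icc α β, ‖(y : ℂ) ^ (z - 1)‖ = y ^ (-b) := fun y hy => by
    rw [Complex.norm_cpow_eq_rpow_re_of_pos (hpos y hy)]
    simp [hz]
  have nG : ∀ y ∈ Set.Icc α β, ‖G y * v y‖ ≤ M₁ := fun y hy => by
    rw [norm_mul]
    refine (mul_le_of_le_one_right (norm_nonneg _) (nv y)).trans ?_
    rw [hG]; simp only
    rw [norm_div, nz y hy, Complex.norm_real]
    exact hM₁ y hy
  have nzz : ‖z‖ ≤ 1 + |γ| := by
    refine (norm_add_le _ _).trans (add_le_add ?_ (by simp))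
    rw [← Complex.ofReal_one, ← Complex.ofReal_sub, Complex.norm_real, Real.norm_eq_abs, abs_le]
    constructor <;> linarith
  have hinv := integral_inv_sub_sq_le hαβ hδ he
  have nG' : ‖∫ y in α..β, G' y * v y‖ ≤ M₂ * (1 / δ) := by
    have hM₂0 : 0 ≤ M₂ := by
      have h1 := hM₂ α ⟨le_rfl, hαβ⟩
      have h2 : 0 < 1 / (α - e) ^ 2 := by
        have := he α ⟨le_rfl, hαβ⟩
        have : α - e ≠ 0 := fun h0 => by rw [h0, abs_zero] at this; linarith
        positivity
      have h3 : 0 ≤ M₂ * (1 / (α - e) ^ 2) := le_trans (by positivity) h1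
      by_contra! hneg
      nlinarith
    calc _ ≤ ∫ y in α..β, M₂ * (1 / (y - e) ^ 2) := by
          refine intervalIntegral.norm_integral_le_of_norm_le hαβ ?_ (hinv.1.const_mul _)
          refine Filter.Eventually.of_forall fun y hy' => ?_
          have hy : y ∈ Set.Icc α β := Set.Ioc_subset_Icc_self hy'
          rw [norm_mul]
          refine (mul_le_of_le_one_right (norm_nonneg _) (nv y)).trans ((?_ : _ ≤ _).trans (hM₂ y hy))
          have hQp : 0 < |oscQuad b c h y| := abs_pos.2 (hQ y hy)
          rw [hG']; simp only
          rw [norm_div, norm_pow, Complex.norm_real, Real.norm_eq_abs]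
          have hyb : 0 < y ^ (-b) := Real.rpow_pos_of_pos (hpos y hy) _
          have : ‖z * (y : ℂ) ^ (z - 1) * (oscQuad b c h y : ℂ) -
              (y : ℂ) ^ z * (oscQuadDeriv b c y : ℂ)‖ ≤
              (1 + |γ|) * y ^ (-b) * |oscQuad b c h y| + y ^ (1 - b) * |oscQuadDeriv b c y| := by
            refine (norm_sub_le _ _).trans (add_le_add ?_ ?_)
            · rw [norm_mul, norm_mul, nz' y hy, Complex.norm_real, Real.norm_eq_abs]
              gcongr
            · rw [norm_mul, nz y hy, Complex.norm_real, Real.norm_eq_abs]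
          refine (div_le_div_of_nonneg_right this (by positivity)).trans (le_of_eq ?_)
          field_simp
      _ = M₂ * ∫ y in α..β, (1 / (y - e) ^ 2) := intervalIntegral.integral_const_mul _ _
      _ ≤ _ := mul_le_mul_of_nonneg_left hinv.2 hM₂0
  calc _ ≤ ‖G β * v β‖ + ‖G α * v α‖ + ‖∫ y in α..β, G' y * v y‖ :=
        (norm_sub_le _ _).trans (by gcongr; exact norm_sub_le _ _)
    _ ≤ M₁ + M₁ + M₂ * (1 / δ) := by
        gcongr
        · exact nG β ⟨hαβ, le_rfl⟩
        · exact nG α ⟨le_rfl, hαβ⟩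
    _ = _ := by ring

/-- For c ≤ 4 the point c is no large parameter: the trivial bound serves up to y = 5, and beyond 5
the polynomial Q is comparable from below to y(y + |c|), so one integration by parts with e = 0
suffices, whatever h is. -/
theorem intervalBound_oscIntegrand_of_le {b γ c h : ℝ} (hb₀ : 0 ≤ b) (hb₁ : b ≤ 1) (hc : c ≤ 4) :
    IntervalBound (oscIntegrand b γ c h) (Set.Ioi 0) (500 * (1 + |γ|)) := by
  have hγ := abs_nonneg γ
  have key : IntervalBound (oscIntegrand b γ c h) (Set.Ioi 0)
      (5 * 5 + (2 * 10 + (410 * (1 + |γ|)) * (1 / 1))) := by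
    refine IntervalBound.split (continuousOn_oscIntegrand _ _ _ _) 5 ?_ ?_ (by norm_num)
      (by positivity)
    · refine IntervalBound.of_norm_le (fun y hy => ?_) (by norm_num) fun α β hαβ hs => ?_
      · have h0 : 0 < y := hy.1
        have h5 : y ≤ 5 := hy.2
        refine (norm_oscIntegrand_le h0).trans ?_
        calc y ^ b ≤ 5 ^ b := Real.rpow_le_rpow h0.le h5 hb₀
          _ ≤ 5 ^ (1 : ℝ) := Real.rpow_le_rpow_of_exponent_le (by norm_num) hb₁
          _ = 5 := Real.rpow_one 5
      · have h1 : 0 < α := (hs ⟨le_rfl, hαβ⟩).1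
        have h2 : β ≤ 5 := (hs ⟨hαβ, le_rfl⟩).2
        linarith
    · intro α β hαβ hs
      have hα : 5 ≤ α := (hs ⟨le_rfl, hαβ⟩).2
      have hQ : ∀ y ∈ Set.Icc α β, y * (y + |c|) / 10 ≤ oscQuad b c h y := fun y hy => by
        have hy5 : 5 ≤ y := hα.trans hy.1
        have : 0 ≤ b * ((y - c) ^ 2 + h ^ 2) := by positivity
        -- For c ≥ 0 this is 11c ≤ 9y, which c ≤ 4 and y ≥ 5 just give.
        have h2 : (y + |c|) / 10 ≤ y - c := by
          rcases abs_cases c with ⟨h, h'⟩ | ⟨h, h'⟩ <;> rw [h] <;> linarith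
        rw [oscQuad]
        nlinarith
      have hQ2 : ∀ y ∈ Set.Icc α β, y ^ 2 / 10 ≤ oscQuad b c h y := fun y hy => by
        have hy5 : 5 ≤ y := hα.trans hy.1
        have := hQ y hy
        nlinarith [abs_nonneg c]
      have hQ0 : ∀ y ∈ Set.Icc α β, 0 < oscQuad b c h y := fun y hy => by
        have hy5 : 5 ≤ y := hα.trans hy.1
        exact lt_of_lt_of_le (by positivity) (hQ2 y hy)
      have hp : ∀ y ∈ Set.Icc α β, y ^ (1 - b) ≤ y := fun y hy => by
        have hy5 : 5 ≤ y := hα.trans hy.1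
        calc y ^ (1 - b) ≤ y ^ (1 : ℝ) :=
              Real.rpow_le_rpow_of_exponent_le (by linarith) (by linarith)
          _ = y := Real.rpow_one y
      refine norm_integral_oscIntegrand_le (e := 0) hb₀ hb₁ (by linarith) hαβ one_pos
        (fun y hy => ?_) (fun y hy => (hQ0 y hy).ne') (fun y hy => ?_) (fun y hy => ?_)
      · have hy5 : 5 ≤ y := hα.trans hy.1
        rw [sub_zero, abs_of_nonneg (by linarith)]; linarith
      · have hy5 : 5 ≤ y := hα.trans hy.1
        rw [abs_of_pos (hQ0 y hy), div_le_iff₀ (hQ0 y hy)]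
        have := hp y hy; have := hQ2 y hy
        nlinarith
      · have hy5 : 5 ≤ y := hα.trans hy.1
        have hq := hQ0 y hy
        rw [abs_of_pos hq, sub_zero]
        have hyb : y ^ (-b) ≤ 1 := Real.rpow_le_one_of_one_le_of_nonpos (by linarith) (by linarith)
        have hyp : 0 < y ^ (1 - b) := Real.rpow_pos_of_pos (by linarith) _
        have hinv : 1 / oscQuad b c h y ≤ 10 * (1 / y ^ 2) := by
          rw [mul_one_div, div_le_div_iff₀ hq (by positivity)]
          have := hQ2 y hy; linarith
        have h1 : (1 + |γ|) * y ^ (-b) / oscQuad b c h y ≤ (1 + |γ|) * (10 * (1 / y ^ 2)) := by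
          rw [mul_div_assoc]
          refine mul_le_mul_of_nonneg_left ((div_le_div_of_nonneg_right hyb hq.le).trans hinv)
            (by positivity)
        have hQ' : |oscQuadDeriv b c y| ≤ 4 * (y + |c|) := by
          have := abs_nonneg c; have := neg_abs_le c; have := le_abs_self c
          rw [oscQuadDeriv, abs_le]; constructor <;> nlinarith
        have h2 : y ^ (1 - b) * |oscQuadDeriv b c y| / oscQuad b c h y ^ 2 ≤
            40 * (10 * (1 / y ^ 2)) := by
          calc _ ≤ 40 * oscQuad b c h y / oscQuad b c h y ^ 2 := by
                refine div_le_div_of_nonneg_right ?_ (by positivity)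
                have h4 : y ^ (1 - b) * |oscQuadDeriv b c y| ≤ y * (4 * (y + |c|)) :=
                  mul_le_mul (hp y hy) hQ' (abs_nonneg _) (by linarith)
                have := hQ y hy
                linarith
            _ = 40 * (1 / oscQuad b c h y) := by field_simp
            _ ≤ _ := by gcongr
        have h3 : 0 ≤ 1 / y ^ 2 := by positivity
        nlinarith [mul_nonneg hγ h3]
  exact key.mono le_rfl (by linarith)

/-- Left of c the two terms of Q have opposite signs, so Q can vanish. The zeros are confined to
zones where the integrand's size times the length of the zone is bounded, either through c^b or
through 1/|h|. -/
theorem intervalBound_oscIntegrand_left {b γ c h : ℝ} (hb₀ : 0 ≤ b) (hb₁ : b ≤ 1) (hc : 4 < c) :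
    IntervalBound (oscIntegrand b γ c h) (Set.Icc (3 * c / 4) c)
      (1 + (1 + (2 * 4 + 22 * (1 + |γ|)))) := by
  have hγ := abs_nonneg γ
  have hc0 : 0 < c := by linarith
  -- The width κ satisfies c^b κ = 1, so the trivial bound on a stretch of length κ below c
  -- contributes at most 1.
  obtain ⟨κ, hκ⟩ : ∃ κ, κ = c ^ (-b) := ⟨_, rfl⟩
  have hκ0 : 0 < κ := hκ ▸ Real.rpow_pos_of_pos hc0 _
  have hκc : c ^ b * κ = 1 := by rw [hκ, ← Real.rpow_add hc0]; simp
  have hκc' : c ^ (1 - b) = c * κ := by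
    rw [hκ, sub_eq_add_neg, Real.rpow_add hc0, Real.rpow_one]
  have hcont : ∀ s : Set ℝ, s ⊆ Set.Ioi 0 → ContinuousOn (oscIntegrand b γ c h) s := fun s hs =>
    (continuousOn_oscIntegrand b γ c h).mono hs
  have hsub : Set.Icc (3 * c / 4) c ⊆ Set.Ioi 0 := fun y hy => lt_of_lt_of_le (by positivity) hy.1
  rw [add_comm (1 : ℝ) (1 + (2 * 4 + 22 * (1 + |γ|)))]
  refine IntervalBound.split (hcont _ hsub) (c - κ) ?_ ?_ (by positivity) (by norm_num)
  · rw [add_comm (1 : ℝ)]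
    -- Left of c − 4h²/c one has h² ≤ c(c − y)/4, and y(y − c) dominates the positive term of Q.
    -- Right of it Q may vanish, but the integrand is at most 1/|h| on an interval of length at most
    -- |h|.
    refine IntervalBound.split (hcont _ (Set.inter_subset_left.trans hsub)) (c - 4 * h ^ 2 / c)
      ?_ ?_ (by positivity) (by norm_num)
    · intro α β hαβ hs
      have hv : ∀ y ∈ Set.Icc α β, 3 * c / 4 ≤ y ∧ κ ≤ c - y ∧ h ^ 2 ≤ c * (c - y) / 4 := by
        intro y hy
        obtain ⟨⟨h1, h2⟩, h3⟩ := hs hy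
        have h4 : 4 * h ^ 2 / c ≤ c - y := by
          have : y ≤ c - 4 * h ^ 2 / c := h3
          linarith
        rw [div_le_iff₀ hc0] at h4
        have h2' : y ≤ c - κ := h2
        exact ⟨h1.1, by linarith, by linarith⟩
      have hQ : ∀ y ∈ Set.Icc α β, c * (c - y) / 4 ≤ -oscQuad b c h y := fun y hy => by
        obtain ⟨h1, h2, h3⟩ := hv y hy
        have h4 : b * ((y - c) ^ 2 + h ^ 2) ≤ (c - y) ^ 2 + h ^ 2 := by
          have : 0 ≤ (y - c) ^ 2 + h ^ 2 := by positivity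
          nlinarith
        rw [oscQuad]; nlinarith
      have hab : ∀ y ∈ Set.Icc α β, c * (c - y) / 4 ≤ |oscQuad b c h y| := fun y hy =>
        (hQ y hy).trans (neg_le_abs _)
      have hq0 : ∀ y ∈ Set.Icc α β, 0 < c * (c - y) / 4 := fun y hy => by
        have : 0 < c - y := by linarith [(hv y hy).2.1]
        positivity
      have hyp : ∀ y ∈ Set.Icc α β, y ^ (1 - b) ≤ c * κ := fun y hy => by
        rw [← hκc']
        exact Real.rpow_le_rpow (by linarith [(hv y hy).1]) (by linarith [(hv y hy).2.1])
          (by linarith)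
      have := norm_integral_oscIntegrand_le (b := b) (γ := γ) (c := c) (h := h) (e := c) (δ := κ)
        (M₁ := 4) (M₂ := 22 * (1 + |γ|) * κ) hb₀ hb₁ (hsub (hs ⟨le_rfl, hαβ⟩).1.1) hαβ hκ0
        (fun y hy => ?_) (fun y hy h0 => ?_) (fun y hy => ?_) (fun y hy => ?_)
      · refine this.trans (le_of_eq ?_); field_simp
      · have := (hv y hy).2.1
        rw [abs_of_neg (by linarith)]; linarith
      · have h1 := hab y hy; have h2 := hq0 y hy
        rw [h0, abs_zero] at h1; linarith
      · have h1 := hab y hy; have h2 := hq0 y hy; have h3 := hyp y hy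
        rw [div_le_iff₀ (by linarith)]
        nlinarith [(hv y hy).2.1]
      · obtain ⟨h1, h2, h3⟩ := hv y hy
        have hy0 : 0 < y := by linarith
        have hw : 0 < c - y := by linarith
        have hwc : c - y ≤ c := by linarith
        have hyb : y ^ (-b) ≤ 4 / 3 * κ := by
          have e : y ^ (-b) = y ^ (1 - b) / y := by
            rw [sub_eq_add_neg, Real.rpow_add hy0, Real.rpow_one]; field_simp
          rw [e, div_le_iff₀ hy0]
          refine (hyp y hy).trans ?_
          nlinarith
        have hQ' : |oscQuadDeriv b c y| ≤ c := by
          rw [oscQuadDeriv, abs_le]; constructor <;> nlinarith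
        have e1 : (1 + |γ|) * y ^ (-b) / |oscQuad b c h y| ≤
            (1 + |γ|) * (4 / 3 * κ) / (c * (c - y) / 4) := by
          have := hq0 y hy
          gcongr
          exact hab y hy
        have e2 : y ^ (1 - b) * |oscQuadDeriv b c y| / |oscQuad b c h y| ^ 2 ≤
            (c * κ) * c / (c * (c - y) / 4) ^ 2 := by
          have := hq0 y hy
          gcongr
          · exact hyp y hy
          · exact hab y hy
        have e3 : (c * κ) * c / (c * (c - y) / 4) ^ 2 = 16 * κ * (1 / (y - c) ^ 2) := by
          rw [← neg_sub c y, neg_sq]; field_simp; norm_num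
        have e4 : (1 + |γ|) * (4 / 3 * κ) / (c * (c - y) / 4) ≤
            6 * (1 + |γ|) * κ * (1 / (y - c) ^ 2) := by
          rw [← neg_sub c y, neg_sq, mul_one_div, div_le_div_iff₀ (hq0 y hy) (by positivity)]
          have : (c - y) ^ 2 ≤ c * (c - y) := by nlinarith
          have h5 : 0 ≤ (1 + |γ|) * κ := by positivity
          nlinarith
        have h6 : 0 ≤ |γ| * κ * (1 / (y - c) ^ 2) := by positivity
        nlinarith
    · intro α β hαβ hs
      have hα := hs ⟨le_rfl, hαβ⟩
      have hβ := hs ⟨hαβ, le_rfl⟩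
      have hβc : β ≤ c - κ := hβ.1.2
      have h1 : 0 ≤ β - α := by linarith
      have h3 : β - α ≤ c / 4 := by linarith [hα.1.1.1, hβ.1.1.2]
      have h4 : c - α ≤ 4 * h ^ 2 / c := by
        have : c - 4 * h ^ 2 / c ≤ α := hα.2
        linarith
      -- One factor is at most c/4 and the other at most 4h²/c.
      have h5 : (β - α) ^ 2 ≤ h ^ 2 := by
        rw [le_div_iff₀ hc0] at h4
        nlinarith
      have hh : 0 < |h| := by
        rw [abs_pos]; rintro rfl
        norm_num at h4; linarith
      refine (intervalIntegral.norm_integral_le_of_norm_le_const (C := 1 / |h|)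
        fun y hy => ?_).trans ?_
      · rw [Set.uIoc_of_le hαβ] at hy
        exact norm_oscIntegrand_le_inv (hsub (hs (Set.Ioc_subset_Icc_self hy)).1.1) hh
          (abs_le_dist2 _ _ _)
      · rw [one_div_mul_eq_div, div_le_one hh]
        exact sq_le_sq.1 h5
  · have := IntervalBound.of_norm_le (f := oscIntegrand b γ c h)
      (s := Set.Icc (3 * c / 4) c ∩ Set.Ici (c - κ)) (B := c ^ b) (l := κ) (fun y hy => ?_)
      (by positivity) fun α β hαβ hs => ?_
    · rwa [hκc] at this
    · exact (norm_oscIntegrand_le (hsub hy.1)).trans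
        (Real.rpow_le_rpow (hsub hy.1).le hy.1.2 hb₀)
    · have h1 : c - κ ≤ α := (hs ⟨le_rfl, hαβ⟩).2
      have h2 : β ≤ c := (hs ⟨hαβ, le_rfl⟩).1.2
      linarith

/-- Right of c both terms of Q are nonnegative, so Q ≥ y(y − c) independently of h. Only the stretch
of length κ next to c needs the trivial bound. -/
theorem intervalBound_oscIntegrand_right {b γ c h : ℝ} (hb₀ : 0 ≤ b) (hb₁ : b ≤ 1) (hc : 4 < c) :
    IntervalBound (oscIntegrand b γ c h) (Set.Ici c)
      (2 + (2 * 1 + 5 * (1 + |γ|))) := by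
  have hγ := abs_nonneg γ
  have hc0 : 0 < c := by linarith
  obtain ⟨κ, hκ⟩ : ∃ κ, κ = c ^ (-b) := ⟨_, rfl⟩
  have hκ0 : 0 < κ := hκ ▸ Real.rpow_pos_of_pos hc0 _
  have hκ1 : κ ≤ 1 := hκ ▸ Real.rpow_le_one_of_one_le_of_nonpos (by linarith) (by linarith)
  have hκc : c ^ b * κ = 1 := by rw [hκ, ← Real.rpow_add hc0]; simp
  have hsub : Set.Ici c ⊆ Set.Ioi 0 := fun y hy => lt_of_lt_of_le hc0 hy
  refine IntervalBound.split ((continuousOn_oscIntegrand b γ c h).mono hsub) (c + κ) ?_ ?_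
    (by positivity) (by positivity)
  · have := IntervalBound.of_norm_le (f := oscIntegrand b γ c h)
      (s := Set.Ici c ∩ Set.Iic (c + κ)) (B := 2 * c ^ b) (l := κ) (fun y hy => ?_)
      (by positivity) fun α β hαβ hs => ?_
    · rwa [mul_assoc, hκc, mul_one] at this
    · have hy2 : y ≤ c + κ := hy.2
      have hy0 : 0 < y := hsub hy.1
      calc _ ≤ y ^ b := norm_oscIntegrand_le hy0
        _ ≤ (2 * c) ^ b := Real.rpow_le_rpow hy0.le (by linarith) hb₀
        _ = 2 ^ b * c ^ b := Real.mul_rpow (by norm_num) hc0.le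
        _ ≤ 2 * c ^ b := by
          gcongr
          calc (2 : ℝ) ^ b ≤ 2 ^ (1 : ℝ) := Real.rpow_le_rpow_of_exponent_le (by norm_num) hb₁
            _ = 2 := Real.rpow_one 2
    · have h1 : c ≤ α := (hs ⟨le_rfl, hαβ⟩).1
      have h2 : β ≤ c + κ := (hs ⟨hαβ, le_rfl⟩).2
      linarith
  · intro α β hαβ hs
    have hv : ∀ y ∈ Set.Icc α β, c ≤ y ∧ κ ≤ y - c := fun y hy => by
      have h1 : c + κ ≤ y := (hs hy).2
      exact ⟨(hs hy).1, by linarith⟩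
    have hab : ∀ y ∈ Set.Icc α β, y * (y - c) ≤ |oscQuad b c h y| := fun y hy => by
      refine le_trans ?_ (le_abs_self _)
      have : 0 ≤ b * ((y - c) ^ 2 + h ^ 2) := by positivity
      rw [oscQuad]; linarith
    have hq0 : ∀ y ∈ Set.Icc α β, 0 < y * (y - c) := fun y hy => by
      have := hv y hy
      exact mul_pos (by linarith) (by linarith)
    have hyb : ∀ y ∈ Set.Icc α β, y ^ (-b) ≤ κ := fun y hy => by
      rw [hκ]
      exact Real.rpow_le_rpow_of_nonpos hc0 (hv y hy).1 (by linarith)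
    have hyp : ∀ y ∈ Set.Icc α β, y ^ (1 - b) ≤ y * κ := fun y hy => by
      have hy0 : 0 < y := by linarith [(hv y hy).1]
      rw [sub_eq_add_neg, Real.rpow_add hy0, Real.rpow_one]
      exact mul_le_mul_of_nonneg_left (hyb y hy) hy0.le
    have := norm_integral_oscIntegrand_le (b := b) (γ := γ) (c := c) (h := h) (e := c) (δ := κ)
      (M₁ := 1) (M₂ := 5 * (1 + |γ|) * κ) hb₀ hb₁ (hsub (hs ⟨le_rfl, hαβ⟩).1) hαβ hκ0
      (fun y hy => ?_) (fun y hy h0 => ?_) (fun y hy => ?_) (fun y hy => ?_)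
    · refine this.trans (le_of_eq ?_); field_simp
    · exact (hv y hy).2.trans (le_abs_self _)
    · have h1 := hab y hy; have h2 := hq0 y hy
      rw [h0, abs_zero] at h1; linarith
    · have h1 := hab y hy; have h2 := hq0 y hy; have h3 := hyp y hy
      rw [div_le_iff₀ (by linarith)]
      have h4 := hv y hy
      have : y * κ ≤ y * (y - c) := mul_le_mul_of_nonneg_left h4.2 (by linarith)
      linarith
    · obtain ⟨h1, h2⟩ := hv y hy
      have hy0 : 0 < y := by linarith
      have hw : 0 < y - c := by linarith
      have hwc : y - c ≤ y := by linarith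
      have hQ' : |oscQuadDeriv b c y| ≤ 4 * y := by
        rw [oscQuadDeriv, abs_le]; constructor <;> nlinarith
      have e1 : (1 + |γ|) * y ^ (-b) / |oscQuad b c h y| ≤
          (1 + |γ|) * κ / (y * (y - c)) := by
        gcongr
        · exact hyb y hy
        · exact hab y hy
      have e2 : y ^ (1 - b) * |oscQuadDeriv b c y| / |oscQuad b c h y| ^ 2 ≤
          (y * κ) * (4 * y) / (y * (y - c)) ^ 2 := by
        have := hq0 y hy
        gcongr
        · exact hyp y hy
        · exact hab y hy
      have e3 : (y * κ) * (4 * y) / (y * (y - c)) ^ 2 = 4 * κ * (1 / (y - c) ^ 2) := by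
        field_simp
      have e4 : (1 + |γ|) * κ / (y * (y - c)) ≤ (1 + |γ|) * κ * (1 / (y - c) ^ 2) := by
        rw [mul_one_div]
        gcongr
        nlinarith
      have h6 : 0 ≤ |γ| * κ * (1 / (y - c) ^ 2) := by positivity
      nlinarith

/-- The uniform bound for the one-dimensional oscillatory integral. -/
theorem intervalBound_oscIntegrand {b γ c h : ℝ} (hb₀ : 0 ≤ b) (hb₁ : b ≤ 1) :
    IntervalBound (oscIntegrand b γ c h) (Set.Ioi 0) (500 * (1 + |γ|)) := by
  rcases le_or_gt c 4 with hc | hc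
  · exact intervalBound_oscIntegrand_of_le hb₀ hb₁ hc
  have hγ := abs_nonneg γ
  have hc0 : 0 < c := by linarith
  have hcont := continuousOn_oscIntegrand b γ c h
  have key : IntervalBound (oscIntegrand b γ c h) (Set.Ioi 0)
      ((4 / c * (3 * c / 4) + (1 + (1 + (2 * 4 + 22 * (1 + |γ|))))) +
        (2 + (2 * 1 + 5 * (1 + |γ|)))) := by
    refine IntervalBound.split hcont c ?_ ?_ (by positivity) (by positivity)
    · refine IntervalBound.split (hcont.mono Set.inter_subset_left) (3 * c / 4) ?_ ?_
        (by positivity) (by positivity)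
      -- Up to 3c/4 the integrand is at most 4/c. This also disposes of the second stationary point,
      -- which for h = 0 lies at bc/(1 + b) ≤ c/2.
      · refine IntervalBound.of_norm_le (fun y hy => ?_) (by positivity) fun α β hαβ hs => ?_
        · have h1 : y ≤ 3 * c / 4 := hy.2
          have h2 := norm_oscIntegrand_le_inv (b := b) (γ := γ) (c := c) (h := h) (y := y)
            (B := c / 4) hy.1.1 (by positivity) ?_
          · simpa using h2
          · refine le_trans ?_ (abs_sub_le_dist2 c h y)
            rw [abs_of_neg (by linarith)]; linarith
        · have h1 : 0 < α := (hs ⟨le_rfl, hαβ⟩).1.1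
          have h2 : β ≤ 3 * c / 4 := (hs ⟨hαβ, le_rfl⟩).2
          linarith
      · exact (intervalBound_oscIntegrand_left hb₀ hb₁ hc).mono
          (fun y hy => ⟨hy.2, hy.1.2⟩) le_rfl
    · exact (intervalBound_oscIntegrand_right hb₀ hb₁ hc).mono (fun y hy => hy.2) le_rfl
  refine key.mono le_rfl ?_
  have : 4 / c * (3 * c / 4) = 3 := by field_simp
  rw [this]; linarith

theorem dist2_mul {c h y m : ℝ} (hm : 0 < m) : dist2 (c / m) (h / m) (y / m) = dist2 c h y / m := by
  unfold dist2
  rw [← sub_div, div_pow, div_pow, ← add_div, Real.sqrt_div' _ (by positivity), Real.sqrt_sq hm.le]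

/-- The substitution y = (r/μ)^a turns this into the integral of `oscIntegrand` with b = 1/a and
with c, h rescaled by μ^a. Since the bound for that integral is uniform in c and h, the parameter
`lam` survives only as the Jacobian factor 1/`lam`, which is the source of the decay in time. -/
theorem norm_integral_sinc_le {a γ c h lam r₁ r₂ : ℝ} (ha : 1 ≤ a) (hlam : 0 < lam) (hr₁ : 0 < r₁)
    (hr : r₁ ≤ r₂) :
    ‖∫ r in r₁..r₂, (r : ℂ) ^ (Complex.I * γ) *
      ((r ^ a * Real.sinc (lam * (r * dist2 c h (r ^ a))) : ℝ) : ℂ)‖ ≤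
      500 * (1 + |γ|) / lam := by
  have ha0 : 0 < a := by linarith
  -- With μ^(1+a) = 1/`lam` the scaling absorbs `lam` from the argument of the sinc, and y^(1/a) dy
  -- = a `lam` r^a dr.
  obtain ⟨μ, hμ⟩ : ∃ μ, μ = lam ^ (-(1 / (1 + a))) := ⟨_, rfl⟩
  have hμ0 : 0 < μ := hμ ▸ Real.rpow_pos_of_pos hlam _
  have hμl : μ ^ (1 + a) = 1 / lam := by
    rw [hμ, ← Real.rpow_mul hlam.le, one_div lam, ← Real.rpow_neg_one]
    congr 1; field_simp
  have hμl' : μ * μ ^ a = 1 / lam := by rw [← hμl, Real.rpow_add hμ0, Real.rpow_one]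
  set f : ℝ → ℝ := fun r => (r / μ) ^ a with hf
  set f' : ℝ → ℝ := fun r => a * (r / μ) ^ (a - 1) / μ with hf'
  set g : ℝ → ℂ := oscIntegrand (1 / a) (γ / a) (c / μ ^ a) (h / μ ^ a) with hg
  have huI : Set.uIcc r₁ r₂ = Set.Icc r₁ r₂ := Set.uIcc_of_le hr
  have hpos : ∀ r ∈ Set.Icc r₁ r₂, 0 < r := fun r h => hr₁.trans_le h.1
  have hfpos : ∀ r ∈ Set.Icc r₁ r₂, 0 < f r := fun r h =>
    Real.rpow_pos_of_pos (div_pos (hpos r h) hμ0) _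
  have df : ∀ r ∈ Set.uIcc r₁ r₂, HasDerivAt f (f' r) r := by
    rw [huI]; intro r hr
    have h1 := ((hasDerivAt_id r).div_const μ).rpow_const (p := a)
      (Or.inl (div_pos (hpos r hr) hμ0).ne')
    refine h1.congr_deriv ?_
    simp only [hf', id]; ring
  have cf' : ContinuousOn f' (Set.uIcc r₁ r₂) := by
    rw [huI]; intro r hr
    refine ContinuousAt.continuousWithinAt ?_
    refine ContinuousAt.div_const (continuousAt_const.mul ?_) _
    exact ContinuousAt.rpow_const (by fun_prop) (Or.inl (div_pos (hpos r hr) hμ0).ne')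
  have hsub := intervalIntegral.integral_deriv_smul_comp' (g := g) df cf'
    ((continuousOn_oscIntegrand _ _ _ _).mono (by
      rw [huI]; rintro _ ⟨r, hr, rfl⟩; exact hfpos r hr))
  have key : ∫ r in r₁..r₂, (r : ℂ) ^ (Complex.I * γ) *
      ((r ^ a * Real.sinc (lam * (r * dist2 c h (r ^ a))) : ℝ) : ℂ) =
      ((μ : ℂ) ^ (Complex.I * γ) * ((1 / (lam * a) : ℝ) : ℂ)) * ∫ x in f r₁..f r₂, g x := by
    rw [← hsub, ← intervalIntegral.integral_const_mul]
    refine intervalIntegral.integral_congr fun r hr => ?_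
    rw [huI] at hr
    have hr0 := hpos r hr
    have hx0 : 0 < r / μ := div_pos hr0 hμ0
    have hfr : f r = r ^ a / μ ^ a := Real.div_rpow hr0.le hμ0.le _
    have hfb : f r ^ (1 / a) = r / μ := by
      rw [hf]; simp only
      rw [← Real.rpow_mul hx0.le, mul_one_div_cancel ha0.ne', Real.rpow_one]
    have hfγ : ((f r : ℝ) : ℂ) ^ (Complex.I * ((γ / a : ℝ) : ℂ)) =
        (r : ℂ) ^ (Complex.I * γ) / (μ : ℂ) ^ (Complex.I * γ) := by
      have e1 : (r : ℂ) = (μ : ℂ) * ((r / μ : ℝ) : ℂ) := by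
        push_cast; rw [mul_div_cancel₀]; exact_mod_cast hμ0.ne'
      have e2 : (r : ℂ) ^ (Complex.I * γ) = (μ : ℂ) ^ (Complex.I * γ) *
          ((r / μ : ℝ) : ℂ) ^ (Complex.I * γ) := by
        conv_lhs => rw [e1]
        rw [Complex.mul_cpow_ofReal_nonneg hμ0.le hx0.le]
      have e3 : ((f r : ℝ) : ℂ) = ((r / μ : ℝ) : ℂ) ^ (a : ℂ) := by
        rw [hf, ← Complex.ofReal_cpow hx0.le]
      have hne : (μ : ℂ) ^ (Complex.I * γ) ≠ 0 := by
        rw [Ne, Complex.cpow_eq_zero_iff]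
        rintro ⟨h0, -⟩
        exact hμ0.ne' (by exact_mod_cast h0)
      rw [e2, mul_div_cancel_left₀ _ hne, e3]
      rw [← Complex.ofReal_cpow hx0.le a, Complex.cpow_def_of_ne_zero (by
        exact_mod_cast (Real.rpow_pos_of_pos hx0 a).ne'), Complex.cpow_def_of_ne_zero (by
        exact_mod_cast hx0.ne'), ← Complex.ofReal_log (Real.rpow_pos_of_pos hx0 a).le,
        ← Complex.ofReal_log hx0.le, Real.log_rpow hx0]
      congr 1
      have : (a : ℂ) ≠ 0 := by exact_mod_cast ha0.ne'
      push_cast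
      field_simp
    have hne : (μ : ℂ) ^ (Complex.I * γ) ≠ 0 := by
      rw [Ne, Complex.cpow_eq_zero_iff]
      rintro ⟨h0, -⟩
      exact hμ0.ne' (by exact_mod_cast h0)
    have hμa : 0 < μ ^ a := Real.rpow_pos_of_pos hμ0 _
    have harg : r / μ * (dist2 c h (r ^ a) / μ ^ a) = lam * (r * dist2 c h (r ^ a)) := by
      rw [div_mul_div_comm, hμl']; field_simp
    have hpow : f' r * (r / μ) = a * lam * r ^ a := by
      have e1 : (r / μ) ^ (a - 1) * (r / μ) = r ^ a / μ ^ a := by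
        rw [← hfr, ← Real.rpow_add_one hx0.ne', sub_add_cancel]
      have e2 : f' r * (r / μ) = a / μ * ((r / μ) ^ (a - 1) * (r / μ)) := by rw [hf']; ring
      rw [e2, e1]
      have : lam = 1 / (μ * μ ^ a) := by rw [hμl', one_div_one_div]
      rw [this]
      field_simp
    simp only [Function.comp, hg, oscIntegrand]
    rw [hfγ, hfb, hfr, dist2_mul hμa, harg, Complex.real_smul]
    have hpow' : (f' r : ℂ) * ((r / μ : ℝ) : ℂ) = a * lam * ((r ^ a : ℝ) : ℂ) := by
      exact_mod_cast congrArg (fun t : ℝ => (t : ℂ)) hpow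
    have hl : (lam : ℂ) ≠ 0 := by exact_mod_cast hlam.ne'
    have haC : (a : ℂ) ≠ 0 := by exact_mod_cast ha0.ne'
    rw [Complex.ofReal_mul (r ^ a), Complex.ofReal_mul (r / μ)]
    calc _ = (r : ℂ) ^ (Complex.I * γ) * (((1 / (lam * a) : ℝ) : ℂ) *
          (a * lam * ((r ^ a : ℝ) : ℂ)) * ((Real.sinc (lam * (r * dist2 c h (r ^ a))) : ℝ) : ℂ)) := by
          push_cast; field_simp
      _ = _ := by rw [← hpow']; field_simp
  have hmono : f r₁ ≤ f r₂ := by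
    refine Real.rpow_le_rpow (div_pos hr₁ hμ0).le ?_ ha0.le
    gcongr
  have hb := intervalBound_oscIntegrand (b := 1 / a) (γ := γ / a) (c := c / μ ^ a) (h := h / μ ^ a)
    (by positivity) (by rw [div_le_one ha0]; exact ha) (f r₁) (f r₂) hmono
    (fun y hy => (hfpos r₁ ⟨le_rfl, hr⟩).trans_le hy.1)
  rw [key, norm_mul, norm_mul, norm_ofReal_cpow_I hμ0, one_mul, Complex.norm_real,
    Real.norm_of_nonneg (by positivity)]
  have hγ : |γ / a| ≤ |γ| := by
    rw [abs_div, abs_of_pos ha0]; exact div_le_self (abs_nonneg _) ha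
  calc _ ≤ 1 / (lam * a) * (500 * (1 + |γ|)) := by
        refine mul_le_mul_of_nonneg_left (hb.trans ?_) (by positivity)
        linarith
    _ ≤ 1 / lam * (500 * (1 + |γ|)) := by
        refine mul_le_mul_of_nonneg_right ?_ (by positivity)
        refine one_div_le_one_div_of_le hlam ?_
        nlinarith
    _ = _ := by ring

section

/-! ### Polar coordinates and the Fourier transform of the sphere -/

section Polar

variable {E : Type*} [NormedAddCommGroup E] [InnerProductSpace ℝ E] [FiniteDimensional ℝ E]
  [MeasurableSpace E] [BorelSpace E] [Nontrivial E]

theorem lintegral_polar {f : E → ℝ≥0∞} (hf : Measurable f) :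
    ∫⁻ x, f x = ∫⁻ θ, (∫⁻ r in Set.Ioi (0 : ℝ),
      ENNReal.ofReal (r ^ (Module.finrank ℝ E - 1)) * f (r • (θ : E)))
        ∂(volume : Measure E).toSphere := by
  have h1 := ((volume : Measure E).measurePreserving_homeomorphUnitSphereProd).symm
    (homeomorphUnitSphereProd E).toMeasurableEquiv
  have h2 := h1.lintegral_comp_emb (MeasurableEquiv.measurableEmbedding _)
    (fun x : ({0}ᶜ : Set E) => f x)
  have h4 : ∫⁻ x, f x = ∫⁻ x : ({0}ᶜ : Set E), f x ∂(Measure.comap Subtype.val volume) := by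
    rw [lintegral_subtype_comap (measurableSet_singleton _).compl, restrict_compl_singleton]
  refine h4.trans (h2.symm.trans ?_)
  change ∫⁻ p : Metric.sphere (0 : E) 1 × Set.Ioi (0 : ℝ), f ((p.2 : ℝ) • (p.1 : E)) ∂_ = _
  have hm : Measurable fun p : Metric.sphere (0 : E) 1 × Set.Ioi (0 : ℝ) =>
      f ((p.2 : ℝ) • (p.1 : E)) := hf.comp (by fun_prop)
  rw [lintegral_prod _ hm.aemeasurable]
  refine lintegral_congr fun θ => ?_
  rw [Measure.volumeIoiPow, lintegral_withDensity_eq_lintegral_mul _ (by fun_prop)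
    (g := fun r : Set.Ioi (0 : ℝ) => f ((r : ℝ) • (θ : E))) (hm.comp measurable_prodMk_left)]
  simp only [Pi.mul_apply]
  rw [lintegral_subtype_comap measurableSet_Ioi
    (fun r : ℝ => ENNReal.ofReal (r ^ (Module.finrank ℝ E - 1)) * f (r • (θ : E)))]

theorem integral_polar {f : E → ℂ} (hf : Integrable f) :
    ∫ x, f x = ∫ r in Set.Ioi (0 : ℝ), (r ^ (Module.finrank ℝ E - 1)) •
      ∫ θ, f (r • (θ : E)) ∂(volume : Measure E).toSphere := by
  have h1 := ((volume : Measure E).measurePreserving_homeomorphUnitSphereProd).symm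
    (homeomorphUnitSphereProd E).toMeasurableEquiv
  have h2 := h1.integral_comp (MeasurableEquiv.measurableEmbedding _)
    (fun x : ({0}ᶜ : Set E) => f x)
  have h3 := (h1.integrable_comp_emb (MeasurableEquiv.measurableEmbedding _)
    (g := fun x : ({0}ᶜ : Set E) => f x)).2 (by
      have := hf.integrableOn (s := ({0}ᶜ : Set E))
      rwa [integrableOn_iff_comap_subtypeVal (measurableSet_singleton _).compl] at this)
  have h4 : ∫ x, f x = ∫ x : ({0}ᶜ : Set E), f x ∂(Measure.comap Subtype.val volume) := by
    rw [integral_subtype_comap (measurableSet_singleton _).compl, restrict_compl_singleton]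
  refine h4.trans (h2.symm.trans ((integral_prod_symm _ h3).trans ?_))
  change ∫ r : Set.Ioi (0 : ℝ), (∫ θ : Metric.sphere (0 : E) 1, f ((r : ℝ) • (θ : E)) ∂_) ∂_ = _
  simp only [Measure.volumeIoiPow, ENNReal.ofReal]
  rw [integral_withDensity_eq_integral_smul (measurable_subtype_coe.pow_const _).real_toNNReal,
    integral_subtype_comap measurableSet_Ioi fun r : ℝ =>
      Real.toNNReal (r ^ (Module.finrank ℝ E - 1)) •
        ∫ θ : Metric.sphere (0 : E) 1, f (r • (θ : E)) ∂(volume : Measure E).toSphere]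
  refine setIntegral_congr_fun measurableSet_Ioi fun r hr => ?_
  rw [NNReal.smul_def, Real.coe_toNNReal _ (pow_nonneg (le_of_lt hr) _)]

/-- `∫₀¹ r^d dr` as an extended nonnegative number. -/
def radialMass (d : ℕ) : ℝ≥0∞ := ∫⁻ r in Set.Ioo (0 : ℝ) 1, ENNReal.ofReal (r ^ d)

theorem radialMass_ne_zero (d : ℕ) : radialMass d ≠ 0 := by
  unfold radialMass
  intro h
  rw [lintegral_eq_zero_iff (by fun_prop)] at h
  rw [Filter.EventuallyEq, ae_restrict_iff' measurableSet_Ioo] at h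
  have h2 : (volume : Measure ℝ) (Set.Ioo 0 1) = 0 := by
    refine measure_mono_null (fun r hr => ?_) h
    simp only [Set.mem_compl_iff, Set.mem_ofPred_eq, not_forall]
    refine ⟨hr, ?_⟩
    have := pow_pos hr.1 d
    simp only [Pi.zero_apply, ENNReal.ofReal_eq_zero, not_le]
    exact this
  simp at h2

theorem radialMass_ne_top (d : ℕ) : radialMass d ≠ ∞ := by
  unfold radialMass
  refine ne_of_lt ?_
  calc _ ≤ ∫⁻ r in Set.Ioo (0 : ℝ) 1, 1 := by
        refine setLIntegral_mono measurable_const fun r hr => ?_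
        rw [ENNReal.ofReal_le_one]
        exact pow_le_one₀ hr.1.le hr.2.le
    _ < ∞ := by simp

/-- Extending g(e·θ) homogeneously of degree 0 to the unit ball turns a surface integral into a
volume integral, which can be recomputed in other coordinates; the radial factor is finite and
nonzero and is cancelled later. -/
theorem lintegral_sphere_mul_radialMass {g : ℝ → ℝ≥0∞} (hg : Measurable g) (e : E) :
    (∫⁻ θ, g (inner ℝ e (θ : E)) ∂(volume : Measure E).toSphere) *
      radialMass (Module.finrank ℝ E - 1) =
      ∫⁻ x : E, g (inner ℝ e x / ‖x‖) * (Set.Iio (1 : ℝ)).indicator 1 ‖x‖ := by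
  have hW : Measurable ((Set.Iio (1 : ℝ)).indicator (1 : ℝ → ℝ≥0∞)) :=
    measurable_one.indicator measurableSet_Iio
  have hm : Measurable fun x : E => g (inner ℝ e x / ‖x‖) * (Set.Iio (1 : ℝ)).indicator 1 ‖x‖ := by
    refine (hg.comp ?_).mul (hW.comp measurable_norm)
    exact (by fun_prop : Measurable fun x : E => inner ℝ e x).div measurable_norm
  rw [lintegral_polar hm, ← lintegral_mul_const _ (f := fun θ : Metric.sphere (0 : E) 1 => g (inner ℝ e (θ : E)))
    (hg.comp (by fun_prop))]
  refine lintegral_congr fun θ => ?_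
  rw [radialMass, ← lintegral_const_mul _ (by fun_prop), ← lintegral_indicator measurableSet_Ioo,
    ← lintegral_indicator measurableSet_Ioi]
  refine lintegral_congr fun r => ?_
  have hθ : ‖(θ : E)‖ = 1 := by simp
  by_cases hr : 0 < r
  · rw [Set.indicator_of_mem (show r ∈ Set.Ioi 0 from hr), norm_smul, hθ, mul_one,
      Real.norm_of_nonneg hr.le, inner_smul_right, mul_div_cancel_left₀ _ hr.ne']
    by_cases hr1 : r < 1
    · rw [Set.indicator_of_mem (show r ∈ Set.Ioo 0 1 from ⟨hr, hr1⟩),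
        Set.indicator_of_mem (show r ∈ Set.Iio 1 from hr1)]
      simp [mul_comm]
    · rw [Set.indicator_of_notMem (show r ∉ Set.Iio 1 from hr1),
        Set.indicator_of_notMem (show r ∉ Set.Ioo 0 1 from fun h => hr1 h.2)]
      simp
  · rw [Set.indicator_of_notMem (show r ∉ Set.Ioo 0 1 from fun h => hr h.1),
      Set.indicator_of_notMem (show r ∉ Set.Ioi 0 from hr)]

end Polar

/-- Splitting off the first coordinate of a Euclidean space. -/
def sliceMap (m : ℕ) (x : EuclideanSpace ℝ (Fin (m + 1))) : ℝ × EuclideanSpace ℝ (Fin m) :=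
  (x 0, WithLp.toLp 2 fun i => x i.succ)

theorem measurePreserving_sliceMap (m : ℕ) :
    MeasurePreserving (sliceMap m) volume (volume.prod volume) := by
  have h1 := PiLp.volume_preserving_ofLp (Fin (m + 1))
  have h2 := volume_preserving_piFinSuccAbove (fun _ : Fin (m + 1) => ℝ) 0
  have h3 := (MeasurePreserving.id (volume : Measure ℝ)).prod (PiLp.volume_preserving_toLp (Fin m))
  exact h3.comp (h2.comp h1)

theorem norm_eq_sliceMap {m : ℕ} (x : EuclideanSpace ℝ (Fin (m + 1))) :
    ‖x‖ = Real.sqrt ((sliceMap m x).1 ^ 2 + ‖(sliceMap m x).2‖ ^ 2) := by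
  rw [EuclideanSpace.norm_eq, EuclideanSpace.norm_sq_eq, Fin.sum_univ_succ]
  simp [sliceMap]

/-- The mass of the unit sphere, as a factor in radial integration. -/
def sphereMass (m : ℕ) : ℝ≥0∞ :=
  (volume : Measure (EuclideanSpace ℝ (Fin m))).toSphere Set.univ

theorem lintegral_radial {m : ℕ} (hm : 1 ≤ m) {k : ℝ → ℝ≥0∞} (hk : Measurable k) :
    ∫⁻ η : EuclideanSpace ℝ (Fin m), k ‖η‖ =
      sphereMass m * ∫⁻ r in Set.Ioi (0 : ℝ), ENNReal.ofReal (r ^ (m - 1)) * k r := by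
  have : Nonempty (Fin m) := ⟨⟨0, hm⟩⟩
  refine (lintegral_polar (f := fun η : EuclideanSpace ℝ (Fin m) => k ‖η‖)
    (hk.comp measurable_norm)).trans ?_
  rw [sphereMass, mul_comm, ← lintegral_const]
  refine lintegral_congr fun θ => ?_
  refine setLIntegral_congr_fun measurableSet_Ioi fun r hr => ?_
  have hθ : ‖(θ : EuclideanSpace ℝ (Fin m))‖ = 1 := by simp
  simp only [finrank_euclideanSpace, Fintype.card_fin]
  rw [norm_smul, hθ, mul_one, Real.norm_of_nonneg (le_of_lt hr)]

/-- Writing x = (s, η) and ρ = |η| leaves an integral over a half plane with density ρ^(m−1). Planar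
polar coordinates there give r^(m−1) sin^(m−1)φ · r, hence the same radial factor r^m as polar
coordinates in the whole space. -/
theorem lintegral_slice {m : ℕ} (hm : 1 ≤ m) {g : ℝ → ℝ≥0∞} (hg : Measurable g) :
    ∫⁻ x : EuclideanSpace ℝ (Fin (m + 1)),
        g (x 0 / ‖x‖) * (Set.Iio (1 : ℝ)).indicator 1 ‖x‖ =
      sphereMass m * ((∫⁻ φ in Set.Ioo 0 Real.pi,
        g (Real.cos φ) * ENNReal.ofReal (Real.sin φ ^ (m - 1))) * radialMass m) := by
  have hW : Measurable ((Set.Iio (1 : ℝ)).indicator (1 : ℝ → ℝ≥0∞)) :=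
    measurable_one.indicator measurableSet_Iio
  set k : ℝ × ℝ → ℝ≥0∞ := fun p => g (p.1 / Real.sqrt (p.1 ^ 2 + p.2 ^ 2)) *
    (Set.Iio (1 : ℝ)).indicator 1 (Real.sqrt (p.1 ^ 2 + p.2 ^ 2)) with hk
  have hkm : Measurable k := by
    refine (hg.comp ?_).mul (hW.comp (by fun_prop))
    fun_prop
  have e1 : ∫⁻ x : EuclideanSpace ℝ (Fin (m + 1)),
      g (x 0 / ‖x‖) * (Set.Iio (1 : ℝ)).indicator 1 ‖x‖ =
      ∫⁻ x : EuclideanSpace ℝ (Fin (m + 1)), k ((sliceMap m x).1, ‖(sliceMap m x).2‖) := by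
    refine lintegral_congr fun x => ?_
    simp only [hk]
    rw [← norm_eq_sliceMap]
    rfl
  have hkm2 : Measurable fun z : ℝ × EuclideanSpace ℝ (Fin m) => k (z.1, ‖z.2‖) :=
    hkm.comp (by fun_prop)
  rw [e1, (measurePreserving_sliceMap m).lintegral_comp hkm2, lintegral_prod _ hkm2.aemeasurable]
  have e2 : ∀ s : ℝ, ∫⁻ η : EuclideanSpace ℝ (Fin m), k (s, ‖η‖) =
      sphereMass m * ∫⁻ ρ in Set.Ioi (0 : ℝ), ENNReal.ofReal (ρ ^ (m - 1)) * k (s, ρ) := fun s =>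
    lintegral_radial hm (hkm.comp measurable_prodMk_left)
  simp only [e2]
  set K : ℝ × ℝ → ℝ≥0∞ := fun p => (Set.Ioi (0 : ℝ)).indicator
    (fun ρ => ENNReal.ofReal (ρ ^ (m - 1)) * k (p.1, ρ)) p.2 with hK
  have hKm : Measurable K := by
    have : K = (Prod.snd ⁻¹' Set.Ioi (0 : ℝ)).indicator
        (fun p : ℝ × ℝ => ENNReal.ofReal (p.2 ^ (m - 1)) * k p) := by
      ext p; simp only [hK, Set.indicator]; rfl
    rw [this]
    exact ((by fun_prop : Measurable fun p : ℝ × ℝ => ENNReal.ofReal (p.2 ^ (m - 1))).mul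
      hkm).indicator (measurable_snd measurableSet_Ioi)
  have e3 : ∀ s : ℝ, ∫⁻ ρ in Set.Ioi (0 : ℝ), ENNReal.ofReal (ρ ^ (m - 1)) * k (s, ρ) =
      ∫⁻ ρ, K (s, ρ) := fun s => (lintegral_indicator measurableSet_Ioi _).symm
  simp only [e3]
  rw [lintegral_const_mul _ hKm.lintegral_prod_right', ← lintegral_prod _ hKm.aemeasurable]
  congr 1
  change ∫⁻ p, K p = _
  -- `K` vanishes for ρ ≤ 0, so only angles in (0, π) contribute.
  rw [← lintegral_comp_polarCoord_symm, polarCoord_target, Measure.volume_eq_prod,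
    ← Measure.prod_restrict]
  have e4 : ∀ p ∈ Set.Ioi (0 : ℝ) ×ˢ Set.Ioo (-Real.pi) Real.pi,
      ENNReal.ofReal p.1 • K (polarCoord.symm p) =
      (Set.Ioo (0 : ℝ) 1).indicator (fun r => ENNReal.ofReal (r ^ m)) p.1 *
      (Set.Ioo 0 Real.pi).indicator
        (fun φ => g (Real.cos φ) * ENNReal.ofReal (Real.sin φ ^ (m - 1))) p.2 := by
    rintro ⟨r, φ⟩ ⟨hr, hφ⟩
    have hr : 0 < r := hr
    simp only [polarCoord_symm_apply, hK, smul_eq_mul]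
    by_cases h0 : 0 < φ
    · have hs : 0 < Real.sin φ := Real.sin_pos_of_pos_of_lt_pi h0 hφ.2
      rw [Set.indicator_of_mem (show r * Real.sin φ ∈ Set.Ioi 0 from mul_pos hr hs),
        Set.indicator_of_mem (show φ ∈ Set.Ioo 0 Real.pi from ⟨h0, hφ.2⟩)]
      have hsq : Real.sqrt ((r * Real.cos φ) ^ 2 + (r * Real.sin φ) ^ 2) = r := by
        rw [mul_pow, mul_pow, ← mul_add, Real.cos_sq_add_sin_sq, mul_one, Real.sqrt_sq hr.le]
      simp only [hk]
      rw [hsq, mul_div_cancel_left₀ _ hr.ne']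
      by_cases h1 : r < 1
      · rw [Set.indicator_of_mem (show r ∈ Set.Iio 1 from h1),
          Set.indicator_of_mem (show r ∈ Set.Ioo 0 1 from ⟨hr, h1⟩), mul_pow,
          ENNReal.ofReal_mul (by positivity)]
        have : r ^ m = r * r ^ (m - 1) := by rw [← pow_succ']; congr 1; omega
        rw [this, ENNReal.ofReal_mul hr.le, Pi.one_apply]
        ring
      · rw [Set.indicator_of_notMem (show r ∉ Set.Iio 1 from h1),
          Set.indicator_of_notMem (show r ∉ Set.Ioo 0 1 from fun h => h1 h.2)]
        simp
    · have hs : Real.sin φ ≤ 0 :=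
        Real.sin_nonpos_of_nonpos_of_neg_pi_le (not_lt.1 h0) hφ.1.le
      rw [Set.indicator_of_notMem (fun h : r * Real.sin φ ∈ Set.Ioi 0 => by
          have : 0 < r * Real.sin φ := h
          nlinarith), Set.indicator_of_notMem (show φ ∉ Set.Ioo 0 Real.pi from fun h => h0 h.1)]
      simp
  rw [Measure.prod_restrict, setLIntegral_congr_fun (measurableSet_Ioi.prod measurableSet_Ioo) e4,
    ← Measure.prod_restrict]
  rw [lintegral_prod_mul (f := (Set.Ioo (0 : ℝ) 1).indicator (fun r => ENNReal.ofReal (r ^ m)))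
    (g := (Set.Ioo 0 Real.pi).indicator
        (fun φ => g (Real.cos φ) * ENNReal.ofReal (Real.sin φ ^ (m - 1))))
    ((Measurable.indicator (by fun_prop) measurableSet_Ioo).aemeasurable)
    ((Measurable.indicator ((hg.comp (by fun_prop)).mul (by fun_prop))
      measurableSet_Ioo).aemeasurable)]
  rw [lintegral_indicator measurableSet_Ioo, lintegral_indicator measurableSet_Ioo,
    Measure.restrict_restrict measurableSet_Ioo, Measure.restrict_restrict measurableSet_Ioo,
    mul_comm]
  congr 1
  · congr 2
    refine Set.inter_eq_left.2 (Set.Ioo_subset_Ioo_left (by linarith [Real.pi_pos]))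
  · rw [radialMass, Set.inter_eq_left.2 (fun r hr => hr.1)]

/-- Both expressions for the ball integral carry the same `radialMass m`, which cancels. The
direction e is moved to the first basis vector by rotation invariance of Lebesgue measure. -/
theorem lintegral_sphere {m : ℕ} (hm : 1 ≤ m) {g : ℝ → ℝ≥0∞} (hg : Measurable g)
    {e : EuclideanSpace ℝ (Fin (m + 1))} (he : ‖e‖ = 1) :
    ∫⁻ θ, g (inner ℝ e (θ : EuclideanSpace ℝ (Fin (m + 1))))
        ∂(volume : Measure (EuclideanSpace ℝ (Fin (m + 1)))).toSphere =
      sphereMass m * ∫⁻ φ in Set.Ioo 0 Real.pi,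
        g (Real.cos φ) * ENNReal.ofReal (Real.sin φ ^ (m - 1)) := by
  have h1 := lintegral_sphere_mul_radialMass hg e
  have hd : Module.finrank ℝ (EuclideanSpace ℝ (Fin (m + 1))) - 1 = m := by simp
  rw [hd] at h1
  rw [← ENNReal.mul_left_inj (radialMass_ne_zero m) (radialMass_ne_top m), h1, mul_assoc,
    ← lintegral_slice hm hg]
  set e₀ : EuclideanSpace ℝ (Fin (m + 1)) := EuclideanSpace.single 0 1 with he₀
  have hn : ‖e₀‖ = ‖e‖ := by rw [he, he₀]; simp
  -- The reflection in the hyperplane bisecting the two unit vectors exchanges them.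
  set R := (ℝ ∙ (e₀ - e))ᗮ.reflection with hR
  have hRe : R e₀ = e := Submodule.reflection_sub hn
  have hW : Measurable ((Set.Iio (1 : ℝ)).indicator (1 : ℝ → ℝ≥0∞)) :=
    measurable_one.indicator measurableSet_Iio
  have hm' : Measurable fun x : EuclideanSpace ℝ (Fin (m + 1)) =>
      g (inner ℝ e x / ‖x‖) * (Set.Iio (1 : ℝ)).indicator 1 ‖x‖ := by
    refine (hg.comp ?_).mul (hW.comp measurable_norm)
    exact (by fun_prop : Measurable fun x : EuclideanSpace ℝ (Fin (m + 1)) =>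
      inner ℝ e x).div measurable_norm
  rw [← R.measurePreserving.lintegral_comp hm']
  refine lintegral_congr fun x => ?_
  rw [← hRe, LinearIsometryEquiv.inner_map_map, LinearIsometryEquiv.norm_map]
  congr 3
  simp [he₀, EuclideanSpace.inner_single_left]

theorem integral_sphere {m : ℕ} (hm : 1 ≤ m) {g : ℝ → ℂ} (hg : Measurable g)
    {e : EuclideanSpace ℝ (Fin (m + 1))} (he : ‖e‖ = 1) :
    ∫ θ, g (inner ℝ e (θ : EuclideanSpace ℝ (Fin (m + 1))))
        ∂(volume : Measure (EuclideanSpace ℝ (Fin (m + 1)))).toSphere =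
      (sphereMass m).toReal * ∫ φ in Set.Ioo 0 Real.pi,
        ((Real.sin φ ^ (m - 1) : ℝ) : ℂ) * g (Real.cos φ) := by
  set σ := (volume : Measure (EuclideanSpace ℝ (Fin (m + 1)))).toSphere
  set D : ℝ → ℝ≥0∞ := fun φ => ENNReal.ofReal (Real.sin φ ^ (m - 1)) with hD
  have hDm : Measurable D := by rw [hD]; fun_prop
  set ν := ((volume.restrict (Set.Ioo 0 Real.pi)).withDensity D) with hν
  have hi : Measurable fun θ : Metric.sphere (0 : EuclideanSpace ℝ (Fin (m + 1))) 1 =>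
      inner ℝ e (θ : EuclideanSpace ℝ (Fin (m + 1))) := by fun_prop
  -- The formula for nonnegative functions determines the law of e·θ under the surface measure; in
  -- this form it applies to complex integrands.
  have hmap : Measure.map (fun θ : Metric.sphere (0 : EuclideanSpace ℝ (Fin (m + 1))) 1 =>
      inner ℝ e (θ : EuclideanSpace ℝ (Fin (m + 1)))) σ =
      sphereMass m • Measure.map Real.cos ν := by
    refine Measure.ext_of_lintegral _ fun k hk => ?_
    rw [lintegral_map hk hi, lintegral_smul_measure, lintegral_map hk Real.measurable_cos,
      lintegral_sphere hm hk he, hν,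
      lintegral_withDensity_eq_lintegral_mul _ hDm (g := fun φ => k (Real.cos φ))
        (hk.comp Real.measurable_cos), smul_eq_mul]
    congr 1
    refine lintegral_congr fun φ => ?_
    simp only [Pi.mul_apply, hD]
    rw [mul_comm]
  rw [← integral_map (φ := fun θ : Metric.sphere (0 : EuclideanSpace ℝ (Fin (m + 1))) 1 =>
      inner ℝ e (θ : EuclideanSpace ℝ (Fin (m + 1)))) hi.aemeasurable hg.aestronglyMeasurable,
    hmap, integral_smul_measure, integral_map Real.measurable_cos.aemeasurable
      hg.aestronglyMeasurable, hν]
  rw [Complex.real_smul]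
  congr 1
  simp only [hD, ENNReal.ofReal]
  rw [integral_withDensity_eq_integral_smul (by fun_prop)]
  refine setIntegral_congr_fun measurableSet_Ioo fun φ hφ => ?_
  have := (Real.sin_pos_of_pos_of_lt_pi hφ.1 hφ.2).le
  simp only [NNReal.smul_def]
  rw [Real.coe_toNNReal _ (by positivity), Complex.real_smul]

end

/-- Writing the antiderivative of cos(ρu) with sinc instead of sin(ρu)/ρ includes ρ = 0. -/
theorem hasDerivAt_mul_sinc (ρ u : ℝ) :
    HasDerivAt (fun u => u * Real.sinc (ρ * u)) (Real.cos (ρ * u)) u := by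
  rcases eq_or_ne ρ 0 with rfl | hρ
  · simpa using hasDerivAt_id' u
  have e : (fun u => u * Real.sinc (ρ * u)) = fun u => Real.sin (ρ * u) / ρ := by
    ext u
    rcases eq_or_ne u 0 with rfl | hu
    · simp
    · rw [Real.sinc_of_ne_zero (mul_ne_zero hρ hu)]; field_simp
  rw [e]
  have := (((hasDerivAt_id u).const_mul ρ).sin).div_const ρ
  refine this.congr_deriv ?_
  simp only [id, mul_one]
  field_simp

theorem hasDerivAt_cos_mul_sinc (ρ φ : ℝ) :
    HasDerivAt (fun φ => -(Real.cos φ * Real.sinc (ρ * Real.cos φ)))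
      (Real.sin φ * Real.cos (ρ * Real.cos φ)) φ := by
  have := ((hasDerivAt_mul_sinc ρ (Real.cos φ)).comp φ (Real.hasDerivAt_cos φ)).neg
  refine this.congr_deriv ?_
  ring

theorem integral_sin_mul_cos (ρ : ℝ) :
    ∫ φ in (0 : ℝ)..Real.pi, Real.sin φ * Real.cos (ρ * Real.cos φ) = 2 * Real.sinc ρ := by
  rw [intervalIntegral.integral_eq_sub_of_hasDerivAt
    (fun φ _ => hasDerivAt_cos_mul_sinc ρ φ) (Continuous.intervalIntegrable (by fun_prop) _ _)]
  simp [Real.sinc_neg]; ring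

/-- Integration by parts against one factor sin φ; the boundary terms vanish because sin^(k+1) is
zero at 0 and π. One cosine comes from differentiating the power, the other from the antiderivative.
-/
theorem integral_sin_pow_mul_cos (k : ℕ) (ρ : ℝ) :
    ∫ φ in (0 : ℝ)..Real.pi, Real.sin φ ^ (k + 2) * Real.cos (ρ * Real.cos φ) =
      ∫ φ in (0 : ℝ)..Real.pi,
        (k + 1) * Real.sin φ ^ k * Real.cos φ ^ 2 * Real.sinc (ρ * Real.cos φ) := by
  have h1 : ∀ φ ∈ Set.uIcc 0 Real.pi, HasDerivAt (fun φ => Real.sin φ ^ (k + 1))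
      ((k + 1) * Real.sin φ ^ k * Real.cos φ) φ := fun φ _ => by
    have := (Real.hasDerivAt_sin φ).pow (k + 1)
    refine this.congr_deriv ?_
    push_cast; simp
  have h2 := intervalIntegral.integral_mul_deriv_eq_deriv_mul h1
    (fun φ _ => hasDerivAt_cos_mul_sinc ρ φ) (Continuous.intervalIntegrable (by fun_prop) _ _)
    (Continuous.intervalIntegrable (by fun_prop) _ _)
  have h3 : ∀ φ, Real.sin φ ^ (k + 2) * Real.cos (ρ * Real.cos φ) =
      Real.sin φ ^ (k + 1) * (Real.sin φ * Real.cos (ρ * Real.cos φ)) := fun φ => by ring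
  simp only [h3]
  rw [h2, Real.sin_pi, Real.sin_zero, zero_pow k.succ_ne_zero, zero_mul, zero_mul, sub_zero,
    zero_sub, ← intervalIntegral.integral_neg]
  refine intervalIntegral.integral_congr fun φ _ => ?_
  ring

theorem integral_sin_pow_mul_exp (k : ℕ) (ρ : ℝ) :
    ∫ φ in Set.Ioo 0 Real.pi, ((Real.sin φ ^ k : ℝ) : ℂ) *
      Complex.exp (Complex.I * (ρ * Real.cos φ : ℝ)) =
    ((∫ φ in (0 : ℝ)..Real.pi, Real.sin φ ^ k * Real.cos (ρ * Real.cos φ) : ℝ) : ℂ) := by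
  rw [← integral_Ioc_eq_integral_Ioo, ← intervalIntegral.integral_of_le Real.pi_pos.le,
    ← intervalIntegral.integral_ofReal]
  set A := ∫ φ in (0 : ℝ)..Real.pi, ((Real.sin φ ^ k : ℝ) : ℂ) *
      Complex.exp (Complex.I * (ρ * Real.cos φ : ℝ)) with hA
  -- The reflection φ ↦ π − φ preserves the sine and changes the sign of the cosine, so the integral
  -- is its own complex conjugate.
  have hB : A = ∫ φ in (0 : ℝ)..Real.pi, ((Real.sin φ ^ k : ℝ) : ℂ) *
      Complex.exp (-(Complex.I * (ρ * Real.cos φ : ℝ))) := by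
    have := intervalIntegral.integral_comp_sub_left (a := 0) (b := Real.pi)
      (fun φ : ℝ => ((Real.sin φ ^ k : ℝ) : ℂ) * Complex.exp (Complex.I * (ρ * Real.cos φ : ℝ)))
      Real.pi
    rw [sub_self, sub_zero] at this
    rw [hA, ← this]
    refine intervalIntegral.integral_congr fun φ _ => ?_
    simp only [Real.sin_pi_sub, Real.cos_pi_sub]
    push_cast; congr 2; ring
  have h2 : A = (A + A) / 2 := by ring
  rw [h2]
  nth_rewrite 2 [hB]
  rw [hA, ← intervalIntegral.integral_add (Continuous.intervalIntegrable (by fun_prop) _ _)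
    (Continuous.intervalIntegrable (by fun_prop) _ _), ← intervalIntegral.integral_div]
  refine intervalIntegral.integral_congr fun φ _ => ?_
  have e : ((Real.cos (ρ * Real.cos φ) : ℝ) : ℂ) =
      (Complex.exp (Complex.I * (ρ * Real.cos φ : ℝ)) +
        Complex.exp (-(Complex.I * (ρ * Real.cos φ : ℝ)))) / 2 := by
    rw [Complex.ofReal_cos, Complex.cos, neg_mul, mul_comm Complex.I]
  rw [Complex.ofReal_mul (Real.sin φ ^ k), e]
  ring

/-- The Fourier transform of the sphere as an average of `sinc`. -/
theorem exists_sphere_fourier {m : ℕ} (hm : 2 ≤ m) :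
    ∃ ν : Measure ℝ, IsFiniteMeasure ν ∧ ∀ v : EuclideanSpace ℝ (Fin (m + 1)),
      ∫ θ, Complex.exp (Complex.I * (inner ℝ v (θ : EuclideanSpace ℝ (Fin (m + 1))) : ℝ))
        ∂(volume : Measure (EuclideanSpace ℝ (Fin (m + 1)))).toSphere =
      ((∫ φ, |Real.cos φ| * Real.sinc (‖v‖ * Real.cos φ) ∂ν : ℝ) : ℂ) := by
  have key : ∀ v : EuclideanSpace ℝ (Fin (m + 1)),
      ∫ θ, Complex.exp (Complex.I * (inner ℝ v (θ : EuclideanSpace ℝ (Fin (m + 1))) : ℝ))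
        ∂(volume : Measure (EuclideanSpace ℝ (Fin (m + 1)))).toSphere =
      (((sphereMass m).toReal * ∫ φ in (0 : ℝ)..Real.pi,
        Real.sin φ ^ (m - 1) * Real.cos (‖v‖ * Real.cos φ) : ℝ) : ℂ) := by
    intro v
    obtain ⟨e, he, hv⟩ : ∃ e : EuclideanSpace ℝ (Fin (m + 1)), ‖e‖ = 1 ∧ v = ‖v‖ • e := by
      rcases eq_or_ne v 0 with rfl | hv
      · exact ⟨EuclideanSpace.single 0 1, by simp, by simp⟩
      · refine ⟨‖v‖⁻¹ • v, by simp [norm_smul, hv], ?_⟩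
        rw [smul_smul, mul_inv_cancel₀ (norm_ne_zero_iff.2 hv), one_smul]
    have h1 := integral_sphere (m := m) (by omega)
      (g := fun s => Complex.exp (Complex.I * (‖v‖ * s : ℝ))) (by fun_prop) he
    rw [integral_sin_pow_mul_exp] at h1
    rw [Complex.ofReal_mul, ← h1]
    congr 1; ext θ
    conv_lhs => rw [hv, real_inner_smul_left]
  rcases Nat.lt_or_ge 2 m with h3 | h3
  · obtain ⟨k, rfl⟩ : ∃ k, m = k + 3 := ⟨m - 3, by omega⟩
    -- Of the two cosines from the integration by parts one goes into the measure. The other stays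
    -- in the integrand, to cancel the 1/|cos φ| that appears when the radial integral is estimated.
    set D : ℝ → ℝ≥0∞ := fun φ => ENNReal.ofReal
      ((sphereMass (k + 3)).toReal * ((k + 1) * (Real.sin φ ^ k * |Real.cos φ|))) with hD
    have hDm : Measurable D := by rw [hD]; fun_prop
    have hDb : ∀ φ, D φ ≤ ENNReal.ofReal ((sphereMass (k + 3)).toReal * (k + 1)) := fun φ => by
      refine ENNReal.ofReal_le_ofReal (mul_le_mul_of_nonneg_left ?_ ENNReal.toReal_nonneg)
      refine mul_le_of_le_one_right (by positivity) ?_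
      calc Real.sin φ ^ k * |Real.cos φ| ≤ |Real.sin φ ^ k| * |Real.cos φ| :=
            mul_le_mul_of_nonneg_right (le_abs_self _) (abs_nonneg _)
        _ ≤ 1 * 1 := by
          gcongr
          · rw [abs_pow]; exact pow_le_one₀ (abs_nonneg _) (Real.abs_sin_le_one _)
          · exact Real.abs_cos_le_one _
        _ = 1 := one_mul 1
    refine ⟨(volume.restrict (Set.Ioo 0 Real.pi)).withDensity D, ⟨?_⟩, fun v => ?_⟩
    · rw [withDensity_apply _ MeasurableSet.univ]
      refine lt_of_le_of_lt (lintegral_mono hDb) ?_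
      simp [ENNReal.mul_lt_top_iff]
    · rw [key v]
      congr 1
      simp only [hD, ENNReal.ofReal]
      rw [integral_withDensity_eq_integral_smul (by fun_prop)]
      have e1 : k + 3 - 1 = k + 2 := by omega
      rw [e1, integral_sin_pow_mul_cos, ← intervalIntegral.integral_const_mul,
        intervalIntegral.integral_of_le Real.pi_pos.le, integral_Ioc_eq_integral_Ioo]
      refine setIntegral_congr_fun measurableSet_Ioo fun φ hφ => ?_
      have := (Real.sin_pos_of_pos_of_lt_pi hφ.1 hφ.2).le
      simp only [NNReal.smul_def]
      rw [Real.coe_toNNReal _ (by positivity), smul_eq_mul, ← sq_abs (Real.cos φ)]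
      ring
  · obtain rfl : m = 2 := by omega
    -- On the two-dimensional sphere the transform is a multiple of sinc itself; a point mass at φ =
    -- 0, where cos φ = 1, puts it in the common form.
    refine ⟨ENNReal.ofReal ((sphereMass 2).toReal * 2) • Measure.dirac 0, ⟨?_⟩, fun v => ?_⟩
    · simp [ENNReal.mul_lt_top_iff]
    · rw [key v]
      congr 1
      have := integral_sin_mul_cos ‖v‖
      norm_num at this ⊢
      rw [this]
      ring

/-! ### The dispersive kernel bound -/

/-- The dispersion relation `ξ₁ |ξ|^a` with `ξ = 2πη`. -/
def disp {n : ℕ} [NeZero n] (a : ℝ) (η : EuclideanSpace ℝ (Fin n)) : ℝ :=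
  (2 * Real.pi * η 0) * (2 * Real.pi * ‖η‖) ^ a

/-- A closed annulus. -/
def annulus (n : ℕ) (r₁ r₂ : ℝ) : Set (EuclideanSpace ℝ (Fin n)) := {η | ‖η‖ ∈ Set.Icc r₁ r₂}

theorem isCompact_annulus (n : ℕ) (r₁ r₂ : ℝ) : IsCompact (annulus n r₁ r₂) := by
  refine Metric.isCompact_of_isClosed_isBounded (isClosed_Icc.preimage continuous_norm) ?_
  refine (Metric.isBounded_closedBall (x := (0 : EuclideanSpace ℝ (Fin n))) (r := r₂)).subset ?_
  intro η hη
  simpa using hη.2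

theorem measurableSet_annulus (n : ℕ) (r₁ r₂ : ℝ) : MeasurableSet (annulus n r₁ r₂) :=
  (isCompact_annulus n r₁ r₂).measurableSet

theorem measurable_disp {n : ℕ} [NeZero n] (a : ℝ) : Measurable (disp (n := n) a) := by
  unfold disp
  fun_prop

/-- Pythagoras: c is the first coordinate of X and h is its distance to the first axis. This is the
geometric origin of `dist2`. -/
theorem norm_sub_smul_single {m : ℕ} (X : EuclideanSpace ℝ (Fin (m + 1))) (y : ℝ) :
    ‖X - y • EuclideanSpace.single 0 1‖ = dist2 (X 0) (Real.sqrt (‖X‖ ^ 2 - X 0 ^ 2)) y := by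
  have hX : X 0 ^ 2 ≤ ‖X‖ ^ 2 := by
    rw [EuclideanSpace.norm_sq_eq, Fin.sum_univ_succ]
    simp only [Real.norm_eq_abs, sq_abs]
    linarith [Finset.sum_nonneg fun (i : Fin m) (_ : i ∈ Finset.univ) => sq_nonneg (X i.succ)]
  rw [dist2, Real.sq_sqrt (by linarith), ← Real.sqrt_sq (norm_nonneg (X - _)), norm_sub_sq_real,
    inner_smul_right, EuclideanSpace.inner_single_right, norm_smul]
  congr 1
  simp only [conj_trivial, one_mul, Real.norm_eq_abs, PiLp.norm_single, norm_one, mul_one,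
    sq_abs]
  ring

theorem norm_exp_I_mul_ofReal (x : ℝ) : ‖Complex.exp (Complex.I * (x : ℂ))‖ = 1 := by
  rw [mul_comm]; exact Complex.norm_exp_ofReal_mul_I x

/-- The integrand of the kernel of the propagator, with the power weight `|ξ|^w`. -/
def kernelFun {m : ℕ} (a t : ℝ) (w : ℂ) (x η : EuclideanSpace ℝ (Fin (m + 1))) : ℂ :=
  Complex.exp (Complex.I * ((2 * Real.pi * inner ℝ x η - t * disp a η : ℝ) : ℂ)) *
    ((2 * Real.pi * ‖η‖ : ℝ) : ℂ) ^ w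

theorem measurable_kernelFun {m : ℕ} (a t : ℝ) (w : ℂ) (x : EuclideanSpace ℝ (Fin (m + 1))) :
    Measurable (kernelFun a t w x) := by
  unfold kernelFun
  have := measurable_disp (n := m + 1) a
  fun_prop

theorem norm_kernelFun {m : ℕ} (a t : ℝ) (w : ℂ) (x : EuclideanSpace ℝ (Fin (m + 1)))
    {η : EuclideanSpace ℝ (Fin (m + 1))} (hη : 0 < ‖η‖) :
    ‖kernelFun a t w x η‖ = (2 * Real.pi * ‖η‖) ^ w.re := by
  unfold kernelFun
  rw [norm_mul, norm_exp_I_mul_ofReal, one_mul,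
    Complex.norm_cpow_eq_rpow_re_of_pos (by have := Real.pi_pos; positivity)]

/-- The power is monotone in one direction or the other, so one endpoint always dominates; the sum
avoids a case distinction on the sign of w. -/
theorem rpow_le_add {x y r w : ℝ} (hx : 0 < x) (h1 : x ≤ r) (h2 : r ≤ y) :
    r ^ w ≤ x ^ w + y ^ w := by
  have hr : 0 < r := hx.trans_le h1
  rcases le_total 0 w with hw | hw
  · have := Real.rpow_le_rpow hr.le h2 hw
    have := Real.rpow_pos_of_pos hx w
    linarith
  · have := Real.rpow_le_rpow_of_nonpos hx h1 hw
    have := Real.rpow_pos_of_pos (hr.trans_le h2) w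
    linarith

theorem integrableOn_kernelFun {m : ℕ} (a t : ℝ) (w : ℂ) (x : EuclideanSpace ℝ (Fin (m + 1)))
    {r₁ r₂ : ℝ} (hr₁ : 0 < r₁) :
    IntegrableOn (kernelFun a t w x) (annulus (m + 1) r₁ r₂) := by
  refine Measure.integrableOn_of_bounded
    (M := (2 * Real.pi * r₁) ^ w.re + (2 * Real.pi * r₂) ^ w.re)
    (isCompact_annulus _ _ _).measure_lt_top.ne (measurable_kernelFun _ _ _ _).aestronglyMeasurable ?_
  filter_upwards [ae_restrict_mem (measurableSet_annulus _ _ _)] with η hη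
  have hp := Real.pi_pos
  have h1 : r₁ ≤ ‖η‖ := hη.1
  have h2 : ‖η‖ ≤ r₂ := hη.2
  rw [norm_kernelFun _ _ _ _ (hr₁.trans_le h1)]
  exact rpow_le_add (by positivity) (by gcongr) (by gcongr)

/-- The dispersion relation is ξ₁ times a radial function, so on a sphere of fixed radius it is
linear in the direction. The whole phase is then the inner product of θ with a single vector
depending on r. -/
theorem kernelFun_smul {m : ℕ} (a t : ℝ) (w : ℂ) (x θ : EuclideanSpace ℝ (Fin (m + 1)))
    (hθ : ‖θ‖ = 1) {r : ℝ} (hr : 0 < r) :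
    kernelFun a t w x (r • θ) = ((2 * Real.pi * r : ℝ) : ℂ) ^ w *
      Complex.exp (Complex.I * (inner ℝ ((r * (2 * Real.pi)) • x -
        (t * (2 * Real.pi) ^ (a + 1) * r * r ^ a) •
          (EuclideanSpace.single 0 1 : EuclideanSpace ℝ (Fin (m + 1)))) θ : ℝ)) := by
  have hp := Real.pi_pos
  unfold kernelFun disp
  rw [norm_smul, hθ, mul_one, Real.norm_of_nonneg hr.le, mul_comm]
  congr 4
  rw [inner_sub_left, real_inner_smul_left, real_inner_smul_left, inner_smul_right,
    EuclideanSpace.inner_single_left, Real.mul_rpow (by positivity) hr.le,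
    Real.rpow_add (by positivity), Real.rpow_one]
  simp only [PiLp.smul_apply, smul_eq_mul, map_one, one_mul]
  ring

/-- In polar coordinates the angular integral is an average over φ of |cos φ| sinc(|v(r)| cos φ).
After Fubini, `norm_integral_sinc_le` with parameter |T||cos φ| bounds each radial integral by a
multiple of 1/(|T||cos φ|), and the factor |cos φ| cancels. The linear growth in γ is mild enough
for analytic interpolation. -/
theorem exists_kernel_bound {m : ℕ} (hm : 2 ≤ m) {a : ℝ} (ha : 1 ≤ a) :
    ∃ C : ℝ, 0 ≤ C ∧ ∀ (γ t r₁ r₂ : ℝ) (x : EuclideanSpace ℝ (Fin (m + 1))), t ≠ 0 → 0 < r₁ →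
      r₁ ≤ r₂ → ‖∫ η in annulus (m + 1) r₁ r₂,
        kernelFun a t (-((m - a : ℝ) : ℂ) + Complex.I * γ) x η‖ ≤ C * (1 + |γ|) / |t| := by
  obtain ⟨ν, hν, hJ⟩ := exists_sphere_fourier hm
  have hp := Real.pi_pos
  set P : ℝ := 2 * Real.pi with hP
  have hP0 : 0 < P := by positivity
  refine ⟨P ^ (-(m - a)) * (ν.real Set.univ * (500 / P ^ (a + 1))), by positivity,
    fun γ t r₁ r₂ x ht hr₁ hr => ?_⟩
  set w : ℂ := -((m - a : ℝ) : ℂ) + Complex.I * γ with hw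
  set T : ℝ := t * P ^ (a + 1) with hT
  have hPa : 0 < P ^ (a + 1) := Real.rpow_pos_of_pos hP0 _
  have hT0 : T ≠ 0 := mul_ne_zero ht hPa.ne'
  -- Chosen so that v(r) = T r (X − r^a e₁): the factor T r comes out of the norm and leaves `dist2
  -- c h (r ^ a)`.
  set X := (P / T) • x with hX
  set c := X 0 with hc
  set h := Real.sqrt (‖X‖ ^ 2 - X 0 ^ 2) with hh
  set v : ℝ → EuclideanSpace ℝ (Fin (m + 1)) := fun r =>
    (r * P) • x - (t * P ^ (a + 1) * r * r ^ a) • EuclideanSpace.single 0 1 with hv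
  have hvn : ∀ r, 0 < r → ‖v r‖ = |T| * (r * dist2 c h (r ^ a)) := fun r hr0 => by
    have : v r = (T * r) • (X - (r ^ a) • EuclideanSpace.single 0 1) := by
      rw [hv, hX, smul_sub, smul_smul, smul_smul]
      have e1 : T * r * (P / T) = r * P := by field_simp
      rw [e1, hT]
    rw [this, norm_smul, norm_sub_smul_single, norm_mul, Real.norm_eq_abs, Real.norm_of_nonneg hr0.le,
      mul_assoc]
  -- polar coordinates
  have e1 : ∫ η in annulus (m + 1) r₁ r₂, kernelFun a t w x η =
      ∫ r in Set.Icc r₁ r₂, ((P : ℂ) ^ w) * ∫ φ, (r : ℂ) ^ (Complex.I * γ) *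
        ((r ^ a * (|Real.cos φ| * Real.sinc (‖v r‖ * Real.cos φ)) : ℝ) : ℂ) ∂ν := by
    rw [← integral_indicator (measurableSet_annulus _ _ _), integral_polar
      ((integrable_indicator_iff (measurableSet_annulus _ _ _)).2
        (integrableOn_kernelFun a t w x hr₁)),
      ← integral_indicator measurableSet_Ioi, ← integral_indicator measurableSet_Icc]
    congr 1; ext r
    by_cases hrI : r ∈ Set.Icc r₁ r₂
    · have hr0 : 0 < r := hr₁.trans_le hrI.1
      rw [Set.indicator_of_mem (show r ∈ Set.Ioi 0 from hr0), Set.indicator_of_mem hrI]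
      have e2 : ∀ θ : Metric.sphere (0 : EuclideanSpace ℝ (Fin (m + 1))) 1,
          (annulus (m + 1) r₁ r₂).indicator (kernelFun a t w x)
            (r • (θ : EuclideanSpace ℝ (Fin (m + 1)))) = ((P * r : ℝ) : ℂ) ^ w *
          Complex.exp (Complex.I * (inner ℝ (v r) (θ : EuclideanSpace ℝ (Fin (m + 1))) : ℝ)) := by
        intro θ
        have hθ : ‖(θ : EuclideanSpace ℝ (Fin (m + 1)))‖ = 1 := by simp
        rw [Set.indicator_of_mem, kernelFun_smul _ _ _ _ _ hθ hr0]
        change ‖r • (θ : EuclideanSpace ℝ (Fin (m + 1)))‖ ∈ Set.Icc r₁ r₂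
        rwa [norm_smul, hθ, mul_one, Real.norm_of_nonneg hr0.le]
      simp only [e2]
      rw [integral_const_mul, hJ, finrank_euclideanSpace, Fintype.card_fin, add_tsub_cancel_right,
        integral_const_mul]
      have e3 : ∀ φ, ((r ^ a * (|Real.cos φ| * Real.sinc (‖v r‖ * Real.cos φ)) : ℝ) : ℂ) =
          ((r ^ a : ℝ) : ℂ) * ((|Real.cos φ| * Real.sinc (‖v r‖ * Real.cos φ) : ℝ) : ℂ) := fun φ => by
        push_cast; ring
      simp only [e3]
      rw [integral_const_mul, integral_complex_ofReal, Complex.real_smul]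
      -- The weight r^(−(m−a)+iγ) meets the Jacobian r^m, leaving r^a r^(iγ).
      have e4 : ((P * r : ℝ) : ℂ) ^ w * ((r ^ m : ℝ) : ℂ) =
          (P : ℂ) ^ w * ((r : ℂ) ^ (Complex.I * γ) * ((r ^ a : ℝ) : ℂ)) := by
        rw [Complex.ofReal_mul, Complex.mul_cpow_ofReal_nonneg hP0.le hr0.le, mul_assoc]
        congr 1
        rw [Complex.ofReal_cpow hr0.le, ← Complex.cpow_add _ _ (by exact_mod_cast hr0.ne'),
          ← Real.rpow_natCast, Complex.ofReal_cpow hr0.le,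
          ← Complex.cpow_add _ _ (by exact_mod_cast hr0.ne')]
        congr 1
        rw [hw]; push_cast; ring
      rw [← mul_assoc ((r ^ m : ℝ) : ℂ), mul_comm ((r ^ m : ℝ) : ℂ), e4]
      ring
    · rw [Set.indicator_of_notMem hrI]
      by_cases hr0 : 0 < r
      · rw [Set.indicator_of_mem (show r ∈ Set.Ioi 0 from hr0)]
        have e2 : ∀ θ : Metric.sphere (0 : EuclideanSpace ℝ (Fin (m + 1))) 1,
            (annulus (m + 1) r₁ r₂).indicator (kernelFun a t w x)
              (r • (θ : EuclideanSpace ℝ (Fin (m + 1)))) = 0 := by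
          intro θ
          have hθ : ‖(θ : EuclideanSpace ℝ (Fin (m + 1)))‖ = 1 := by simp
          refine Set.indicator_of_notMem (fun hmem => hrI ?_) _
          have : ‖r • (θ : EuclideanSpace ℝ (Fin (m + 1)))‖ ∈ Set.Icc r₁ r₂ := hmem
          rwa [norm_smul, hθ, mul_one, Real.norm_of_nonneg hr0.le] at this
        simp [e2]
      · rw [Set.indicator_of_notMem (show r ∉ Set.Ioi 0 from hr0)]
  rw [e1, integral_const_mul, norm_mul, Complex.norm_cpow_eq_rpow_re_of_pos hP0]
  have hre : w.re = -(m - a) := by simp [hw]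
  rw [hre]
  -- Fubini
  have hcv : Measurable v := by rw [hv]; fun_prop
  have hint : Integrable (fun z : ℝ × ℝ => (z.1 : ℂ) ^ (Complex.I * γ) *
      ((z.1 ^ a * (|Real.cos z.2| * Real.sinc (‖v z.1‖ * Real.cos z.2)) : ℝ) : ℂ))
      ((volume.restrict (Set.Icc r₁ r₂)).prod ν) := by
    have hmeas : Measurable (fun z : ℝ × ℝ => (z.1 : ℂ) ^ (Complex.I * γ) *
      ((z.1 ^ a * (|Real.cos z.2| * Real.sinc (‖v z.1‖ * Real.cos z.2)) : ℝ) : ℂ)) := by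
      have h1 : Measurable fun z : ℝ × ℝ => Real.sinc (‖v z.1‖ * Real.cos z.2) :=
        Real.continuous_sinc.measurable.comp
          (((hcv.comp measurable_fst).norm).mul (by fun_prop))
      have h2 : Measurable fun z : ℝ × ℝ => |Real.cos z.2| := by fun_prop
      fun_prop
    refine Integrable.of_bound hmeas.aestronglyMeasurable (r₂ ^ a) ?_
    have : ∀ᵐ z ∂((volume.restrict (Set.Icc r₁ r₂)).prod ν), z.1 ∈ Set.Icc r₁ r₂ :=
      Measure.quasiMeasurePreserving_fst.ae (ae_restrict_mem measurableSet_Icc)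
    filter_upwards [this] with z hz
    have hz0 : 0 < z.1 := hr₁.trans_le hz.1
    rw [norm_mul, norm_ofReal_cpow_I hz0, one_mul, Complex.norm_real, Real.norm_eq_abs, abs_mul,
      abs_mul, abs_abs]
    calc _ ≤ |z.1 ^ a| * (1 * 1) := by
          gcongr
          · exact Real.abs_cos_le_one _
          · exact Real.abs_sinc_le_one _
      _ ≤ r₂ ^ a := by
        rw [mul_one, mul_one, abs_of_nonneg (by positivity)]
        exact Real.rpow_le_rpow hz0.le hz.2 (by linarith)
  rw [integral_integral_swap hint]
  have hin : ∀ φ, ‖∫ r in Set.Icc r₁ r₂, (r : ℂ) ^ (Complex.I * γ) *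
      ((r ^ a * (|Real.cos φ| * Real.sinc (‖v r‖ * Real.cos φ)) : ℝ) : ℂ)‖ ≤
      500 * (1 + |γ|) / |T| := by
    intro φ
    rcases eq_or_ne (Real.cos φ) 0 with h0 | h0
    · simp [h0]; positivity
    have e5 : ∫ r in Set.Icc r₁ r₂, (r : ℂ) ^ (Complex.I * γ) *
        ((r ^ a * (|Real.cos φ| * Real.sinc (‖v r‖ * Real.cos φ)) : ℝ) : ℂ) =
        (|Real.cos φ| : ℝ) * ∫ r in r₁..r₂, (r : ℂ) ^ (Complex.I * γ) *
        ((r ^ a * Real.sinc ((|T| * |Real.cos φ|) * (r * dist2 c h (r ^ a))) : ℝ) : ℂ) := by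
      rw [intervalIntegral.integral_of_le hr, ← integral_Icc_eq_integral_Ioc, ← integral_const_mul]
      refine setIntegral_congr_fun measurableSet_Icc fun r hrI => ?_
      have hr0 : 0 < r := hr₁.trans_le hrI.1
      -- Evenness of sinc replaces cos φ by |cos φ|, so that the parameter of the radial integral is
      -- positive.
      have e6 : Real.sinc (‖v r‖ * Real.cos φ) =
          Real.sinc ((|T| * |Real.cos φ|) * (r * dist2 c h (r ^ a))) := by
        rw [hvn r hr0]
        rcases abs_choice (Real.cos φ) with h | h <;> rw [h]
        · congr 1; ring
        · rw [← Real.sinc_neg]; congr 1; ring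
      simp only [e6]
      push_cast; ring
    have hcp : 0 < |Real.cos φ| := abs_pos.2 h0
    have hTp : 0 < |T| := abs_pos.2 hT0
    rw [e5, norm_mul, Complex.norm_real, Real.norm_eq_abs, abs_abs]
    refine (mul_le_mul_of_nonneg_left (norm_integral_sinc_le ha (mul_pos hTp hcp) hr₁ hr)
      hcp.le).trans (le_of_eq ?_)
    field_simp
  have hfin := norm_integral_le_of_norm_le_const (μ := ν) (Filter.Eventually.of_forall hin)
  refine (mul_le_mul_of_nonneg_left hfin (by positivity)).trans (le_of_eq ?_)
  rw [hT, abs_mul, abs_of_pos hPa]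
  have := abs_pos.2 ht
  field_simp

section

/-! ### Plancherel for integrable square integrable functions -/

section Plancherel

variable {E : Type*} [NormedAddCommGroup E] [InnerProductSpace ℝ E] [FiniteDimensional ℝ E]
  [MeasurableSpace E] [BorelSpace E]

theorem ae_eq_of_integral_schwartz_mul_eq {f g : E → ℂ} (hf : LocallyIntegrable f)
    (hg : LocallyIntegrable g)
    (h : ∀ φ : 𝓢(E, ℂ), ∫ x, φ x * f x = ∫ x, φ x * g x) : f =ᵐ[volume] g := by
  refine ae_eq_of_integral_contDiff_smul_eq hf hg fun φ hφ hc => ?_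
  have h1 : HasCompactSupport (Complex.ofRealCLM ∘ φ) := hc.comp_left rfl
  have h2 : ContDiff ℝ ((⊤ : ℕ∞) : WithTop ℕ∞) (Complex.ofRealCLM ∘ φ) := by fun_prop
  simpa using h (h1.toSchwartzMap h2)

theorem integral_schwartz_fourier_mul (φ : 𝓢(E, ℂ)) {w : E → ℂ} (hw : Integrable w) :
    ∫ x, (𝓕 φ : 𝓢(E, ℂ)) x * w x = ∫ x, φ x * 𝓕 w x := by
  have := VectorFourier.integral_fourierIntegral_smul_eq_flip (e := Real.fourierChar) (μ := volume)
    (ν := volume) (L := innerₗ E) (f := φ) (g := w) Real.continuous_fourierChar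
    (by simpa using continuous_inner) φ.integrable hw
  simp only [flip_innerₗ, smul_eq_mul] at this
  rw [SchwartzMap.fourier_coe]
  exact this

theorem integral_schwartz_fourierInv_mul (φ : 𝓢(E, ℂ)) {w : E → ℂ} (hw : Integrable w) :
    ∫ x, (𝓕⁻ φ : 𝓢(E, ℂ)) x * w x = ∫ x, φ x * 𝓕⁻ w x := by
  have h1 := integral_schwartz_fourier_mul φ (w := fun x => w (-x)) hw.comp_neg
  rw [SchwartzMap.fourier_coe] at h1
  rw [SchwartzMap.fourierInv_coe, Real.fourierInv_eq_fourier_comp_neg w, ← h1,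
    ← integral_neg_eq_self]
  simp [Real.fourierInv_eq_fourier_neg]

/-- The Fourier transform on L² is an abstract extension by density. Pairing with Schwartz functions
shows that it agrees almost everywhere with the Fourier integral when w is also integrable, and
Plancherel carries over. -/
theorem memLp_fourier {w : E → ℂ} (hw : Integrable w) (hw2 : MemLp w 2) :
    MemLp (𝓕 w) 2 ∧ eLpNorm (𝓕 w) 2 volume = eLpNorm w 2 volume := by
  set W : Lp ℂ 2 (volume : Measure E) := hw2.toLp w with hW
  have hae : (𝓕 W : Lp ℂ 2 (volume : Measure E)) =ᵐ[volume] 𝓕 w := by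
    refine ae_eq_of_integral_schwartz_mul_eq ((Lp.memLp _).locallyIntegrable (by norm_num))
      (VectorFourier.fourierIntegral_continuous Real.continuous_fourierChar
        (by simpa using continuous_inner) hw).locallyIntegrable fun φ => ?_
    have h1 := congrArg (fun T : 𝓢'(E, ℂ) => T φ) (Lp.fourier_toTemperedDistribution_eq W)
    simp only [TemperedDistribution.fourier_apply, Lp.toTemperedDistribution_apply,
      smul_eq_mul] at h1
    rw [← h1, ← integral_schwartz_fourier_mul φ hw]
    refine integral_congr_ae ?_
    filter_upwards [hw2.coeFn_toLp] with x hx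
    rw [hW, hx]
  refine ⟨(memLp_congr_ae hae).1 (Lp.memLp _), ?_⟩
  rw [← eLpNorm_congr_ae hae, ← eLpNorm_congr_ae hw2.coeFn_toLp]
  have := Lp.norm_fourier_eq W
  rw [Lp.norm_def, Lp.norm_def, ENNReal.toReal_eq_toReal_iff' (Lp.eLpNorm_ne_top _)
    (Lp.eLpNorm_ne_top _)] at this
  exact this

theorem memLp_fourierInv {w : E → ℂ} (hw : Integrable w) (hw2 : MemLp w 2) :
    MemLp (𝓕⁻ w) 2 ∧ eLpNorm (𝓕⁻ w) 2 volume = eLpNorm w 2 volume := by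
  have e : (𝓕⁻ w : E → ℂ) = (𝓕 w) ∘ (fun x => -x) := by
    ext x; rw [Real.fourierInv_eq_fourier_neg]; rfl
  have hn : MeasurePreserving (fun x : E => -x) volume volume := Measure.measurePreserving_neg _
  obtain ⟨h1, h2⟩ := memLp_fourier hw hw2
  rw [e]
  exact ⟨h1.comp_measurePreserving hn, by rw [eLpNorm_comp_measurePreserving h1.1 hn, h2]⟩

end Plancherel

/-! ### Holomorphic parameter integrals -/

/-- Boundedness of L dominates the exponential and its derivative on every unit disc by a constant,
so one may differentiate under the integral. -/
theorem differentiable_integral_mul_exp {Ω : Type*} [MeasurableSpace Ω] {μ : Measure Ω}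
    {h : Ω → ℂ} {L : Ω → ℝ} {B : ℝ} (hh : Integrable h μ) (hL : AEStronglyMeasurable L μ)
    (hB : ∀ᵐ p ∂μ, |L p| ≤ B) :
    Differentiable ℂ fun z : ℂ => ∫ p, h p * Complex.exp (z * L p) ∂μ := by
  intro z₀
  have hLc : AEStronglyMeasurable (fun p => (L p : ℂ)) μ :=
    Complex.continuous_ofReal.comp_aestronglyMeasurable hL
  have hm : ∀ z : ℂ, AEStronglyMeasurable (fun p => h p * Complex.exp (z * L p)) μ := fun z =>
    hh.1.mul (Complex.continuous_exp.comp_aestronglyMeasurable (hLc.const_mul z))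
  have hexp : ∀ z : ℂ, ∀ l : ℝ, |l| ≤ B → ‖Complex.exp (z * l)‖ ≤ Real.exp (‖z‖ * B) := by
    intro z l hl
    rw [Complex.norm_exp]
    refine Real.exp_le_exp.2 ?_
    simp only [Complex.mul_re, Complex.ofReal_re, Complex.ofReal_im, mul_zero, sub_zero]
    calc z.re * l ≤ |z.re * l| := le_abs_self _
      _ = |z.re| * |l| := abs_mul _ _
      _ ≤ ‖z‖ * B := mul_le_mul (Complex.abs_re_le_norm z) hl (abs_nonneg _) (norm_nonneg _)
  have := (hasDerivAt_integral_of_dominated_loc_of_deriv_le (μ := μ) (𝕜 := ℂ)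
    (F := fun z p => h p * Complex.exp (z * L p))
    (F' := fun z p => h p * (Complex.exp (z * L p) * L p))
    (bound := fun p => ‖h p‖ * (Real.exp ((‖z₀‖ + 1) * B) * B)) (s := Metric.ball z₀ 1)
    (x₀ := z₀) (Metric.ball_mem_nhds z₀ one_pos) (Filter.Eventually.of_forall hm) ?_ ?_ ?_ ?_ ?_).2
  · exact this.differentiableAt
  · refine (hh.norm.mul_const (Real.exp (‖z₀‖ * B))).mono' (hm z₀) ?_
    filter_upwards [hB] with p hp
    rw [norm_mul]
    exact mul_le_mul_of_nonneg_left (hexp _ _ hp) (norm_nonneg _)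
  · exact hh.1.mul ((Complex.continuous_exp.comp_aestronglyMeasurable (hLc.const_mul z₀)).mul hLc)
  · filter_upwards [hB] with p hp z hz
    have hB0 : 0 ≤ B := (abs_nonneg _).trans hp
    have hz' : ‖z‖ ≤ ‖z₀‖ + 1 := by
      have h1 : ‖z - z₀‖ < 1 := by simpa [dist_eq_norm] using hz
      have h2 := norm_add_le (z - z₀) z₀
      rw [sub_add_cancel] at h2
      linarith
    rw [norm_mul, norm_mul, Complex.norm_real, Real.norm_eq_abs]
    gcongr
    refine (hexp _ _ hp).trans (Real.exp_le_exp.2 ?_)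
    gcongr
  · exact hh.norm.mul_const _
  · refine Filter.Eventually.of_forall fun p z _ => ?_
    have h1 : HasDerivAt (fun z : ℂ => z * (L p : ℂ)) (L p : ℂ) z := by
      simpa using (hasDerivAt_id z).mul_const (L p : ℂ)
    exact (h1.cexp).const_mul _

/-! ### Bounded functions with bounded support -/

/-- Measurable functions that are bounded above and below on their bounded support. -/
structure NiceFun {E : Type*} [NormedAddCommGroup E] [MeasurableSpace E] (f : E → ℂ) : Prop where
  measurable : Measurable f
  bound : ∃ R ε M : ℝ, 0 < ε ∧ ∀ x, f x ≠ 0 → ‖x‖ ≤ R ∧ ε ≤ ‖f x‖ ∧ ‖f x‖ ≤ M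

/-- The analytic family `f |f|^(κ - 1 + κ z)`. -/
def powFamily {E : Type*} (κ : ℝ) (z : ℂ) (f : E → ℂ) (x : E) : ℂ :=
  f x * Complex.exp ((κ - 1 + κ * z) * Real.log ‖f x‖)

section NiceFun

theorem norm_powFamily {E : Type*} {f : E → ℂ} {κ : ℝ} {z : ℂ} {x : E} (hx : f x ≠ 0) :
    ‖powFamily κ z f x‖ = ‖f x‖ ^ (κ + κ * z.re) := by
  have h0 : 0 < ‖f x‖ := norm_pos_iff.2 hx
  unfold powFamily
  rw [norm_mul, Complex.norm_exp]
  have : ((κ - 1 + κ * z) * (Real.log ‖f x‖ : ℂ)).re = Real.log ‖f x‖ * (κ + κ * z.re - 1) := by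
    simp; ring
  rw [this, ← Real.rpow_def_of_pos h0, Real.rpow_sub h0, Real.rpow_one]
  field_simp

variable {E : Type*} [NormedAddCommGroup E] [MeasurableSpace E] {f : E → ℂ}

theorem NiceFun.exists_bound (hf : NiceFun f) : ∃ R M : ℝ, 0 ≤ M ∧
    (∀ x, ‖f x‖ ≤ M) ∧ Function.support f ⊆ Metric.closedBall 0 R := by
  obtain ⟨R, ε, M, hε, h⟩ := hf.bound
  refine ⟨R, max M 0, le_max_right _ _, fun x => ?_, fun x hx => ?_⟩
  · by_cases hx : f x = 0
    · rw [hx, norm_zero]; exact le_max_right _ _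
    · exact (h x hx).2.2.trans (le_max_left _ _)
  · simpa using (h x hx).1

/-- The lower bound on the support is what makes log|f| bounded there; off the support the value
`Real.log 0 = 0` is harmless. This makes the interpolation family entire in z. -/
theorem NiceFun.exists_log_bound (hf : NiceFun f) : ∃ B : ℝ, 0 ≤ B ∧ ∀ x, |Real.log ‖f x‖| ≤ B := by
  obtain ⟨R, ε, M, hε, h⟩ := hf.bound
  refine ⟨|Real.log ε| + |Real.log M|, by positivity, fun x => ?_⟩
  by_cases hx : f x = 0
  · rw [hx, norm_zero, Real.log_zero, abs_zero]; positivity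
  obtain ⟨-, h1, h2⟩ := h x hx
  have h3 := Real.log_le_log hε h1
  have h4 := Real.log_le_log (hε.trans_le h1) h2
  have := neg_abs_le (Real.log ε); have := le_abs_self (Real.log M)
  have := abs_nonneg (Real.log ε); have := abs_nonneg (Real.log M)
  rw [abs_le]; constructor <;> linarith

theorem NiceFun.powFamily (hf : NiceFun f) (κ : ℝ) (z : ℂ) :
    NiceFun (FractionalZK.powFamily κ z f) := by
  refine ⟨?_, ?_⟩
  · unfold FractionalZK.powFamily
    have := hf.measurable
    fun_prop
  obtain ⟨R, ε, M, hε, h⟩ := hf.bound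
  have hne : ∀ x, FractionalZK.powFamily κ z f x ≠ 0 → f x ≠ 0 := fun x hx h0 => hx (by
    simp [FractionalZK.powFamily, h0])
  set c := κ + κ * z.re
  have hN : 0 < max M ε := hε.trans_le (le_max_right _ _)
  refine ⟨R, min (ε ^ c) (max M ε ^ c), ε ^ c + max M ε ^ c, ?_, ?_⟩
  · exact lt_min (Real.rpow_pos_of_pos hε _) (Real.rpow_pos_of_pos hN _)
  · intro x hx
    have hx' := hne x hx
    obtain ⟨h1, h2, h3⟩ := h x hx'
    have h0 : 0 < ‖f x‖ := norm_pos_iff.2 hx'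
    rw [norm_powFamily hx']
    have h4 : ‖f x‖ ≤ max M ε := h3.trans (le_max_left _ _)
    refine ⟨h1, ?_, rpow_le_add hε h2 h4⟩
    rcases le_total 0 c with hc | hc
    · exact (min_le_left _ _).trans (Real.rpow_le_rpow hε.le h2 hc)
    · exact (min_le_right _ _).trans (Real.rpow_le_rpow_of_nonpos h0 h4 hc)

variable [InnerProductSpace ℝ E] [FiniteDimensional ℝ E] [BorelSpace E]

theorem NiceFun.memLp (hf : NiceFun f) (p : ℝ≥0∞) : MemLp f p := by
  obtain ⟨R, M, -, hM, hs⟩ := hf.exists_bound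
  have h1 : MemLp f p (volume.restrict (Metric.closedBall 0 R)) := by
    have : IsFiniteMeasure ((volume : Measure E).restrict (Metric.closedBall 0 R)) :=
      ⟨by simpa using measure_closedBall_lt_top⟩
    exact MemLp.of_bound hf.measurable.aestronglyMeasurable M (Filter.Eventually.of_forall hM)
  rw [← memLp_indicator_iff_restrict Metric.isClosed_closedBall.measurableSet] at h1
  rwa [Set.indicator_eq_self.2 hs] at h1

theorem NiceFun.integrable (hf : NiceFun f) : Integrable f :=
  memLp_one_iff_integrable.1 (hf.memLp 1)

end NiceFun

end

/-! ### The fixed-time bilinear form and its analytic interpolation -/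

section

theorem integral_norm_rpow_two_eq {E : Type*} [MeasurableSpace E] {μ : Measure E} {f g : E → ℂ}
    (hf : MemLp f 2 μ) (hg : MemLp g 2 μ) (h : eLpNorm f 2 μ = eLpNorm g 2 μ) :
    ∫ x, ‖f x‖ ^ (2 : ℝ) ∂μ = ∫ x, ‖g x‖ ^ (2 : ℝ) ∂μ := by
  have h0 : ∀ k : E → ℂ, 0 ≤ ∫ x, ‖k x‖ ^ (2 : ℝ) ∂μ := fun k => integral_nonneg fun x => by
    positivity
  rw [hf.eLpNorm_eq_integral_rpow_norm (by norm_num) (by norm_num),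
    hg.eLpNorm_eq_integral_rpow_norm (by norm_num) (by norm_num), ENNReal.toReal_ofNat,
    ENNReal.ofReal_eq_ofReal_iff (Real.rpow_nonneg (h0 _) _) (Real.rpow_nonneg (h0 _) _)] at h
  have := congrArg (fun t : ℝ => t ^ (2 : ℝ)) h
  rwa [← Real.rpow_mul (h0 _), ← Real.rpow_mul (h0 _), inv_mul_cancel₀ two_ne_zero, Real.rpow_one,
    Real.rpow_one] at this

variable {m : ℕ}

/-- The convolution kernel of the frequency localized propagator with weight `|ξ|^w`. -/
def kern (a t : ℝ) (w : ℂ) (r₁ r₂ : ℝ) (x : EuclideanSpace ℝ (Fin (m + 1))) : ℂ :=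
  ∫ η in annulus (m + 1) r₁ r₂, kernelFun a t w x η

/-- The integrand of the bilinear form of the frequency localized propagator. -/
def tripleFun (a t : ℝ) (w : ℂ) (F G : EuclideanSpace ℝ (Fin (m + 1)) → ℂ)
    (p : (EuclideanSpace ℝ (Fin (m + 1)) × EuclideanSpace ℝ (Fin (m + 1))) ×
      EuclideanSpace ℝ (Fin (m + 1))) : ℂ :=
  F p.1.1 * G p.1.2 * kernelFun a t w (p.1.1 - p.1.2) p.2

/-- The measure `dx dy dη` restricted to an annulus in `η`. -/
def tripleMeasure (m : ℕ) (r₁ r₂ : ℝ) :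
    Measure ((EuclideanSpace ℝ (Fin (m + 1)) × EuclideanSpace ℝ (Fin (m + 1))) ×
      EuclideanSpace ℝ (Fin (m + 1))) :=
  (volume.prod volume).prod (volume.restrict (annulus (m + 1) r₁ r₂))

instance isFiniteMeasure_restrict_annulus (n : ℕ) (r₁ r₂ : ℝ) :
    IsFiniteMeasure ((volume : Measure (EuclideanSpace ℝ (Fin n))).restrict (annulus n r₁ r₂)) :=
  ⟨by simpa using (isCompact_annulus n r₁ r₂).measure_lt_top⟩

theorem ae_mem_annulus (m : ℕ) (r₁ r₂ : ℝ) :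
    ∀ᵐ p ∂(tripleMeasure m r₁ r₂), p.2 ∈ annulus (m + 1) r₁ r₂ :=
  Measure.quasiMeasurePreserving_snd.ae (ae_restrict_mem (measurableSet_annulus _ _ _))

theorem integrable_tripleFun (a t : ℝ) (w : ℂ) {F G : EuclideanSpace ℝ (Fin (m + 1)) → ℂ}
    (hF : NiceFun F) (hG : NiceFun G) {r₁ r₂ : ℝ} (hr₁ : 0 < r₁) :
    Integrable (tripleFun a t w F G) (tripleMeasure m r₁ r₂) := by
  have h1 : Integrable (fun p : (EuclideanSpace ℝ (Fin (m + 1)) × EuclideanSpace ℝ (Fin (m + 1))) ×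
      EuclideanSpace ℝ (Fin (m + 1)) => (F p.1.1 * G p.1.2) *
        ((((2 * Real.pi * r₁) ^ w.re + (2 * Real.pi * r₂) ^ w.re : ℝ)) : ℂ))
      (tripleMeasure m r₁ r₂) :=
    (hF.integrable.mul_prod hG.integrable).mul_prod (integrable_const _)
  refine h1.norm.mono' ?_ ?_
  · have := hF.measurable
    have := hG.measurable
    have := measurable_disp (n := m + 1) a
    unfold tripleFun kernelFun
    refine Measurable.aestronglyMeasurable ?_
    fun_prop
  · filter_upwards [ae_mem_annulus m r₁ r₂] with p hp
    have hpi := Real.pi_pos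
    have h1 : r₁ ≤ ‖p.2‖ := hp.1
    have h2 : ‖p.2‖ ≤ r₂ := hp.2
    rw [tripleFun, norm_mul, norm_mul (F p.1.1 * G p.1.2), norm_kernelFun _ _ _ _ (hr₁.trans_le h1),
      Complex.norm_real]
    refine mul_le_mul_of_nonneg_left ?_ (norm_nonneg _)
    exact (rpow_le_add (by positivity) (by gcongr) (by gcongr)).trans (le_abs_self _)

theorem integral_tripleFun (a t : ℝ) (w : ℂ) {F G : EuclideanSpace ℝ (Fin (m + 1)) → ℂ}
    (hF : NiceFun F) (hG : NiceFun G) {r₁ r₂ : ℝ} (hr₁ : 0 < r₁) :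
    ∫ p, tripleFun a t w F G p ∂(tripleMeasure m r₁ r₂) =
      ∫ q, F q.1 * G q.2 * kern a t w r₁ r₂ (q.1 - q.2) ∂(volume.prod volume) := by
  have h := integrable_tripleFun a t w hF hG (r₂ := r₂) hr₁
  rw [tripleMeasure] at h ⊢
  rw [integral_prod _ h]
  refine integral_congr_ae (Filter.Eventually.of_forall fun q => ?_)
  simp only [tripleFun, kern]
  rw [integral_const_mul]

/-- The same triple integral read in the other order: integrating in x and y first produces Fourier
transforms and the L² bound, whereas integrating in η first produces the kernel and the L¹ bound. -/
theorem integral_tripleFun_fourier (a t : ℝ) (w : ℂ) {F G : EuclideanSpace ℝ (Fin (m + 1)) → ℂ}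
    (hF : NiceFun F) (hG : NiceFun G) {r₁ r₂ : ℝ} (hr₁ : 0 < r₁) :
    ∫ p, tripleFun a t w F G p ∂(tripleMeasure m r₁ r₂) =
      ∫ η in annulus (m + 1) r₁ r₂, kernelFun a t w 0 η * (𝓕⁻ F η * 𝓕 G η) := by
  have h := integrable_tripleFun a t w hF hG (r₂ := r₂) hr₁
  rw [tripleMeasure] at h ⊢
  rw [integral_prod_symm _ h]
  refine integral_congr_ae (Filter.Eventually.of_forall fun η => ?_)
  simp only
  rw [Real.fourierInv_eq', Real.fourier_eq', ← integral_prod_mul, ← integral_const_mul]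
  refine integral_congr_ae (Filter.Eventually.of_forall fun q => ?_)
  simp only [tripleFun, kernelFun, smul_eq_mul]
  have e : Complex.exp (Complex.I * ((2 * Real.pi * inner ℝ (q.1 - q.2) η - t * disp a η : ℝ) : ℂ)) =
      Complex.exp (Complex.I * ((2 * Real.pi * inner ℝ 0 η - t * disp a η : ℝ) : ℂ)) *
      (Complex.exp (((2 * Real.pi * inner ℝ q.1 η : ℝ) : ℂ) * Complex.I) *
        Complex.exp (((-2 * Real.pi * inner ℝ q.2 η : ℝ) : ℂ) * Complex.I)) := by
    rw [← Complex.exp_add, ← Complex.exp_add, inner_sub_left, inner_zero_left]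
    congr 1
    push_cast
    ring
  rw [e]
  ring

/-- On this line the multiplier is unimodular, so Cauchy–Schwarz and Plancherel suffice. -/
theorem norm_integral_tripleFun_le_of_re_eq_zero (a t : ℝ) {w : ℂ} (hw : w.re = 0)
    {F G : EuclideanSpace ℝ (Fin (m + 1)) → ℂ}
    (hF : NiceFun F) (hG : NiceFun G) {r₁ r₂ : ℝ} (hr₁ : 0 < r₁) :
    ‖∫ p, tripleFun a t w F G p ∂(tripleMeasure m r₁ r₂)‖ ≤
      (∫ x, ‖F x‖ ^ (2 : ℝ)) ^ (1 / 2 : ℝ) * (∫ x, ‖G x‖ ^ (2 : ℝ)) ^ (1 / 2 : ℝ) := by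
  obtain ⟨f1, f2⟩ := memLp_fourierInv hF.integrable (hF.memLp 2)
  obtain ⟨g1, g2⟩ := memLp_fourier hG.integrable (hG.memLp 2)
  have hpq : (2 : ℝ).HolderConjugate 2 := ⟨by norm_num, by norm_num, by norm_num⟩
  have f1' : MemLp (𝓕⁻ F) (ENNReal.ofReal 2) volume := by simpa using f1
  have g1' : MemLp (𝓕 G) (ENNReal.ofReal 2) volume := by simpa using g1
  have hint : Integrable (fun η => ‖𝓕⁻ F η‖ * ‖𝓕 G η‖) := by
    have := f1.norm.integrable_mul g1.norm
    exact this
  rw [integral_tripleFun_fourier a t w hF hG hr₁, ← integral_norm_rpow_two_eq f1 (hF.memLp 2) f2,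
    ← integral_norm_rpow_two_eq g1 (hG.memLp 2) g2]
  refine le_trans ?_ (integral_mul_norm_le_Lp_mul_Lq hpq f1' g1')
  refine (norm_integral_le_of_norm_le hint.integrableOn ?_).trans
    (setIntegral_le_integral hint (Filter.Eventually.of_forall fun η => by positivity))
  filter_upwards [ae_restrict_mem (measurableSet_annulus _ _ _)] with η hη
  have h1 : r₁ ≤ ‖η‖ := hη.1
  rw [norm_mul, norm_kernelFun _ _ _ _ (hr₁.trans_le h1), hw, Real.rpow_zero, one_mul, norm_mul]

theorem norm_integral_tripleFun_le_of_kern_le (a t : ℝ) {w : ℂ}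
    {F G : EuclideanSpace ℝ (Fin (m + 1)) → ℂ}
    (hF : NiceFun F) (hG : NiceFun G) {r₁ r₂ K : ℝ} (hr₁ : 0 < r₁)
    (hK : ∀ x : EuclideanSpace ℝ (Fin (m + 1)), ‖kern a t w r₁ r₂ x‖ ≤ K) :
    ‖∫ p, tripleFun a t w F G p ∂(tripleMeasure m r₁ r₂)‖ ≤
      K * ((∫ x, ‖F x‖) * (∫ x, ‖G x‖)) := by
  rw [integral_tripleFun a t w hF hG hr₁]
  have h1 := hF.integrable.norm.mul_prod hG.integrable.norm
  rw [← integral_prod_mul, ← integral_const_mul]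
  refine norm_integral_le_of_norm_le (h1.const_mul K) (Filter.Eventually.of_forall fun q => ?_)
  rw [norm_mul, norm_mul, mul_comm K]
  exact mul_le_mul_of_nonneg_left (hK _) (by positivity)

/-- The modulus of the family is |f|^(κ + κ Re z). The hypothesis on c is met by c = 2 at Re z = 0
and by c = 1 at Re z = 1, so the L² norm on one edge and the L¹ norm on the other are both powers of
the same integral. -/
theorem integral_norm_powFamily_rpow {E : Type*} [MeasurableSpace E] {μ : Measure E} {κ c : ℝ}
    (hκ : 0 < κ) (hc : 0 < c) {z : ℂ} {f : E → ℂ} (h : (κ + κ * z.re) * c = 2 * κ) :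
    ∫ x, ‖powFamily κ z f x‖ ^ c ∂μ = ∫ x, ‖f x‖ ^ (2 * κ) ∂μ := by
  refine integral_congr_ae (Filter.Eventually.of_forall fun x => ?_)
  by_cases hx : f x = 0
  · simp only [powFamily, hx, zero_mul, norm_zero]
    rw [Real.zero_rpow hc.ne', Real.zero_rpow (by positivity)]
  · simp only
    rw [norm_powFamily hx, ← Real.rpow_mul (norm_nonneg _), h]

/-- The bilinear form as a function of the interpolation parameter. -/
def analyticForm (a t β κ r₁ r₂ : ℝ) (f g : EuclideanSpace ℝ (Fin (m + 1)) → ℂ) (z : ℂ) : ℂ :=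
  ∫ p, tripleFun a t (-(β * z)) (powFamily κ z f) (powFamily κ z g) p ∂(tripleMeasure m r₁ r₂)

/-- All dependence on z, from both power families and from the multiplier, collects into one factor
exp(z L) with L real and bounded on the annulus. Both claims follow from this. -/
theorem analyticForm_props (a t β κ : ℝ) {r₁ r₂ : ℝ} (hr₁ : 0 < r₁)
    {f g : EuclideanSpace ℝ (Fin (m + 1)) → ℂ} (hf : NiceFun f) (hg : NiceFun g) :
    Differentiable ℂ (analyticForm a t β κ r₁ r₂ f g) ∧
      ∃ D : ℝ, ∀ z : ℂ, |z.re| ≤ 1 → ‖analyticForm a t β κ r₁ r₂ f g z‖ ≤ D := by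
  have hpi := Real.pi_pos
  set h : (EuclideanSpace ℝ (Fin (m + 1)) × EuclideanSpace ℝ (Fin (m + 1))) ×
    EuclideanSpace ℝ (Fin (m + 1)) → ℂ := tripleFun a t 0 (powFamily κ 0 f) (powFamily κ 0 g) with hh
  set L : (EuclideanSpace ℝ (Fin (m + 1)) × EuclideanSpace ℝ (Fin (m + 1))) ×
    EuclideanSpace ℝ (Fin (m + 1)) → ℝ := fun p =>
    κ * (Real.log ‖f p.1.1‖ + Real.log ‖g p.1.2‖) - β * Real.log (2 * Real.pi * ‖p.2‖) with hL
  have hint : Integrable h (tripleMeasure m r₁ r₂) :=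
    integrable_tripleFun a t 0 (hf.powFamily κ 0) (hg.powFamily κ 0) hr₁
  have hLm : AEStronglyMeasurable L (tripleMeasure m r₁ r₂) := by
    have := hf.measurable
    have := hg.measurable
    refine Measurable.aestronglyMeasurable ?_
    rw [hL]
    fun_prop
  obtain ⟨B₁, hB₁0, hB₁⟩ := hf.exists_log_bound
  obtain ⟨B₂, hB₂0, hB₂⟩ := hg.exists_log_bound
  set B₃ := |Real.log (2 * Real.pi * r₁)| + |Real.log (2 * Real.pi * r₂)| with hB₃
  have hLb : ∀ᵐ p ∂(tripleMeasure m r₁ r₂), |L p| ≤ |κ| * (B₁ + B₂) + |β| * B₃ := by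
    filter_upwards [ae_mem_annulus m r₁ r₂] with p hp
    have h1 : r₁ ≤ ‖p.2‖ := hp.1
    have h2 : ‖p.2‖ ≤ r₂ := hp.2
    have h3 : |Real.log (2 * Real.pi * ‖p.2‖)| ≤ B₃ := by
      have e1 : Real.log (2 * Real.pi * r₁) ≤ Real.log (2 * Real.pi * ‖p.2‖) :=
        Real.log_le_log (by positivity) (by gcongr)
      have e2 : Real.log (2 * Real.pi * ‖p.2‖) ≤ Real.log (2 * Real.pi * r₂) :=
        Real.log_le_log (mul_pos (by positivity) (hr₁.trans_le h1)) (by gcongr)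
      have := neg_abs_le (Real.log (2 * Real.pi * r₁))
      have := le_abs_self (Real.log (2 * Real.pi * r₂))
      have := abs_nonneg (Real.log (2 * Real.pi * r₁))
      have := abs_nonneg (Real.log (2 * Real.pi * r₂))
      rw [hB₃, abs_le]; constructor <;> linarith
    rw [hL]
    refine (abs_sub _ _).trans (add_le_add ?_ ?_)
    · rw [abs_mul]
      exact mul_le_mul_of_nonneg_left ((abs_add_le _ _).trans (add_le_add (hB₁ _) (hB₂ _)))
        (abs_nonneg _)
    · rw [abs_mul]
      exact mul_le_mul_of_nonneg_left h3 (abs_nonneg _)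
  have heq : analyticForm a t β κ r₁ r₂ f g =
      fun z => ∫ p, h p * Complex.exp (z * L p) ∂(tripleMeasure m r₁ r₂) := by
    ext z
    refine integral_congr_ae ?_
    filter_upwards [ae_mem_annulus m r₁ r₂] with p hp
    have h1 : r₁ ≤ ‖p.2‖ := hp.1
    have h0 : 0 < 2 * Real.pi * ‖p.2‖ := mul_pos (by positivity) (hr₁.trans_le h1)
    have h0' : ((2 * Real.pi * ‖p.2‖ : ℝ) : ℂ) ≠ 0 := by exact_mod_cast h0.ne'
    simp only [hh, hL, tripleFun, kernelFun, powFamily]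
    rw [Complex.cpow_def_of_ne_zero h0', Complex.cpow_zero, ← Complex.ofReal_log h0.le]
    have e : ∀ A B : ℂ, f p.1.1 * Complex.exp ((κ - 1 + κ * z) * A) *
        (g p.1.2 * Complex.exp ((κ - 1 + κ * z) * B)) =
        f p.1.1 * Complex.exp ((κ - 1 + κ * 0) * A) *
        (g p.1.2 * Complex.exp ((κ - 1 + κ * 0) * B)) * Complex.exp (z * (κ * (A + B))) := by
      intro A B
      have e1 : ∀ A : ℂ, Complex.exp ((κ - 1 + κ * z) * A) =
          Complex.exp ((κ - 1 + κ * 0) * A) * Complex.exp (z * (κ * A)) := fun A => by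
        rw [← Complex.exp_add]; congr 1; ring
      rw [e1, e1, mul_add, mul_add z, Complex.exp_add]
      ring
    rw [e]
    push_cast
    rw [mul_sub z, sub_eq_add_neg (z * _), Complex.exp_add]
    have e2 : ∀ l : ℂ, -(z * (β * l)) = l * -(β * z) := fun l => by ring
    rw [e2]
    ring
  refine ⟨heq ▸ differentiable_integral_mul_exp hint hLm hLb,
    (∫ p, ‖h p‖ ∂(tripleMeasure m r₁ r₂)) * Real.exp (|κ| * (B₁ + B₂) + |β| * B₃), fun z hz => ?_⟩
  rw [heq]
  simp only
  rw [← integral_mul_const]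
  refine norm_integral_le_of_norm_le (hint.norm.mul_const _) ?_
  filter_upwards [hLb] with p hp
  rw [norm_mul, Complex.norm_exp]
  refine mul_le_mul_of_nonneg_left (Real.exp_le_exp.2 ?_) (norm_nonneg _)
  simp only [Complex.mul_re, Complex.ofReal_re, Complex.ofReal_im, mul_zero, sub_zero]
  calc z.re * L p ≤ |z.re * L p| := le_abs_self _
    _ = |z.re| * |L p| := abs_mul _ _
    _ ≤ 1 * |L p| := mul_le_mul_of_nonneg_right hz (abs_nonneg _)
    _ ≤ _ := by rw [one_mul]; exact hp

/-- The fixed time estimate from `L^{p'}` to `L^p`, in bilinear form. -/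
theorem exists_fixed_time_bound (hm : 2 ≤ m) {a : ℝ} (ha : 1 ≤ a) (ha' : a ≤ 2) {θ : ℝ}
    (hθ₀ : 0 < θ) (hθ₁ : θ < 1) :
    ∃ C : ℝ, 0 ≤ C ∧ ∀ (t r₁ r₂ : ℝ) (f g : EuclideanSpace ℝ (Fin (m + 1)) → ℂ), t ≠ 0 → 0 < r₁ →
      r₁ ≤ r₂ → NiceFun f → NiceFun g →
      ‖∫ q, f q.1 * g q.2 * kern a t (-((θ * (m - a) : ℝ) : ℂ)) r₁ r₂ (q.1 - q.2)
        ∂(volume.prod volume)‖ ≤ C * |t| ^ (-θ) *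
        ((∫ x, ‖f x‖ ^ (2 / (1 + θ))) * ∫ x, ‖g x‖ ^ (2 / (1 + θ))) ^ ((1 + θ) / 2) := by
  obtain ⟨C, hC, hker⟩ := exists_kernel_bound hm ha
  set β : ℝ := m - a with hβ
  have hβ0 : 0 ≤ β := by
    have : (2 : ℝ) ≤ m := by exact_mod_cast hm
    rw [hβ]; linarith
  -- With this κ the exponent κ(1 + θ) equals 1, so the family passes through f and g themselves at
  -- z = θ, and 2κ is the exponent p'.
  set κ : ℝ := 1 / (1 + θ) with hκ
  have hκ0 : 0 < κ := by positivity
  have h2κ : 2 / (1 + θ) = 2 * κ := by rw [hκ]; ring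
  set K := Real.exp 1 * (1 + β) * C with hK
  have hK0 : 0 ≤ K := by positivity
  refine ⟨K ^ θ, by positivity, fun t r₁ r₂ f g ht hr₁ hr hf hg => ?_⟩
  rw [h2κ]
  set A := ∫ x, ‖f x‖ ^ (2 * κ) with hA
  set B := ∫ x, ‖g x‖ ^ (2 * κ) with hB
  have hA0 : 0 ≤ A := integral_nonneg fun x => by positivity
  have hB0 : 0 ≤ B := integral_nonneg fun x => by positivity
  have htp : 0 < |t| := abs_pos.2 ht
  set J := analyticForm a t β κ r₁ r₂ f g with hJ
  obtain ⟨hJd, D, hD⟩ := analyticForm_props a t β κ (r₂ := r₂) hr₁ hf hg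
  -- The Gaussian factor exp(z²) absorbs the growth in Im z of the kernel bound on the line Re z =
  -- 1; at the real point θ its modulus is at least 1, so it costs nothing.
  set Φ : ℂ → ℂ := fun z => Complex.exp (z ^ 2) * J z with hΦ
  have hΦd : Differentiable ℂ Φ := by
    rw [hΦ]; exact Differentiable.mul (by fun_prop) hJd
  have hexp : ∀ z : ℂ, ‖Complex.exp (z ^ 2)‖ = Real.exp (z.re ^ 2 - z.im ^ 2) := fun z => by
    rw [Complex.norm_exp]; congr 1; rw [sq z, Complex.mul_re]; ring
  have hlog : ∀ {k : EuclideanSpace ℝ (Fin (m + 1)) → ℂ} (x), k x = 0 ∨ k x ≠ 0 := fun x => em _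
  have hmem : ((θ : ℂ)) ∈ Complex.HadamardThreeLines.verticalClosedStrip 0 1 := by
    constructor <;> simp <;> linarith
  have h3 := Complex.HadamardThreeLines.norm_le_interp_of_mem_verticalClosedStrip₀₁' Φ
    (z := (θ : ℂ)) (a := (A * B) ^ (1 / 2 : ℝ)) (b := K / |t| * (A * B)) hmem
    hΦd.diffContOnCl ?_ ?_ ?_
  · have hJθ : J θ = ∫ q, f q.1 * g q.2 * kern a t (-((θ * β : ℝ) : ℂ)) r₁ r₂ (q.1 - q.2)
        ∂(volume.prod volume) := by
      have hp : ∀ k : EuclideanSpace ℝ (Fin (m + 1)) → ℂ, powFamily κ (θ : ℂ) k = k := fun k => by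
        ext x
        have : (κ : ℂ) - 1 + κ * θ = 0 := by
          have : κ - 1 + κ * θ = 0 := by rw [hκ]; field_simp; linarith
          exact_mod_cast this
        simp [powFamily, this]
      have e : -((β : ℂ) * θ) = -((θ * β : ℝ) : ℂ) := by push_cast; ring
      rw [hJ, analyticForm, hp, hp, integral_tripleFun a t _ hf hg hr₁, e]
    rw [← hJθ]
    have h4 : ‖J θ‖ ≤ ‖Φ θ‖ := by
      rw [hΦ]; simp only
      rw [norm_mul, hexp]
      refine le_mul_of_one_le_left (norm_nonneg _) (Real.one_le_exp ?_)
      simp; positivity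
    refine h4.trans (h3.trans (le_of_eq ?_))
    have hAB : 0 ≤ A * B := mul_nonneg hA0 hB0
    rw [Complex.ofReal_re, Real.mul_rpow (by positivity) hAB, Real.div_rpow hK0 htp.le,
      ← Real.rpow_mul hAB, Real.rpow_neg htp.le]
    have : (A * B) ^ ((1 + θ) / 2) = (A * B) ^ (1 / 2 * (1 - θ)) * (A * B) ^ θ := by
      rcases hAB.eq_or_lt with h0 | h0
      · rw [← h0, Real.zero_rpow (by linarith), Real.zero_rpow (by linarith), zero_mul]
      · rw [← Real.rpow_add h0]; congr 1; ring
    rw [this]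
    field_simp
  · refine ⟨Real.exp 1 * D, ?_⟩
    rintro _ ⟨z, hz, rfl⟩
    have hz' : 0 ≤ z.re ∧ z.re ≤ 1 := hz
    simp only [Function.comp, hΦ]
    rw [norm_mul, hexp]
    refine mul_le_mul (Real.exp_le_exp.2 ?_) (hD z ?_) (norm_nonneg _) (Real.exp_pos _).le
    · nlinarith [sq_nonneg z.im]
    · rw [abs_le]; constructor <;> linarith
  · intro z hz
    have hz : z.re = 0 := hz
    simp only [hΦ]
    rw [norm_mul, hexp, Real.mul_rpow hA0 hB0]
    have h5 := norm_integral_tripleFun_le_of_re_eq_zero a t (w := -(β * z)) (by simp [hz])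
      (hf.powFamily κ z) (hg.powFamily κ z) (r₂ := r₂) hr₁
    rw [integral_norm_powFamily_rpow hκ0 two_pos (by rw [hz]; ring),
      integral_norm_powFamily_rpow hκ0 two_pos (by rw [hz]; ring)] at h5
    refine (mul_le_of_le_one_left (norm_nonneg _) (Real.exp_le_one_iff.2 ?_)).trans h5
    rw [hz]; nlinarith [sq_nonneg z.im]
  · intro z hz
    have hz : z.re = 1 := hz
    simp only [hΦ]
    -- On Re z = 1 the multiplier is the one of the kernel bound, with γ = −β Im z.
    have hw : -((β : ℂ) * z) = -((m - a : ℝ) : ℂ) + Complex.I * ((-(β * z.im) : ℝ) : ℂ) := by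
      apply Complex.ext <;> simp [hz, hβ]
    have h5 := norm_integral_tripleFun_le_of_kern_le a t (w := -(β * z))
      (hf.powFamily κ z) (hg.powFamily κ z) (r₂ := r₂) (K := C * (1 + |-(β * z.im)|) / |t|) hr₁
      (fun x => by rw [hw]; exact hker _ t r₁ r₂ x ht hr₁ hr)
    have h6 : ∀ k : EuclideanSpace ℝ (Fin (m + 1)) → ℂ,
        ∫ x, ‖powFamily κ z k x‖ = ∫ x, ‖k x‖ ^ (2 * κ) := fun k => by
      rw [← integral_norm_powFamily_rpow (z := z) hκ0 one_pos (by rw [hz]; ring)]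
      simp
    rw [h6, h6] at h5
    rw [norm_mul, hexp, hz]
    refine (mul_le_mul_of_nonneg_left h5 (Real.exp_pos _).le).trans ?_
    rw [abs_neg, abs_mul, abs_of_nonneg hβ0]
    have h7 : Real.exp (1 ^ 2 - z.im ^ 2) * (1 + β * |z.im|) ≤ Real.exp 1 * (1 + β) := by
      have e1 : Real.exp (1 ^ 2 - z.im ^ 2) = Real.exp 1 * Real.exp (-(z.im ^ 2)) := by
        rw [← Real.exp_add]; congr 1; ring
      have e2 : Real.exp (-(z.im ^ 2)) ≤ 1 := Real.exp_le_one_iff.2 (by nlinarith [sq_nonneg z.im])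
      have e3 : Real.exp (-(z.im ^ 2)) * |z.im| ≤ 1 := by
        have h8 : |z.im| ≤ Real.exp (z.im ^ 2) := by
          have := Real.add_one_le_exp (z.im ^ 2)
          have h9 := sq_abs z.im
          nlinarith [sq_nonneg (|z.im| - 1), abs_nonneg z.im]
        calc _ ≤ Real.exp (-(z.im ^ 2)) * Real.exp (z.im ^ 2) := by gcongr
          _ = 1 := by rw [← Real.exp_add]; simp
      rw [e1, mul_assoc]
      refine mul_le_mul_of_nonneg_left ?_ (Real.exp_pos _).le
      nlinarith
    have h8 : 0 ≤ C / |t| * (A * B) := by positivity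
    calc _ = Real.exp (1 ^ 2 - z.im ^ 2) * (1 + β * |z.im|) * (C / |t| * (A * B)) := by ring
      _ ≤ Real.exp 1 * (1 + β) * (C / |t| * (A * B)) := mul_le_mul_of_nonneg_right h7 h8
      _ = _ := by rw [hK]; ring

end

/-! ### The Hardy-Littlewood-Sobolev inequality on the line -/

theorem lintegral_comp_abs (F : ℝ → ℝ≥0∞) :
    ∫⁻ u, F |u| = 2 * ∫⁻ u in Set.Ioi (0 : ℝ), F u := by
  rw [← lintegral_add_compl (fun u => F |u|) (measurableSet_Ioi (a := (0 : ℝ))), two_mul]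
  congr 1
  · exact setLIntegral_congr_fun measurableSet_Ioi fun u hu => by
      rw [abs_of_pos hu]
  · rw [Set.compl_Ioi, ← lintegral_indicator measurableSet_Iic, ← lintegral_neg_eq_self,
      ← Measure.restrict_congr_set (Ioi_ae_eq_Ici (a := (0 : ℝ))).symm, ← lintegral_indicator measurableSet_Ici]
    refine lintegral_congr fun u => ?_
    by_cases hu : 0 ≤ u
    · rw [Set.indicator_of_mem (show -u ∈ Set.Iic 0 by simpa using hu),
        Set.indicator_of_mem (show u ∈ Set.Ici 0 from hu), abs_neg, abs_of_nonneg hu]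
    · rw [Set.indicator_of_notMem (show -u ∉ Set.Iic 0 by simpa using hu),
        Set.indicator_of_notMem (show u ∉ Set.Ici 0 from hu)]

theorem lintegral_near {θ ρ : ℝ} (hθ₁ : θ < 1) (hρ : 0 < ρ) (t : ℝ) :
    ∫⁻ t', (Set.Iic ρ).indicator (fun u => ENNReal.ofReal (u ^ (-θ))) |t - t'| =
      2 * ENNReal.ofReal (ρ ^ (1 - θ) / (1 - θ)) := by
  rw [lintegral_sub_left_eq_self
      (fun v => (Set.Iic ρ).indicator (fun u => ENNReal.ofReal (u ^ (-θ))) |v|) t,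
    lintegral_comp_abs, lintegral_indicator measurableSet_Iic,
    Measure.restrict_restrict measurableSet_Iic, Set.Iic_inter_Ioi,
    ← ofReal_integral_eq_lintegral_ofReal, ← intervalIntegral.integral_of_le hρ.le,
    integral_rpow (Or.inl (by linarith)), Real.zero_rpow (by linarith)]
  · congr 3
    · rw [sub_zero]; congr 1; ring
    · ring
  · exact (intervalIntegral.intervalIntegrable_rpow' (a := 0) (b := ρ) (by linarith)).1
  · filter_upwards [ae_restrict_mem measurableSet_Ioc] with u hu
    exact Real.rpow_nonneg hu.1.le _

/-- The exponent −2 is −θ · (2/θ): the kernel enters through Hölder's inequality with exponent 2/θ,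
whose dual is 2/(2 − θ). -/
theorem lintegral_far {ρ : ℝ} (hρ : 0 < ρ) (t : ℝ) :
    ∫⁻ t', (Set.Ioi ρ).indicator (fun u => ENNReal.ofReal (u ^ (-2 : ℝ))) |t - t'| =
      2 * ENNReal.ofReal (1 / ρ) := by
  rw [lintegral_sub_left_eq_self
      (fun v => (Set.Ioi ρ).indicator (fun u => ENNReal.ofReal (u ^ (-2 : ℝ))) |v|) t,
    lintegral_comp_abs, lintegral_indicator measurableSet_Ioi,
    Measure.restrict_restrict measurableSet_Ioi, 
    show Set.Ioi ρ ∩ Set.Ioi 0 = Set.Ioi ρ from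
      Set.inter_eq_left.2 fun u hu => Set.mem_Ioi.2 (hρ.trans (Set.mem_Ioi.1 hu)),
    ← ofReal_integral_eq_lintegral_ofReal, integral_Ioi_rpow_of_lt (by norm_num) hρ]
  · congr 2
    norm_num
    rw [Real.rpow_neg_one]
  · exact integrableOn_Ioi_rpow_of_lt (by norm_num) hρ
  · filter_upwards [ae_restrict_mem measurableSet_Ioi] with u hu
    exact Real.rpow_nonneg (hρ.le.trans (le_of_lt hu)) _

/-- The constant in the Hardy-Littlewood-Sobolev inequality. -/
def hlsConst (θ : ℝ) : ℝ≥0∞ := 2 * ENNReal.ofReal (1 / (1 - θ)) + 2 ^ (θ / 2)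

theorem hlsConst_ne_top {θ : ℝ} (hθ : 0 < θ) : hlsConst θ ≠ ∞ := by
  unfold hlsConst
  refine ENNReal.add_ne_top.2 ⟨ENNReal.mul_ne_top (by simp) (by simp), ?_⟩
  exact ENNReal.rpow_ne_top_of_nonneg (by positivity) (by simp)

/-- A pointwise bound in the manner of Hedberg. Within distance ρ of t, k(t') is replaced by the
larger k(t) and the kernel is integrated; beyond ρ, Hölder's inequality uses the integrability of k.
-/
theorem lintegral_fractional_le {θ : ℝ} (hθ₀ : 0 < θ) (hθ₁ : θ < 1) {k : ℝ → ℝ} (hk : Measurable k)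
    (hk0 : ∀ t, 0 ≤ k t) {X : ℝ} (hX : 0 < X)
    (hkX : ∫⁻ t, ENNReal.ofReal (k t ^ (2 / (2 - θ))) ≤ ENNReal.ofReal X) (t : ℝ) (ht : 0 < k t) :
    ∫⁻ t', {t' | k t' ≤ k t}.indicator
        (fun t' => ENNReal.ofReal (|t - t'| ^ (-θ)) * ENNReal.ofReal (k t')) t' ≤
      hlsConst θ * ENNReal.ofReal (X ^ (1 - θ) * k t ^ (θ / (2 - θ))) := by
  set r := 2 / (2 - θ) with hr
  have h2θ : 0 < 2 - θ := by linarith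
  have hr0 : 0 < r := by positivity
  -- This radius balances the two contributions: both become X^(1−θ) k(t)^(θ/(2−θ)).
  set ρ := X * k t ^ (-r) with hρ
  have hρ0 : 0 < ρ := by positivity
  set N : ℝ → ℝ≥0∞ := fun t' => (Set.Iic ρ).indicator (fun u => ENNReal.ofReal (u ^ (-θ))) |t - t'|
    with hN
  set S : ℝ → ℝ≥0∞ := fun t' => (Set.Ioi ρ).indicator (fun u => ENNReal.ofReal (u ^ (-θ))) |t - t'|
    with hS
  have hNm : Measurable N :=
    (Measurable.indicator (by fun_prop) measurableSet_Iic).comp (by fun_prop)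
  have hSm : Measurable S :=
    (Measurable.indicator (by fun_prop) measurableSet_Ioi).comp (by fun_prop)
  have hkm : Measurable fun t' => ENNReal.ofReal (k t') := by fun_prop
  have h1 : ∀ t', {t' | k t' ≤ k t}.indicator
      (fun t' => ENNReal.ofReal (|t - t'| ^ (-θ)) * ENNReal.ofReal (k t')) t' ≤
      N t' * ENNReal.ofReal (k t) + S t' * ENNReal.ofReal (k t') := by
    intro t'
    by_cases ht' : k t' ≤ k t
    swap
    · rw [Set.indicator_of_notMem (show t' ∉ {t' | k t' ≤ k t} from ht')]
      exact bot_le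
    rw [Set.indicator_of_mem (show t' ∈ {t' | k t' ≤ k t} from ht')]
    by_cases hu : |t - t'| ≤ ρ
    · simp only [hN]
      rw [Set.indicator_of_mem (show |t - t'| ∈ Set.Iic ρ from hu)]
      refine le_trans ?_ le_self_add
      gcongr
    · simp only [hS]
      rw [Set.indicator_of_mem (show |t - t'| ∈ Set.Ioi ρ from not_le.1 hu)]
      exact le_add_self
  have h2 : ∫⁻ t', N t' * ENNReal.ofReal (k t) =
      2 * ENNReal.ofReal (1 / (1 - θ)) * ENNReal.ofReal (X ^ (1 - θ) * k t ^ (θ / (2 - θ))) := by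
    rw [lintegral_mul_const _ hNm, hN, lintegral_near hθ₁ hρ0, mul_assoc, mul_assoc,
      ← ENNReal.ofReal_mul (by have : 0 < 1 - θ := by linarith
                               positivity),
      ← ENNReal.ofReal_mul (by have : 0 < 1 - θ := by linarith
                               positivity)]
    congr 2
    rw [hρ, Real.mul_rpow hX.le (by positivity), ← Real.rpow_mul ht.le]
    have : k t ^ (θ / (2 - θ)) = k t ^ (-r * (1 - θ)) * k t := by
      rw [← Real.rpow_add_one ht.ne']; congr 1; rw [hr]; field_simp; ring
    rw [this]; ring
  have h3 : ∫⁻ t', S t' * ENNReal.ofReal (k t') ≤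
      2 ^ (θ / 2) * ENNReal.ofReal (X ^ (1 - θ) * k t ^ (θ / (2 - θ))) := by
    have hpq : (2 / θ).HolderConjugate r := by
      refine ⟨?_, by positivity, hr0⟩
      rw [hr]; field_simp; ring
    refine (ENNReal.lintegral_mul_le_Lp_mul_Lq volume hpq hSm.aemeasurable
      hkm.aemeasurable).trans ?_
    have e1 : ∫⁻ t', S t' ^ (2 / θ) = 2 * ENNReal.ofReal (1 / ρ) := by
      rw [← lintegral_far hρ0 t]
      refine lintegral_congr fun t' => ?_
      simp only [hS]
      by_cases hu : |t - t'| ∈ Set.Ioi ρ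
      · rw [Set.indicator_of_mem hu, Set.indicator_of_mem hu,
          ENNReal.ofReal_rpow_of_nonneg (by positivity) (by positivity),
          ← Real.rpow_mul (abs_nonneg _)]
        congr 2; field_simp
      · rw [Set.indicator_of_notMem hu, Set.indicator_of_notMem hu,
          ENNReal.zero_rpow_of_pos (by positivity)]
    have e2 : ∫⁻ t', ENNReal.ofReal (k t') ^ r ≤ ENNReal.ofReal X := by
      refine le_trans (le_of_eq (lintegral_congr fun t' => ?_)) hkX
      rw [ENNReal.ofReal_rpow_of_nonneg (hk0 t') hr0.le]
    rw [e1]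
    calc _ ≤ (2 * ENNReal.ofReal (1 / ρ)) ^ (1 / (2 / θ)) * ENNReal.ofReal X ^ (1 / r) := by
          gcongr
      _ = 2 ^ (θ / 2) * ENNReal.ofReal ((1 / ρ) ^ (θ / 2) * X ^ (1 / r)) := by
          rw [one_div_div, ENNReal.mul_rpow_of_nonneg _ _ (by positivity),
            ENNReal.ofReal_rpow_of_nonneg (by positivity) (by positivity),
            ENNReal.ofReal_rpow_of_nonneg hX.le (by positivity), mul_assoc,
            ← ENNReal.ofReal_mul (by positivity)]
      _ = _ := by
          congr 2
          rw [hρ, one_div, Real.inv_rpow (by positivity), Real.mul_rpow hX.le (by positivity),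
            ← Real.rpow_mul ht.le, mul_inv, ← Real.rpow_neg hX.le, ← Real.rpow_neg ht.le,
            mul_right_comm, ← Real.rpow_add hX]
          congr 2
          · rw [hr]; field_simp; ring
          · rw [hr]; field_simp
  calc _ ≤ ∫⁻ t', (N t' * ENNReal.ofReal (k t) + S t' * ENNReal.ofReal (k t')) :=
        lintegral_mono h1
    _ = (∫⁻ t', N t' * ENNReal.ofReal (k t)) + ∫⁻ t', S t' * ENNReal.ofReal (k t') :=
        lintegral_add_left (hNm.mul_const _) _
    _ ≤ _ := by rw [h2, hlsConst, add_mul]; gcongr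

/-- The diagonal Hardy-Littlewood-Sobolev inequality. -/
theorem hls {θ : ℝ} (hθ₀ : 0 < θ) (hθ₁ : θ < 1) {k : ℝ → ℝ} (hk : Measurable k)
    (hk0 : ∀ t, 0 ≤ k t) {X : ℝ} (hX : 0 < X)
    (hkX : ∫⁻ t, ENNReal.ofReal (k t ^ (2 / (2 - θ))) ≤ ENNReal.ofReal X) :
    ∫⁻ t, ∫⁻ t', ENNReal.ofReal (|t - t'| ^ (-θ)) * ENNReal.ofReal (k t) * ENNReal.ofReal (k t') ≤
      2 * hlsConst θ * ENNReal.ofReal (X ^ (2 - θ)) := by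
  have h2θ : 0 < 2 - θ := by linarith
  set W : ℝ → ℝ → ℝ≥0∞ := fun t t' =>
    ENNReal.ofReal (|t - t'| ^ (-θ)) * ENNReal.ofReal (k t) * ENNReal.ofReal (k t') with hW
  -- By symmetry of the kernel it is enough to treat the half where the first variable carries the
  -- larger value of k.
  set W₁ : ℝ × ℝ → ℝ≥0∞ := {z : ℝ × ℝ | k z.2 ≤ k z.1}.indicator (fun z => W z.1 z.2) with hW₁
  have hWm : Measurable fun z : ℝ × ℝ => W z.1 z.2 := by rw [hW]; fun_prop
  have hW₁m : Measurable W₁ := hWm.indicator (measurableSet_le (by fun_prop) (by fun_prop))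
  have hsplit : ∀ t t', W t t' ≤ W₁ (t, t') + W₁ (t', t) := by
    intro t t'
    rcases le_total (k t') (k t) with h | h
    · simp only [hW₁]
      rw [Set.indicator_of_mem (show (t, t') ∈ {z : ℝ × ℝ | k z.2 ≤ k z.1} from h)]
      exact le_self_add
    · simp only [hW₁]
      rw [Set.indicator_of_mem (show (t', t) ∈ {z : ℝ × ℝ | k z.2 ≤ k z.1} from h)]
      refine le_trans (le_of_eq ?_) le_add_self
      simp only [hW]
      rw [abs_sub_comm, mul_right_comm]
  have hinner : ∀ t, ∫⁻ t', W₁ (t, t') ≤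
      hlsConst θ * (ENNReal.ofReal (X ^ (1 - θ)) * ENNReal.ofReal (k t ^ (2 / (2 - θ)))) := by
    intro t
    rcases (hk0 t).eq_or_lt with h0 | h0
    · refine le_trans (le_of_eq ?_) bot_le
      have h1 : ∀ t', W₁ (t, t') = 0 := fun t' => by simp [hW₁, hW, ← h0]
      simp [h1]
    · have e1 : ∀ t', W₁ (t, t') = ENNReal.ofReal (k t) * {t' | k t' ≤ k t}.indicator
          (fun t' => ENNReal.ofReal (|t - t'| ^ (-θ)) * ENNReal.ofReal (k t')) t' := by
        intro t'
        simp only [hW₁, hW, Set.indicator, Set.mem_ofPred_eq]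
        split_ifs
        · ring
        · simp
      simp only [e1]
      rw [lintegral_const_mul _ (Measurable.indicator (by fun_prop)
        (measurableSet_le hk measurable_const))]
      refine (mul_le_mul_right (lintegral_fractional_le hθ₀ hθ₁ hk hk0 hX hkX t h0) _).trans
        (le_of_eq ?_)
      rw [mul_left_comm, ← ENNReal.ofReal_mul h0.le, ← ENNReal.ofReal_mul (by positivity)]
      congr 2
      -- The outer factor k(t) completes the pointwise bound to exactly the power whose integral is
      -- controlled.
      have : k t ^ (2 / (2 - θ)) = k t * k t ^ (θ / (2 - θ)) := by
        rw [mul_comm, ← Real.rpow_add_one h0.ne']; congr 1; field_simp; ring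
      rw [this]; ring
  have hmain : ∫⁻ t, ∫⁻ t', W₁ (t, t') ≤ hlsConst θ * ENNReal.ofReal (X ^ (2 - θ)) := by
    refine (lintegral_mono hinner).trans ?_
    rw [lintegral_const_mul _ (by fun_prop), lintegral_const_mul _ (by fun_prop)]
    have : X ^ (2 - θ) = X ^ (1 - θ) * X := by
      rw [← Real.rpow_add_one hX.ne']; congr 1; ring
    rw [this, ENNReal.ofReal_mul (by positivity)]
    gcongr
  calc _ ≤ ∫⁻ t, ∫⁻ t', (W₁ (t, t') + W₁ (t', t)) :=
        lintegral_mono fun t => lintegral_mono fun t' => hsplit t t'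
    _ = (∫⁻ t, ∫⁻ t', W₁ (t, t')) + ∫⁻ t, ∫⁻ t', W₁ (t', t) := by
        rw [← lintegral_add_left hW₁m.lintegral_prod_right']
        refine lintegral_congr fun t => ?_
        exact (lintegral_add_left (f := fun t' => W₁ (t, t'))
          (hW₁m.comp measurable_prodMk_left) _).symm ▸ rfl
    _ = (∫⁻ t, ∫⁻ t', W₁ (t, t')) + ∫⁻ t, ∫⁻ t', W₁ (t, t') := by
        congr 1
        exact lintegral_lintegral_swap (f := fun t t' => W₁ (t', t))
          (hW₁m.comp measurable_swap).aemeasurable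
    _ ≤ _ := by
        rw [← two_mul, mul_assoc]
        gcongr

/-! ### Duality for mixed norms through truncated extremizers -/

section

theorem integrable_of_bounded_of_forall_notMem {α F : Type*} [MeasurableSpace α]
    [NormedAddCommGroup F] {μ : Measure α} {f : α → F} (hf : AEStronglyMeasurable f μ) {S : Set α}
    (hS : μ S ≠ ∞) {C : ℝ} (hC : ∀ x, ‖f x‖ ≤ C) (h0 : ∀ x, x ∉ S → f x = 0) : Integrable f μ :=
  (Measure.integrableOn_of_bounded hS hf
    (Filter.Eventually.of_forall hC)).integrable_of_forall_notMem_eq_zero h0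

section TestFun

variable {E : Type*} [NormedAddCommGroup E] [MeasurableSpace E]

/-- Bounded space-time functions with bounded support all of whose time slices satisfy
`NiceFun`. -/
structure TestFun (G : ℝ × E → ℂ) : Prop where
  measurable : Measurable G
  bound : ∃ R K : ℝ, (∀ z, ‖G z‖ ≤ K) ∧ ∀ z, G z ≠ 0 → z ∈ Set.Icc (-R) R ×ˢ Metric.closedBall 0 R
  slice : ∀ t, NiceFun fun x => G (t, x)

end TestFun

section Duality

set_option linter.unusedSectionVars false

variable {E : Type*} [NormedAddCommGroup E] [InnerProductSpace ℝ E] [FiniteDimensional ℝ E]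
  [MeasurableSpace E] [BorelSpace E]

theorem TestFun.integrable {G : ℝ × E → ℂ} (hG : TestFun G) : Integrable G := by
  obtain ⟨R, K, hK, hs⟩ := hG.bound
  refine integrable_of_bounded_of_forall_notMem hG.measurable.aestronglyMeasurable
    (S := Set.Icc (-R) R ×ˢ Metric.closedBall 0 R) ?_ hK fun z hz => by_contra fun h => hz (hs z h)
  exact ((isCompact_Icc.prod (isCompact_closedBall _ _)).measure_lt_top).ne

/-- The truncation used for the test functions. -/
def truncFun (p : ℝ) (N : ℝ) (u : ℝ × E → ℂ) (z : ℝ × E) : ℝ :=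
  {z : ℝ × E | ‖z.2‖ ≤ N ∧ 1 / N ≤ ‖u z‖}.indicator (fun z => ‖u z‖ ^ p) z

/-- The spatial integral of the truncation. -/
def truncInt (p : ℝ) (N : ℝ) (u : ℝ × E → ℂ) (t : ℝ) : ℝ := ∫ x, truncFun p N u (t, x)

/-- The set of times used for the test functions. -/
def truncSet (p : ℝ) (N : ℝ) (u : ℝ × E → ℂ) : Set ℝ :=
  {t | |t| ≤ N ∧ 1 / N ≤ truncInt p N u t}

variable {p N B : ℝ} {u : ℝ × E → ℂ}

theorem measurable_truncFun (hu : Measurable u) : Measurable (truncFun p N u) := by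
  unfold truncFun
  refine Measurable.indicator (by fun_prop) (MeasurableSet.inter ?_ ?_)
  · exact measurableSet_le measurable_snd.norm measurable_const
  · exact measurableSet_le measurable_const hu.norm

theorem truncFun_nonneg (z : ℝ × E) : 0 ≤ truncFun p N u z :=
  Set.indicator_nonneg (fun _ _ => by positivity) _

theorem truncFun_le (hp : 0 ≤ p) (hB : ∀ z, ‖u z‖ ≤ B) (z : ℝ × E) : truncFun p N u z ≤ B ^ p := by
  have hB0 : 0 ≤ B := (norm_nonneg _).trans (hB z)
  unfold truncFun Set.indicator
  split_ifs
  · exact Real.rpow_le_rpow (norm_nonneg _) (hB z) hp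
  · positivity

theorem integrable_truncFun (hp : 0 ≤ p) (hu : Measurable u) (hB : ∀ z, ‖u z‖ ≤ B) (t : ℝ) :
    Integrable fun x => truncFun p N u (t, x) := by
  refine integrable_of_bounded_of_forall_notMem (S := Metric.closedBall 0 N)
    ((measurable_truncFun hu).comp measurable_prodMk_left).aestronglyMeasurable
    measure_closedBall_lt_top.ne (C := B ^ p) (fun x => ?_) fun x hx => ?_
  · rw [Real.norm_of_nonneg (truncFun_nonneg _)]
    exact truncFun_le hp hB _
  · unfold truncFun
    rw [Set.indicator_of_notMem]
    rintro ⟨h, -⟩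
    exact hx (by simpa using h)

theorem measurable_truncInt (hu : Measurable u) : Measurable (truncInt p N u) :=
  ((measurable_truncFun hu).stronglyMeasurable.integral_prod_right').measurable

theorem truncInt_nonneg (t : ℝ) : 0 ≤ truncInt p N u t :=
  integral_nonneg fun _ => truncFun_nonneg _

theorem exists_truncInt_le (hp : 0 ≤ p) (hB : ∀ z, ‖u z‖ ≤ B) :
    ∃ D : ℝ, 0 ≤ D ∧ ∀ t, truncInt p N u t ≤ D := by
  have hB0 : 0 ≤ B := (norm_nonneg _).trans (hB (0, 0))
  refine ⟨B ^ p * (volume (Metric.closedBall (0 : E) N)).toReal, by positivity, fun t => ?_⟩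
  have h1 : truncInt p N u t = ∫ x in Metric.closedBall (0 : E) N, truncFun p N u (t, x) := by
    refine (setIntegral_eq_integral_of_forall_compl_eq_zero fun x hx => ?_).symm
    unfold truncFun
    rw [Set.indicator_of_notMem]
    rintro ⟨h, -⟩
    exact hx (by simpa using h)
  rw [h1]
  refine (le_abs_self _).trans ?_
  rw [← Real.norm_eq_abs]
  refine norm_setIntegral_le_of_norm_le_const measure_closedBall_lt_top fun x _ => ?_
  rw [Real.norm_of_nonneg (truncFun_nonneg _)]
  exact truncFun_le hp hB _

theorem measurableSet_truncSet (hu : Measurable u) : MeasurableSet (truncSet p N u) :=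
  MeasurableSet.inter (measurableSet_le measurable_norm measurable_const)
    (measurableSet_le measurable_const (measurable_truncInt hu))

/-- The test function that is dual to the truncation. -/
def dualFun (p e : ℝ) (N : ℝ) (u : ℝ × E → ℂ) (z : ℝ × E) : ℂ :=
  {z : ℝ × E | z.1 ∈ truncSet p N u ∧ ‖z.2‖ ≤ N ∧ 1 / N ≤ ‖u z‖}.indicator
    (fun z => ((truncInt p N u z.1 ^ e * ‖u z‖ ^ (p - 2) : ℝ) : ℂ) * (starRingEnd ℂ) (u z)) z

theorem norm_dualFun (e : ℝ) (hN : 0 < N) {z : ℝ × E}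
    (hz : z.1 ∈ truncSet p N u ∧ ‖z.2‖ ≤ N ∧ 1 / N ≤ ‖u z‖) :
    ‖dualFun p e N u z‖ = truncInt p N u z.1 ^ e * ‖u z‖ ^ (p - 1) := by
  have h0 : 0 < ‖u z‖ := lt_of_lt_of_le (by positivity) hz.2.2
  have h1 : 0 ≤ truncInt p N u z.1 := truncInt_nonneg _
  unfold dualFun
  rw [Set.indicator_of_mem (Set.mem_ofPred_eq ▸ hz), norm_mul, Complex.norm_real, RCLike.norm_conj,
    Real.norm_of_nonneg (by positivity), mul_assoc, ← Real.rpow_add_one h0.ne']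
  congr 2; ring

theorem dualFun_eq_zero (e : ℝ) {z : ℝ × E}
    (hz : ¬ (z.1 ∈ truncSet p N u ∧ ‖z.2‖ ≤ N ∧ 1 / N ≤ ‖u z‖)) : dualFun p e N u z = 0 := by
  unfold dualFun
  rw [Set.indicator_of_notMem]
  exact hz

theorem measurable_dualFun (e : ℝ) (hu : Measurable u) : Measurable (dualFun p e N u) := by
  have h1 := measurable_truncInt (p := p) (N := N) hu
  unfold dualFun
  refine Measurable.indicator ?_ (MeasurableSet.inter ?_ (MeasurableSet.inter ?_ ?_))
  · exact (Complex.measurable_ofReal.comp (((h1.comp measurable_fst).pow_const e).mul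
      (hu.norm.pow_const _))).mul (Complex.continuous_conj.measurable.comp hu)
  · exact measurable_fst (measurableSet_truncSet hu)
  · exact measurableSet_le measurable_snd.norm measurable_const
  · exact measurableSet_le measurable_const hu.norm

/-- The lower cutoffs matter: |u| ≥ 1/N gives each time slice the lower bound required by `NiceFun`,
and a spatial integral of at least 1/N keeps its power bounded even when e is negative. -/
theorem testFun_dualFun (e : ℝ) (hp : 1 ≤ p) (hN : 0 < N) (hu : Measurable u)
    (hB : ∀ z, ‖u z‖ ≤ B) : TestFun (dualFun p e N u) := by
  have hB0 : 0 ≤ B := (norm_nonneg _).trans (hB (0, 0))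
  obtain ⟨D, hD0, hD⟩ := exists_truncInt_le (N := N) (by linarith : 0 ≤ p) hB
  have key : ∀ z : ℝ × E, (z.1 ∈ truncSet p N u ∧ ‖z.2‖ ≤ N ∧ 1 / N ≤ ‖u z‖) →
      ‖dualFun p e N u z‖ ≤ ((1 / N) ^ e + D ^ e) * B ^ (p - 1) := by
    intro z hz
    rw [norm_dualFun e hN hz]
    have := rpow_le_add (w := e) (by positivity : 0 < 1 / N) hz.1.2 (hD z.1)
    have := hB z
    have : (0 : ℝ) ≤ p - 1 := by linarith
    gcongr
  refine ⟨measurable_dualFun e hu, ⟨N, ((1 / N) ^ e + D ^ e) * B ^ (p - 1), fun z => ?_, fun z hz => ?_⟩, fun t => ⟨?_, ?_⟩⟩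
  · by_cases hz : z.1 ∈ truncSet p N u ∧ ‖z.2‖ ≤ N ∧ 1 / N ≤ ‖u z‖
    · exact key z hz
    · rw [dualFun_eq_zero e hz, norm_zero]; positivity
  · by_cases h : z.1 ∈ truncSet p N u ∧ ‖z.2‖ ≤ N ∧ 1 / N ≤ ‖u z‖
    · exact ⟨⟨by linarith [neg_le_of_abs_le h.1.1], le_of_abs_le h.1.1⟩, by simpa using h.2.1⟩
    · exact absurd (dualFun_eq_zero e h) hz
  · exact (measurable_dualFun e hu).comp measurable_prodMk_left
  · by_cases ht : t ∈ truncSet p N u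
    · have ht0 : 0 < truncInt p N u t := lt_of_lt_of_le (by positivity) ht.2
      refine ⟨N, truncInt p N u t ^ e * (1 / N) ^ (p - 1),
        ((1 / N) ^ e + D ^ e) * B ^ (p - 1), by positivity, fun x hx => ?_⟩
      · by_cases h : (t, x).1 ∈ truncSet p N u ∧ ‖(t, x).2‖ ≤ N ∧ 1 / N ≤ ‖u (t, x)‖
        · refine ⟨h.2.1, ?_, key _ h⟩
          rw [norm_dualFun e hN h]
          have := h.2.2
          have : (0 : ℝ) ≤ p - 1 := by linarith
          gcongr
        · exact absurd (dualFun_eq_zero e h) hx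
    · refine ⟨0, 1, 0, one_pos, fun x hx => absurd (dualFun_eq_zero e fun h => ht h.1) hx⟩

/-- The condition on r says that r is the exponent dual to p, so |u|^((p−1)r) is |u|^p again and a
slice norm of the test function is a power of the same spatial integral. -/
theorem norm_dualFun_rpow (e : ℝ) {r : ℝ} (hr : (p - 1) * r = p) (hr0 : 0 < r) (hN : 0 < N) {t : ℝ}
    (ht : t ∈ truncSet p N u) (x : E) :
    ‖dualFun p e N u (t, x)‖ ^ r = truncInt p N u t ^ (e * r) * truncFun p N u (t, x) := by
  have h1 : 0 ≤ truncInt p N u t := truncInt_nonneg _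
  by_cases h : ‖x‖ ≤ N ∧ 1 / N ≤ ‖u (t, x)‖
  · rw [norm_dualFun e hN ⟨ht, h⟩, truncFun, Set.indicator_of_mem (by exact h),
      Real.mul_rpow (by positivity) (by positivity), ← Real.rpow_mul h1,
      ← Real.rpow_mul (by positivity), hr]
  · rw [dualFun_eq_zero e fun h' => h h'.2, norm_zero, Real.zero_rpow hr0.ne', truncFun,
      Set.indicator_of_notMem (by exact h), mul_zero]

theorem dualFun_mul (e : ℝ) (hN : 0 < N) (z : ℝ × E) :
    dualFun p e N u z * u z =
      (((truncSet p N u).indicator (fun t => truncInt p N u t ^ e) z.1 * truncFun p N u z : ℝ) : ℂ)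
      := by
  by_cases h : z.1 ∈ truncSet p N u ∧ ‖z.2‖ ≤ N ∧ 1 / N ≤ ‖u z‖
  · have h0 : 0 < ‖u z‖ := lt_of_lt_of_le (by positivity) h.2.2
    unfold dualFun truncFun
    rw [Set.indicator_of_mem (by exact h), Set.indicator_of_mem h.1,
      Set.indicator_of_mem (by exact h.2), mul_assoc, ← Complex.normSq_eq_conj_mul_self,
      Complex.normSq_eq_norm_sq, ← Complex.ofReal_mul, mul_assoc]
    congr 2
    rw [← Real.rpow_add_natCast h0.ne']
    congr 1
    push_cast; ring
  · rw [dualFun_eq_zero e h, zero_mul]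
    unfold truncFun
    by_cases h1 : z.1 ∈ truncSet p N u
    · rw [Set.indicator_of_notMem (s := {z : ℝ × E | ‖z.2‖ ≤ N ∧ 1 / N ≤ ‖u z‖})
        (fun h2 => h ⟨h1, h2⟩)]
      simp
    · rw [Set.indicator_of_notMem h1]
      simp

end Duality

end

section

variable {E : Type*} [NormedAddCommGroup E] [InnerProductSpace ℝ E] [FiniteDimensional ℝ E]
  [MeasurableSpace E] [BorelSpace E]

theorem TestFun.integrable_mul {G u : ℝ × E → ℂ} (hG : TestFun G) (hu : Measurable u) {B : ℝ}
    (hB : ∀ z, ‖u z‖ ≤ B) : Integrable fun z => G z * u z :=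
  hG.integrable.mul_bdd hu.aestronglyMeasurable (Filter.Eventually.of_forall hB)

theorem integral_dualFun_mul {p e N B : ℝ} {u : ℝ × E → ℂ} (hp : 1 ≤ p) (hN : 0 < N)
    (hu : Measurable u) (hB : ∀ z, ‖u z‖ ≤ B) :
    ∫ z, dualFun p e N u z * u z =
      ((∫ t, (truncSet p N u).indicator (fun t => truncInt p N u t ^ (e + 1)) t : ℝ) : ℂ) := by
  rw [Measure.volume_eq_prod,
    integral_prod _ ((testFun_dualFun e hp hN hu hB).integrable_mul hu hB), ← integral_complex_ofReal]
  refine integral_congr_ae (Filter.Eventually.of_forall fun t => ?_)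
  simp only [dualFun_mul e hN]
  rw [integral_complex_ofReal, integral_const_mul]
  congr 1
  rw [← truncInt]
  by_cases ht : t ∈ truncSet p N u
  · have ht0 : 0 < truncInt p N u t := lt_of_lt_of_le (by positivity) ht.2
    rw [Set.indicator_of_mem ht, Set.indicator_of_mem ht, Real.rpow_add_one ht0.ne']
  · rw [Set.indicator_of_notMem ht, Set.indicator_of_notMem ht, zero_mul]

/-- The test function is the extremizer of the duality, truncated. Its dual mixed norm, raised to
the power 2/(2 − θ), and its pairing with u are the same number X, so X ≤ K X^((2−θ)/2). The
truncation makes X finite, which permits division. -/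
theorem lintegral_truncInt_le {θ : ℝ} (hθ₀ : 0 < θ) (hθ₁ : θ < 1) {K B N : ℝ} {u : ℝ × E → ℂ}
    (hK : 0 ≤ K) (hN : 0 < N) (hu : Measurable u) (hB : ∀ z, ‖u z‖ ≤ B)
    (hdual : ∀ G : ℝ × E → ℂ, TestFun G → ∀ X : ℝ, 0 < X →
      ∫⁻ t, ENNReal.ofReal (((∫ x, ‖G (t, x)‖ ^ (2 / (1 + θ))) ^ ((1 + θ) / 2)) ^ (2 / (2 - θ))) ≤
        ENNReal.ofReal X → ‖∫ z, G z * u z‖ ≤ K * X ^ ((2 - θ) / 2)) :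
    ∫⁻ t, ENNReal.ofReal ((truncSet (2 / (1 - θ)) N u).indicator
      (fun t => truncInt (2 / (1 - θ)) N u t ^ ((1 - θ) / θ)) t) ≤ ENNReal.ofReal (K ^ (2 / θ)) := by
  set p := 2 / (1 - θ) with hp
  set e := (1 - θ) / θ - 1 with he
  have h1θ : 0 < 1 - θ := by linarith
  have h2θ : 0 < 2 - θ := by linarith
  have hp1 : 1 ≤ p := by rw [hp, le_div_iff₀ h1θ]; linarith
  set F : ℝ → ℝ := (truncSet p N u).indicator (fun t => truncInt p N u t ^ ((1 - θ) / θ)) with hF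
  have hF0 : ∀ t, 0 ≤ F t := fun t => Set.indicator_nonneg
    (fun t _ => Real.rpow_nonneg (truncInt_nonneg t) _) t
  have hFm : Measurable F :=
    ((measurable_truncInt hu).pow_const _).indicator (measurableSet_truncSet hu)
  have hFi : Integrable F := by
    obtain ⟨D, hD0, hD⟩ := exists_truncInt_le (N := N) (by linarith : 0 ≤ p) hB
    refine integrable_of_bounded_of_forall_notMem hFm.aestronglyMeasurable
      (S := Set.Icc (-N) N) isCompact_Icc.measure_lt_top.ne (C := D ^ ((1 - θ) / θ))
      (fun t => ?_) fun t ht => ?_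
    · rw [Real.norm_of_nonneg (hF0 t)]
      by_cases h : t ∈ truncSet p N u
      · rw [hF, Set.indicator_of_mem h]
        exact Real.rpow_le_rpow (truncInt_nonneg _) (hD t) (by positivity)
      · rw [hF, Set.indicator_of_notMem h]; positivity
    · rw [hF, Set.indicator_of_notMem]
      exact fun h => ht ⟨neg_le_of_abs_le h.1, le_of_abs_le h.1⟩
  rw [← ofReal_integral_eq_lintegral_ofReal hFi (Filter.Eventually.of_forall hF0)]
  refine ENNReal.ofReal_le_ofReal ?_
  rcases (integral_nonneg hF0 : 0 ≤ ∫ t, F t).eq_or_lt with h0 | h0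
  · rw [← h0]; positivity
  set X := ∫ t, F t with hX
  have h1 := hdual (dualFun p e N u) (testFun_dualFun e hp1 hN hu hB) X h0 ?_
  · rw [integral_dualFun_mul hp1 hN hu hB, he, sub_add_cancel, ← hF, ← hX, Complex.norm_real,
      Real.norm_of_nonneg h0.le] at h1
    have h2 : X ^ (θ / 2) ≤ K := by
      have : X = X ^ (θ / 2) * X ^ ((2 - θ) / 2) := by
        rw [← Real.rpow_add h0]
        conv_lhs => rw [← Real.rpow_one X]
        congr 1; ring
      rw [this] at h1
      have h3 : 0 < X ^ ((2 - θ) / 2) := by positivity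
      rw [← this] at h1
      refine le_of_mul_le_mul_right ?_ h3
      rw [← this]; exact h1
    calc X = (X ^ (θ / 2)) ^ (2 / θ) := by
          rw [← Real.rpow_mul h0.le, div_mul_div_cancel₀ two_ne_zero, div_self hθ₀.ne',
            Real.rpow_one]
      _ ≤ _ := Real.rpow_le_rpow (by positivity) h2 (by positivity)
  · rw [hX, ofReal_integral_eq_lintegral_ofReal hFi (Filter.Eventually.of_forall hF0)]
    refine le_of_eq (lintegral_congr fun t => ?_)
    congr 1
    by_cases ht : t ∈ truncSet p N u
    · have ht0 : 0 < truncInt p N u t := lt_of_lt_of_le (by positivity) ht.2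
      simp only [norm_dualFun_rpow e (r := 2 / (1 + θ)) (by rw [hp]; field_simp; ring)
        (by positivity) hN ht]
      rw [integral_const_mul, ← truncInt, ← Real.rpow_add_one ht0.ne', ← Real.rpow_mul ht0.le,
        ← Real.rpow_mul ht0.le, hF, Set.indicator_of_mem ht]
      congr 1
      rw [he]; field_simp; ring
    · have : ∀ x, dualFun p e N u (t, x) = 0 := fun x => dualFun_eq_zero e fun h => ht h.1
      simp only [this, norm_zero]
      rw [hF, Set.indicator_of_notMem ht, Real.zero_rpow (by positivity), integral_zero,
        Real.zero_rpow (by positivity), Real.zero_rpow (by positivity)]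

/-- A mixed norm bound from testing against nice functions. -/
theorem lintegral_rpow_le_of_dual {θ : ℝ} (hθ₀ : 0 < θ) (hθ₁ : θ < 1) {K B : ℝ} {u : ℝ × E → ℂ}
    (hK : 0 ≤ K) (hu : Measurable u) (hB : ∀ z, ‖u z‖ ≤ B)
    (hdual : ∀ G : ℝ × E → ℂ, TestFun G → ∀ X : ℝ, 0 < X →
      ∫⁻ t, ENNReal.ofReal (((∫ x, ‖G (t, x)‖ ^ (2 / (1 + θ))) ^ ((1 + θ) / 2)) ^ (2 / (2 - θ))) ≤
        ENNReal.ofReal X → ‖∫ z, G z * u z‖ ≤ K * X ^ ((2 - θ) / 2)) :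
    ∫⁻ t, (∫⁻ x, ‖u (t, x)‖ₑ ^ (2 / (1 - θ))) ^ ((1 - θ) / θ) ≤ ENNReal.ofReal (K ^ (2 / θ)) := by
  have h1θ : 0 < 1 - θ := by linarith
  set p := 2 / (1 - θ) with hp
  have hp0 : 0 < p := by positivity
  set κ := (1 - θ) / θ with hκ
  have hκ0 : 0 < κ := by positivity
  have hconv : ∀ (N : ℝ) (t : ℝ), ENNReal.ofReal (truncInt p N u t) =
      ∫⁻ x, ENNReal.ofReal (truncFun p N u (t, x)) := fun N t =>
    ofReal_integral_eq_lintegral_ofReal (integrable_truncFun hp0.le hu hB t)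
      (Filter.Eventually.of_forall fun x => truncFun_nonneg _)
  have hN : Filter.Tendsto (fun k : ℕ => (k : ℝ) + 1) Filter.atTop Filter.atTop :=
    Filter.tendsto_atTop_add_const_right _ _ tendsto_natCast_atTop_atTop
  have hNinv : Filter.Tendsto (fun k : ℕ => 1 / ((k : ℝ) + 1)) Filter.atTop (nhds 0) :=
    tendsto_one_div_add_atTop_nhds_zero_nat
  have hinner : ∀ t, Filter.Tendsto (fun k : ℕ => ENNReal.ofReal (truncInt p (k + 1) u t))
      Filter.atTop (nhds (∫⁻ x, ‖u (t, x)‖ₑ ^ p)) := by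
    intro t
    simp only [hconv]
    refine lintegral_tendsto_of_tendsto_of_monotone (fun k => ?_) ?_ ?_
    · exact (ENNReal.measurable_ofReal.comp
        ((measurable_truncFun hu).comp measurable_prodMk_left)).aemeasurable
    · refine Filter.Eventually.of_forall fun x k l hkl => ENNReal.ofReal_le_ofReal ?_
      have hkl' : (k : ℝ) + 1 ≤ l + 1 := by exact_mod_cast Nat.succ_le_succ hkl
      refine Set.indicator_le_indicator_of_subset ?_ (fun _ => by positivity) _
      rintro z ⟨h1, h2⟩
      refine ⟨h1.trans hkl', le_trans ?_ h2⟩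
      gcongr
    · refine Filter.Eventually.of_forall fun x => ?_
      by_cases h0 : u (t, x) = 0
      · have : ∀ k : ℕ, truncFun p (k + 1) u (t, x) = 0 := fun k => by
          rw [truncFun, Set.indicator_of_notMem]
          rintro ⟨-, h⟩
          rw [h0, norm_zero] at h
          have : (0 : ℝ) < 1 / ((k : ℝ) + 1) := by positivity
          linarith
        simp [this, h0, hp0]
      · refine Filter.Tendsto.congr' (f₁ := fun _ => ‖u (t, x)‖ₑ ^ p) ?_ tendsto_const_nhds
        filter_upwards [hN.eventually_ge_atTop ‖x‖,
          hNinv.eventually_le_const (norm_pos_iff.2 h0)] with k h1 h2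
        rw [truncFun, Set.indicator_of_mem (by exact ⟨h1, h2⟩),
          ← ENNReal.ofReal_rpow_of_nonneg (norm_nonneg _) hp0.le, ofReal_norm]
  have houter : ∀ t, Filter.Tendsto (fun k : ℕ => ENNReal.ofReal ((truncSet p (k + 1) u).indicator
      (fun t => truncInt p (k + 1) u t ^ κ) t)) Filter.atTop
      (nhds ((∫⁻ x, ‖u (t, x)‖ₑ ^ p) ^ κ)) := by
    intro t
    by_cases h0 : ∫⁻ x, ‖u (t, x)‖ₑ ^ p = 0
    · have : ∀ k : ℕ, (truncSet p (k + 1) u).indicator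
          (fun t => truncInt p (k + 1) u t ^ κ) t = 0 := fun k => by
        rw [Set.indicator_of_notMem]
        rintro ⟨-, h⟩
        have h1 : ENNReal.ofReal (truncInt p (k + 1) u t) ≤ 0 := by
          rw [hconv, ← h0]
          refine lintegral_mono fun x => ?_
          rw [← ofReal_norm, ENNReal.ofReal_rpow_of_nonneg (norm_nonneg _) hp0.le]
          exact ENNReal.ofReal_le_ofReal (Set.indicator_le_self' (fun _ _ => by positivity) _)
        have h2 : (0 : ℝ) < 1 / ((k : ℝ) + 1) := by positivity
        have := ENNReal.ofReal_pos.2 (h2.trans_le h)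
        exact absurd this (not_lt.2 h1)
      simp [this, h0, hκ0]
    · refine Filter.Tendsto.congr' ?_ ((ENNReal.continuous_rpow_const (y := κ)).tendsto _ |>.comp
        (hinner t))
      -- The spatial integral may be infinite. A finite c strictly below it shows that t eventually
      -- enters the truncated set, after which the indicator plays no role.
      obtain ⟨c, hc0, hc⟩ := exists_between (pos_iff_ne_zero.2 h0)
      have hc' : c ≠ ∞ := (hc.trans_le le_top).ne
      have hcr : 0 < c.toReal := ENNReal.toReal_pos hc0.ne' hc'
      filter_upwards [hN.eventually_ge_atTop |t|, hNinv.eventually_le_const hcr,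
        (hinner t).eventually_const_lt hc] with k h1 h2 h3
      rw [Set.indicator_of_mem, Function.comp_apply,
        ENNReal.ofReal_rpow_of_nonneg (truncInt_nonneg _) hκ0.le]
      refine ⟨h1, h2.trans ?_⟩
      exact ENNReal.toReal_le_of_le_ofReal (truncInt_nonneg _) h3.le
  have hm : ∀ k : ℕ, Measurable fun t => ENNReal.ofReal ((truncSet p (k + 1) u).indicator
      (fun t => truncInt p (k + 1) u t ^ κ) t) := fun k =>
    (((measurable_truncInt hu).pow_const _).indicator (measurableSet_truncSet hu)).ennreal_ofReal
  calc _ = ∫⁻ t, Filter.liminf (fun k : ℕ => ENNReal.ofReal ((truncSet p (k + 1) u).indicator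
      (fun t => truncInt p (k + 1) u t ^ κ) t)) Filter.atTop :=
        lintegral_congr fun t => (houter t).liminf_eq.symm
    -- The cutoffs are removed by Fatou's lemma, since the truncated bounds do not depend on the
    -- level.
    _ ≤ _ := lintegral_liminf_le hm
    _ ≤ _ := Filter.liminf_le_of_le (by isBoundedDefault) fun b hb => by
        obtain ⟨k, hk⟩ := hb.exists
        exact hk.trans (lintegral_truncInt_le hθ₀ hθ₁ hK (by positivity) hu hB hdual)

end

/-! ### The TT* identity -/

section

theorem NiceFun.conj {E : Type*} [NormedAddCommGroup E] [MeasurableSpace E] {f : E → ℂ}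
    (hf : NiceFun f) : NiceFun fun x => (starRingEnd ℂ) (f x) := by
  obtain ⟨R, ε, M, hε, h⟩ := hf.bound
  refine ⟨Complex.continuous_conj.measurable.comp hf.measurable, R, ε, M, hε, fun x hx => ?_⟩
  rw [RCLike.norm_conj]
  exact h x fun h0 => hx (by simp [h0])

/-- The interchange of the two middle factors of a product of two products. -/
def prodComm₄ (α β γ δ : Type*) [MeasurableSpace α] [MeasurableSpace β] [MeasurableSpace γ]
    [MeasurableSpace δ] : (α × β) × γ × δ ≃ᵐ (α × γ) × β × δ where
  toEquiv := Equiv.prodProdProdComm α β γ δ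
  measurable_toFun := by
    change Measurable fun z : (α × β) × γ × δ => ((z.1.1, z.2.1), z.1.2, z.2.2)
    fun_prop
  measurable_invFun := by
    change Measurable fun z : (α × γ) × β × δ => ((z.1.1, z.2.1), z.1.2, z.2.2)
    fun_prop

theorem measurePreserving_prodComm₄ {α β γ δ : Type*} [MeasurableSpace α] [MeasurableSpace β]
    [MeasurableSpace γ] [MeasurableSpace δ] (μ : Measure α) (ν : Measure β) (κ : Measure γ)
    (ρ : Measure δ) [SFinite μ] [SFinite ν] [SFinite κ] [SFinite ρ] :
    MeasurePreserving (prodComm₄ α β γ δ) ((μ.prod ν).prod (κ.prod ρ))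
      ((μ.prod κ).prod (ν.prod ρ)) := by
  have h1 := measurePreserving_prodAssoc μ ν (κ.prod ρ)
  have h2 := (measurePreserving_prodAssoc ν κ ρ).symm
  have h3 := (Measure.measurePreserving_swap (μ := ν) (ν := κ)).prod (MeasurePreserving.id ρ)
  have h4 := measurePreserving_prodAssoc κ ν ρ
  have h5 := (MeasurePreserving.id μ).prod ((h4.comp h3).comp h2)
  exact ((measurePreserving_prodAssoc μ κ (ν.prod ρ)).symm).comp (h5.comp h1)

variable {m : ℕ}

theorem kernelFun_ofReal (a t w : ℝ) (x η : EuclideanSpace ℝ (Fin (m + 1))) :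
    kernelFun a t (w : ℂ) x η =
      Complex.exp (Complex.I * ((2 * Real.pi * inner ℝ x η - t * disp a η : ℝ) : ℂ)) *
        (((2 * Real.pi * ‖η‖) ^ w : ℝ) : ℂ) := by
  have := Real.pi_pos
  rw [kernelFun, Complex.ofReal_cpow (by positivity)]

/-- The group property of the propagator: in the product with a conjugate the phases subtract and
the real weights add. TT* therefore depends only on time and space differences. -/
theorem kernelFun_mul_conj (a t t' w : ℝ) (x x' : EuclideanSpace ℝ (Fin (m + 1)))
    {η : EuclideanSpace ℝ (Fin (m + 1))} (hη : 0 < ‖η‖) :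
    kernelFun a t (w : ℂ) x η * (starRingEnd ℂ) (kernelFun a t' (w : ℂ) x' η) =
      kernelFun a (t - t') ((2 * w : ℝ) : ℂ) (x - x') η := by
  have := Real.pi_pos
  simp only [kernelFun_ofReal, map_mul, Complex.conj_ofReal, ← Complex.exp_conj, Complex.conj_I]
  rw [mul_mul_mul_comm, ← Complex.exp_add, ← Complex.ofReal_mul, ← Real.rpow_add (by positivity),
    inner_sub_left]
  congr 2
  · push_cast; ring
  · congr 1; ring

theorem norm_kernelFun_le (a t w : ℝ) (x : EuclideanSpace ℝ (Fin (m + 1))) {r₁ r₂ : ℝ}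
    (hr₁ : 0 < r₁) {η : EuclideanSpace ℝ (Fin (m + 1))} (hη : η ∈ annulus (m + 1) r₁ r₂) :
    ‖kernelFun a t (w : ℂ) x η‖ ≤ (2 * Real.pi * r₁) ^ w + (2 * Real.pi * r₂) ^ w := by
  have hpi := Real.pi_pos
  have h1 : r₁ ≤ ‖η‖ := hη.1
  have h2 : ‖η‖ ≤ r₂ := hη.2
  rw [norm_kernelFun _ _ _ _ (hr₁.trans_le h1), Complex.ofReal_re]
  exact rpow_le_add (by positivity) (by gcongr) (by gcongr)

/-- The frequency localized solution with data `|ξ|^w g`. -/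
def wave (a w r₁ r₂ : ℝ) (g : EuclideanSpace ℝ (Fin (m + 1)) → ℂ)
    (z : ℝ × EuclideanSpace ℝ (Fin (m + 1))) : ℂ :=
  ∫ η in annulus (m + 1) r₁ r₂, kernelFun a z.1 (w : ℂ) z.2 η * g η

/-- The transpose of `wave`. -/
def dualWave (a w : ℝ) (G : ℝ × EuclideanSpace ℝ (Fin (m + 1)) → ℂ)
    (η : EuclideanSpace ℝ (Fin (m + 1))) : ℂ :=
  ∫ z, G z * kernelFun a z.1 (w : ℂ) z.2 η

/-- The bilinear form of two time slices. -/
def sliceForm (a w r₁ r₂ : ℝ) (G : ℝ × EuclideanSpace ℝ (Fin (m + 1)) → ℂ) (t t' : ℝ) : ℂ :=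
  ∫ q, G (t, q.1) * (starRingEnd ℂ) (G (t', q.2)) * kern a (t - t') (w : ℂ) r₁ r₂ (q.1 - q.2)
    ∂(volume.prod volume)

theorem measurable_kernelFun_uncurry (a : ℝ) (w : ℂ) :
    Measurable fun p : (ℝ × EuclideanSpace ℝ (Fin (m + 1))) × EuclideanSpace ℝ (Fin (m + 1)) =>
      kernelFun a p.1.1 w p.1.2 p.2 := by
  have := measurable_disp (n := m + 1) a
  unfold kernelFun
  fun_prop

theorem measurable_kernelFun_sub (a : ℝ) (w : ℂ) :
    Measurable fun p : ((ℝ × EuclideanSpace ℝ (Fin (m + 1))) × ℝ ×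
      EuclideanSpace ℝ (Fin (m + 1))) × EuclideanSpace ℝ (Fin (m + 1)) =>
        kernelFun a (p.1.1.1 - p.1.2.1) w (p.1.1.2 - p.1.2.2) p.2 := by
  have := measurable_disp (n := m + 1) a
  unfold kernelFun
  fun_prop

theorem measurable_wave (a w r₁ r₂ : ℝ) {g : EuclideanSpace ℝ (Fin (m + 1)) → ℂ}
    (hg : Measurable g) : Measurable (wave a w r₁ r₂ g) :=
  (StronglyMeasurable.integral_prod_right'
    (f := fun p : (ℝ × EuclideanSpace ℝ (Fin (m + 1))) × EuclideanSpace ℝ (Fin (m + 1)) =>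
      kernelFun a p.1.1 (w : ℂ) p.1.2 p.2 * g p.2)
    ((measurable_kernelFun_uncurry a w).mul (hg.comp measurable_snd)).stronglyMeasurable).measurable

theorem exists_norm_wave_le (a w : ℝ) {r₁ r₂ : ℝ} (hr₁ : 0 < r₁)
    {g : EuclideanSpace ℝ (Fin (m + 1)) → ℂ} {D : ℝ} (hD : ∀ η, ‖g η‖ ≤ D) :
    ∃ B : ℝ, ∀ z, ‖wave a w r₁ r₂ g z‖ ≤ B := by
  refine ⟨_, fun z => norm_setIntegral_le_of_norm_le_const
    (C := ((2 * Real.pi * r₁) ^ w + (2 * Real.pi * r₂) ^ w) * D)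
    (isCompact_annulus _ _ _).measure_lt_top fun η hη => ?_⟩
  rw [norm_mul]
  exact mul_le_mul (norm_kernelFun_le a _ w _ hr₁ hη) (hD η) (norm_nonneg _)
    ((norm_nonneg _).trans (norm_kernelFun_le a z.1 w z.2 hr₁ hη))

theorem measurable_dualWave (a w : ℝ) {G : ℝ × EuclideanSpace ℝ (Fin (m + 1)) → ℂ}
    (hG : Measurable G) : Measurable (dualWave a w G) :=
  (StronglyMeasurable.integral_prod_left'
    (f := fun p : (ℝ × EuclideanSpace ℝ (Fin (m + 1))) × EuclideanSpace ℝ (Fin (m + 1)) =>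
      G p.1 * kernelFun a p.1.1 (w : ℂ) p.1.2 p.2)
    ((hG.comp measurable_fst).mul (measurable_kernelFun_uncurry a w)).stronglyMeasurable).measurable

theorem norm_dualWave_le (a w : ℝ) {r₁ r₂ : ℝ} (hr₁ : 0 < r₁)
    {G : ℝ × EuclideanSpace ℝ (Fin (m + 1)) → ℂ} (hG : TestFun G)
    {η : EuclideanSpace ℝ (Fin (m + 1))} (hη : η ∈ annulus (m + 1) r₁ r₂) :
    ‖dualWave a w G η‖ ≤ (∫ z, ‖G z‖) * ((2 * Real.pi * r₁) ^ w + (2 * Real.pi * r₂) ^ w) := by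
  rw [dualWave, ← integral_mul_const]
  refine norm_integral_le_of_norm_le (hG.integrable.norm.mul_const _)
    (Filter.Eventually.of_forall fun z => ?_)
  rw [norm_mul]
  exact mul_le_mul_of_nonneg_left (norm_kernelFun_le a _ w _ hr₁ hη) (norm_nonneg _)

theorem memLp_dualWave (a w : ℝ) {r₁ r₂ : ℝ} (hr₁ : 0 < r₁)
    {G : ℝ × EuclideanSpace ℝ (Fin (m + 1)) → ℂ} (hG : TestFun G) :
    MemLp (dualWave a w G) 2 (volume.restrict (annulus (m + 1) r₁ r₂)) := by
  refine MemLp.of_bound (measurable_dualWave a w hG.measurable).aestronglyMeasurable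
    ((∫ z, ‖G z‖) * ((2 * Real.pi * r₁) ^ w + (2 * Real.pi * r₂) ^ w)) ?_
  filter_upwards [ae_restrict_mem (measurableSet_annulus _ _ _)] with η hη
  exact norm_dualWave_le a w hr₁ hG hη

theorem integral_mul_wave (a w : ℝ) {r₁ r₂ : ℝ} (hr₁ : 0 < r₁)
    {G : ℝ × EuclideanSpace ℝ (Fin (m + 1)) → ℂ} (hG : TestFun G)
    {g : EuclideanSpace ℝ (Fin (m + 1)) → ℂ} (hg : Measurable g) {D : ℝ} (hD : ∀ η, ‖g η‖ ≤ D) :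
    ∫ z, G z * wave a w r₁ r₂ g z = ∫ η in annulus (m + 1) r₁ r₂, g η * dualWave a w G η := by
  have hgi : Integrable g (volume.restrict (annulus (m + 1) r₁ r₂)) :=
    Measure.integrableOn_of_bounded (isCompact_annulus _ _ _).measure_lt_top.ne
      hg.aestronglyMeasurable (Filter.Eventually.of_forall hD)
  have hint : Integrable (Function.uncurry fun (z : ℝ × EuclideanSpace ℝ (Fin (m + 1)))
      (η : EuclideanSpace ℝ (Fin (m + 1))) => G z * (kernelFun a z.1 (w : ℂ) z.2 η * g η))
      (volume.prod (volume.restrict (annulus (m + 1) r₁ r₂))) := by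
    refine ((hG.integrable.mul_prod hgi).norm.mul_const
      ((2 * Real.pi * r₁) ^ w + (2 * Real.pi * r₂) ^ w)).mono' ?_ ?_
    · exact ((hG.measurable.comp measurable_fst).mul ((measurable_kernelFun_uncurry a w).mul
        (hg.comp measurable_snd))).aestronglyMeasurable
    · filter_upwards [Measure.quasiMeasurePreserving_snd.ae
        (ae_restrict_mem (measurableSet_annulus _ _ _))] with p hp
      simp only [Function.uncurry, norm_mul]
      rw [mul_comm ‖kernelFun _ _ _ _ _‖, ← mul_assoc]
      exact mul_le_mul_of_nonneg_left (norm_kernelFun_le a _ w _ hr₁ hp) (by positivity)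
  simp only [wave, dualWave, ← integral_const_mul]
  rw [integral_integral_swap hint]
  refine integral_congr_ae (Filter.Eventually.of_forall fun η => ?_)
  refine integral_congr_ae (Filter.Eventually.of_forall fun z => ?_)
  simp only
  ring

/-- Opening the square of the transpose and integrating in η first leaves the kernel with twice the
weight. Fubini applies because on the annulus the kernel is bounded and G is integrable. -/
theorem integral_dualWave_mul_conj (a w : ℝ) {r₁ r₂ : ℝ} (hr₁ : 0 < r₁)
    {G : ℝ × EuclideanSpace ℝ (Fin (m + 1)) → ℂ} (hG : TestFun G) :
    AEStronglyMeasurable (fun z : ℝ × ℝ => sliceForm a (2 * w) r₁ r₂ G z.1 z.2) ∧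
    ∫ η in annulus (m + 1) r₁ r₂, dualWave a w G η * (starRingEnd ℂ) (dualWave a w G η) =
      ∫ z : ℝ × ℝ, sliceForm a (2 * w) r₁ r₂ G z.1 z.2 := by
  have hGc : Measurable fun z => (starRingEnd ℂ) (G z) :=
    Complex.continuous_conj.measurable.comp hG.measurable
  have hGci : Integrable fun z => (starRingEnd ℂ) (G z) :=
    hG.integrable.norm.mono' hGc.aestronglyMeasurable
      (Filter.Eventually.of_forall fun z => (RCLike.norm_conj _).le)
  have hint : Integrable (Function.uncurry fun
      (ζ : (ℝ × EuclideanSpace ℝ (Fin (m + 1))) × ℝ × EuclideanSpace ℝ (Fin (m + 1)))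
      (η : EuclideanSpace ℝ (Fin (m + 1))) => (G ζ.1 * (starRingEnd ℂ) (G ζ.2)) *
        kernelFun a (ζ.1.1 - ζ.2.1) ((2 * w : ℝ) : ℂ) (ζ.1.2 - ζ.2.2) η)
      ((volume.prod volume).prod (volume.restrict (annulus (m + 1) r₁ r₂))) := by
    refine (((hG.integrable.mul_prod hGci).mul_prod (integrable_const
      (((2 * Real.pi * r₁) ^ (2 * w) + (2 * Real.pi * r₂) ^ (2 * w) : ℝ) : ℂ))).norm).mono' ?_ ?_
    · refine Measurable.aestronglyMeasurable (Measurable.mul ?_ ?_)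
      · exact (hG.measurable.comp (measurable_fst.comp measurable_fst)).mul
          (hGc.comp (measurable_snd.comp measurable_fst))
      · exact measurable_kernelFun_sub a _
    · filter_upwards [Measure.quasiMeasurePreserving_snd.ae
        (ae_restrict_mem (measurableSet_annulus _ _ _))] with p hp
      simp only [Function.uncurry]
      rw [norm_mul, norm_mul (_ * _), Complex.norm_real]
      exact mul_le_mul_of_nonneg_left
        ((norm_kernelFun_le a _ _ _ hr₁ hp).trans (le_abs_self _)) (norm_nonneg _)
  have hH := hint.integral_prod_left
  simp only [Function.uncurry, integral_const_mul] at hH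
  -- The variables (t, x), (t', x') are regrouped as (t, t'), (x, x') so that the spatial integrals
  -- form the slice form at fixed times.
  have hmp := (measurePreserving_prodComm₄ (volume : Measure ℝ) (volume : Measure ℝ)
    (volume : Measure (EuclideanSpace ℝ (Fin (m + 1))))
    (volume : Measure (EuclideanSpace ℝ (Fin (m + 1)))))
  have hH' := hmp.integrable_comp_of_integrable hH
  refine ⟨hH'.integral_prod_left.aestronglyMeasurable, ?_⟩
  calc _ = ∫ η in annulus (m + 1) r₁ r₂, ∫ ζ : (ℝ × EuclideanSpace ℝ (Fin (m + 1))) × ℝ ×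
          EuclideanSpace ℝ (Fin (m + 1)), (G ζ.1 * (starRingEnd ℂ) (G ζ.2)) *
          kernelFun a (ζ.1.1 - ζ.2.1) ((2 * w : ℝ) : ℂ) (ζ.1.2 - ζ.2.2) η
          ∂(volume.prod volume) := by
        refine setIntegral_congr_fun (measurableSet_annulus _ _ _) fun η hη => ?_
        simp only [dualWave]
        rw [← integral_conj, ← integral_prod_mul]
        refine integral_congr_ae (Filter.Eventually.of_forall fun ζ => ?_)
        simp only [map_mul]
        rw [← kernelFun_mul_conj _ _ _ _ _ _ (hr₁.trans_le hη.1)]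
        ring
    _ = _ := integral_integral_swap hint.swap
    _ = ∫ ζ : (ℝ × EuclideanSpace ℝ (Fin (m + 1))) × ℝ × EuclideanSpace ℝ (Fin (m + 1)),
          (G ζ.1 * (starRingEnd ℂ) (G ζ.2)) *
          kern a (ζ.1.1 - ζ.2.1) ((2 * w : ℝ) : ℂ) r₁ r₂ (ζ.1.2 - ζ.2.2)
          ∂(volume.prod volume) := by
        simp only [integral_const_mul, kern]
    _ = _ := (hmp.integral_comp' _).symm
    _ = _ := integral_prod _ hH'

end

/-! ### Strichartz bounds with a frequency cutoff -/

section

variable {m : ℕ}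

theorem measurable_slice_norm {G : ℝ × EuclideanSpace ℝ (Fin (m + 1)) → ℂ} (hG : Measurable G)
    (r κ : ℝ) : Measurable fun t => (∫ x, ‖G (t, x)‖ ^ r) ^ κ :=
  (StronglyMeasurable.integral_prod_right' (f := fun z => ‖G z‖ ^ r)
    (by fun_prop : Measurable fun z => ‖G z‖ ^ r).stronglyMeasurable).measurable.pow_const _

/-- The `L²` bound of the transpose, by duality, dispersion and the Hardy-Littlewood-Sobolev
inequality. -/
theorem exists_dualWave_bound (hm : 2 ≤ m) {a : ℝ} (ha : 1 ≤ a) (ha' : a ≤ 2) {θ : ℝ}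
    (hθ₀ : 0 < θ) (hθ₁ : θ < 1) :
    ∃ K : ℝ, 0 ≤ K ∧ ∀ (r₁ r₂ X : ℝ) (G : ℝ × EuclideanSpace ℝ (Fin (m + 1)) → ℂ), 0 < r₁ →
      r₁ ≤ r₂ → 0 < X → TestFun G →
      ∫⁻ t, ENNReal.ofReal (((∫ x, ‖G (t, x)‖ ^ (2 / (1 + θ))) ^ ((1 + θ) / 2)) ^ (2 / (2 - θ))) ≤
        ENNReal.ofReal X →
      ∫ η in annulus (m + 1) r₁ r₂, ‖dualWave a (-(θ * (m - a) / 2)) G η‖ ^ (2 : ℝ) ≤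
        K * X ^ (2 - θ) := by
  obtain ⟨C, hC0, hC⟩ := exists_fixed_time_bound hm ha ha' hθ₀ hθ₁
  have hL : ENNReal.ofReal C * (2 * hlsConst θ) ≠ ∞ :=
    ENNReal.mul_ne_top ENNReal.ofReal_ne_top
      (ENNReal.mul_ne_top (by simp) (hlsConst_ne_top hθ₀))
  refine ⟨(ENNReal.ofReal C * (2 * hlsConst θ)).toReal, ENNReal.toReal_nonneg,
    fun r₁ r₂ X G hr₁ hr hX hG hk => ?_⟩
  set k : ℝ → ℝ := fun t => (∫ x, ‖G (t, x)‖ ^ (2 / (1 + θ))) ^ ((1 + θ) / 2) with hkdef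
  have hI0 : ∀ t, 0 ≤ ∫ x, ‖G (t, x)‖ ^ (2 / (1 + θ)) := fun t =>
    integral_nonneg fun x => by positivity
  have hk0 : ∀ t, 0 ≤ k t := fun t => Real.rpow_nonneg (hI0 t) _
  have hkm : Measurable k := measurable_slice_norm hG.measurable _ _
  set w := -(θ * (m - a) / 2) with hw
  obtain ⟨hsm, heq⟩ := integral_dualWave_mul_conj a w hr₁ (r₂ := r₂) hG
  -- The dispersive bound says nothing at t = t'; for each t this excludes a null set of times t'.
  have hpt : ∀ t t', t' ≠ t → ‖sliceForm a (2 * w) r₁ r₂ G t t'‖ₑ ≤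
      ENNReal.ofReal C * (ENNReal.ofReal (|t - t'| ^ (-θ)) * ENNReal.ofReal (k t) *
        ENNReal.ofReal (k t')) := by
    intro t t' htt
    have h := hC (t - t') r₁ r₂ (fun x => G (t, x)) (fun x => (starRingEnd ℂ) (G (t', x)))
      (sub_ne_zero.2 htt.symm) hr₁ hr (hG.slice t) (hG.slice t').conj
    -- Doubling the weight of the transpose produces exactly the smoothing of the fixed-time
    -- estimate.
    have e : (-((θ * (m - a) : ℝ) : ℂ)) = ((2 * w : ℝ) : ℂ) := by rw [hw]; push_cast; ring
    rw [e] at h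
    simp only [RCLike.norm_conj] at h
    rw [Real.mul_rpow (hI0 t) (hI0 t')] at h
    rw [← ofReal_norm, ← ENNReal.ofReal_mul (by positivity),
      ← ENNReal.ofReal_mul (mul_nonneg (by positivity) (hk0 t)), ← ENNReal.ofReal_mul hC0]
    refine ENNReal.ofReal_le_ofReal (h.trans (le_of_eq ?_))
    simp only [hkdef]
    ring
  have h1 : (((∫ η in annulus (m + 1) r₁ r₂, ‖dualWave a w G η‖ ^ (2 : ℝ) : ℝ)) : ℂ) =
      ∫ z : ℝ × ℝ, sliceForm a (2 * w) r₁ r₂ G z.1 z.2 := by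
    rw [← heq, ← integral_complex_ofReal]
    refine integral_congr_ae (Filter.Eventually.of_forall fun η => ?_)
    simp only
    rw [Complex.mul_conj, Complex.normSq_eq_norm_sq, ← Real.rpow_natCast]
    norm_num
  have h2 : ENNReal.ofReal (∫ η in annulus (m + 1) r₁ r₂, ‖dualWave a w G η‖ ^ (2 : ℝ)) ≤
      ENNReal.ofReal C * (2 * hlsConst θ) * ENNReal.ofReal (X ^ (2 - θ)) := by
    calc _ ≤ ‖∫ z : ℝ × ℝ, sliceForm a (2 * w) r₁ r₂ G z.1 z.2‖ₑ := by
          rw [← h1, ← ofReal_norm, Complex.norm_real]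
          exact ENNReal.ofReal_le_ofReal (Real.le_norm_self _)
      _ ≤ ∫⁻ z : ℝ × ℝ, ‖sliceForm a (2 * w) r₁ r₂ G z.1 z.2‖ₑ := enorm_integral_le_lintegral_enorm _
      _ = ∫⁻ t, ∫⁻ t', ‖sliceForm a (2 * w) r₁ r₂ G t t'‖ₑ := by
          rw [Measure.volume_eq_prod] at hsm ⊢
          exact lintegral_prod _ hsm.enorm
      _ ≤ ∫⁻ t, ∫⁻ t', ENNReal.ofReal C * (ENNReal.ofReal (|t - t'| ^ (-θ)) *
            ENNReal.ofReal (k t) * ENNReal.ofReal (k t')) := by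
          refine lintegral_mono fun t => lintegral_mono_ae ?_
          have : ∀ᵐ t' : ℝ, t' ≠ t := by simp [ae_iff]
          filter_upwards [this] with t' ht'
          exact hpt t t' ht'
      _ = ENNReal.ofReal C * ∫⁻ t, ∫⁻ t', ENNReal.ofReal (|t - t'| ^ (-θ)) *
            ENNReal.ofReal (k t) * ENNReal.ofReal (k t') := by
          simp only [lintegral_const_mul' _ _ ENNReal.ofReal_ne_top]
      _ ≤ _ := by
          rw [mul_assoc]
          exact mul_le_mul_right (hls hθ₀ hθ₁ hkm hk0 hX hk) _
  rw [← ENNReal.ofReal_toReal hL, ← ENNReal.ofReal_mul ENNReal.toReal_nonneg] at h2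
  exact (ENNReal.ofReal_le_ofReal_iff (mul_nonneg ENNReal.toReal_nonneg (by positivity))).1 h2

/-- The mixed norm bound for frequency localized solutions. -/
theorem exists_wave_bound (hm : 2 ≤ m) {a : ℝ} (ha : 1 ≤ a) (ha' : a ≤ 2) {θ : ℝ}
    (hθ₀ : 0 < θ) (hθ₁ : θ < 1) :
    ∃ K : ℝ, 0 ≤ K ∧ ∀ (r₁ r₂ D : ℝ) (g : EuclideanSpace ℝ (Fin (m + 1)) → ℂ), 0 < r₁ → r₁ ≤ r₂ →
      Measurable g → (∀ η, ‖g η‖ ≤ D) →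
      ∫⁻ t, (∫⁻ x, ‖wave a (-(θ * (m - a) / 2)) r₁ r₂ g (t, x)‖ₑ ^ (2 / (1 - θ))) ^
        ((1 - θ) / θ) ≤
      ENNReal.ofReal ((K * (∫ η in annulus (m + 1) r₁ r₂, ‖g η‖ ^ (2 : ℝ)) ^ (1 / 2 : ℝ)) ^
        (2 / θ)) := by
  obtain ⟨K, hK0, hK⟩ := exists_dualWave_bound hm ha ha' hθ₀ hθ₁
  refine ⟨K ^ (1 / 2 : ℝ), by positivity, fun r₁ r₂ D g hr₁ hr hg hD => ?_⟩
  have hg0 : 0 ≤ ∫ η in annulus (m + 1) r₁ r₂, ‖g η‖ ^ (2 : ℝ) :=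
    integral_nonneg fun η => by positivity
  obtain ⟨B, hB⟩ := exists_norm_wave_le a (-(θ * (m - a) / 2)) hr₁ hD (r₂ := r₂)
  refine lintegral_rpow_le_of_dual hθ₀ hθ₁ (by positivity) (measurable_wave a _ r₁ r₂ hg) hB
    fun G hG X hX hGX => ?_
  rw [integral_mul_wave a _ hr₁ hG hg hD]
  have hgL : MemLp g (ENNReal.ofReal 2) (volume.restrict (annulus (m + 1) r₁ r₂)) :=
    MemLp.of_bound hg.aestronglyMeasurable D (Filter.Eventually.of_forall hD)
  have hVL := memLp_dualWave a (-(θ * (m - a) / 2)) hr₁ hG (r₂ := r₂)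
  -- Moved to the frequency side, the pairing is an L² inner product; the transpose bound enters by
  -- Cauchy–Schwarz, hence the square root of its constant.
  calc _ ≤ ∫ η in annulus (m + 1) r₁ r₂, ‖g η‖ * ‖dualWave a (-(θ * (m - a) / 2)) G η‖ := by
        refine (norm_integral_le_integral_norm _).trans (le_of_eq ?_)
        simp only [norm_mul]
    _ ≤ (∫ η in annulus (m + 1) r₁ r₂, ‖g η‖ ^ (2 : ℝ)) ^ (1 / 2 : ℝ) *
        (∫ η in annulus (m + 1) r₁ r₂, ‖dualWave a (-(θ * (m - a) / 2)) G η‖ ^ (2 : ℝ)) ^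
          (1 / 2 : ℝ) :=
        integral_mul_norm_le_Lp_mul_Lq Real.HolderConjugate.two_two hgL (by simpa using hVL)
    _ ≤ (∫ η in annulus (m + 1) r₁ r₂, ‖g η‖ ^ (2 : ℝ)) ^ (1 / 2 : ℝ) *
        (K * X ^ (2 - θ)) ^ (1 / 2 : ℝ) := by
        refine mul_le_mul_of_nonneg_left (Real.rpow_le_rpow (integral_nonneg fun η => by positivity)
          (hK r₁ r₂ X G hr₁ hr hX hG hGX) (by norm_num)) (by positivity)
    _ = _ := by
        rw [Real.mul_rpow hK0 (by positivity), ← Real.rpow_mul hX.le]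
        have : (2 - θ) * (1 / 2) = (2 - θ) / 2 := by ring
        rw [this]; ring

end

/-! ### Band-limited data and elementary Hausdorff–Young bounds -/

section

variable {m : ℕ}

/-- Bounded measurable functions supported in an annulus. -/
structure BandFun (g : EuclideanSpace ℝ (Fin (m + 1)) → ℂ) : Prop where
  measurable : Measurable g
  bounded : ∃ D : ℝ, ∀ η, ‖g η‖ ≤ D
  band : ∃ r₁ r₂ : ℝ, 0 < r₁ ∧ r₁ ≤ r₂ ∧ ∀ η, η ∉ annulus (m + 1) r₁ r₂ → g η = 0

namespace BandFun

variable {g h : EuclideanSpace ℝ (Fin (m + 1)) → ℂ}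

theorem sub (hg : BandFun g) (hh : BandFun h) : BandFun fun η => g η - h η := by
  obtain ⟨D, hD⟩ := hg.bounded
  obtain ⟨D', hD'⟩ := hh.bounded
  obtain ⟨r₁, r₂, h1, h2, h3⟩ := hg.band
  obtain ⟨r₁', r₂', h1', h2', h3'⟩ := hh.band
  refine ⟨hg.measurable.sub hh.measurable, ⟨D + D', fun η =>
    (norm_sub_le _ _).trans (add_le_add (hD η) (hD' η))⟩, min r₁ r₁', max r₂ r₂', lt_min h1 h1',
    (min_le_left _ _).trans (h2.trans (le_max_left _ _)), fun η hη => ?_⟩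
  have e1 : g η = 0 := h3 η fun h => hη ⟨(min_le_left _ _).trans h.1, h.2.trans (le_max_left _ _)⟩
  have e2 : h η = 0 := h3' η fun h =>
    hη ⟨(min_le_right _ _).trans h.1, h.2.trans (le_max_right _ _)⟩
  simp [e1, e2]

theorem mul_bounded (hg : BandFun g) {k : EuclideanSpace ℝ (Fin (m + 1)) → ℂ} (hk : Measurable k)
    (hb : ∀ r₁ r₂ : ℝ, 0 < r₁ → r₁ ≤ r₂ → ∃ D : ℝ, ∀ η ∈ annulus (m + 1) r₁ r₂, ‖k η‖ ≤ D) :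
    BandFun fun η => k η * g η := by
  obtain ⟨D, hD⟩ := hg.bounded
  obtain ⟨r₁, r₂, h1, h2, h3⟩ := hg.band
  obtain ⟨D', hD'⟩ := hb r₁ r₂ h1 h2
  have hD0 : 0 ≤ D := (norm_nonneg _).trans (hD 0)
  refine ⟨hk.mul hg.measurable, ⟨|D'| * D, fun η => ?_⟩, r₁, r₂, h1, h2, fun η hη => by
    rw [h3 η hη, mul_zero]⟩
  by_cases hη : η ∈ annulus (m + 1) r₁ r₂
  · rw [norm_mul]
    exact mul_le_mul ((hD' η hη).trans (le_abs_self _)) (hD η) (norm_nonneg _) (abs_nonneg _)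
  · rw [h3 η hη, mul_zero, norm_zero]; positivity

theorem memLp (hg : BandFun g) (p : ℝ≥0∞) : MemLp g p := by
  obtain ⟨D, hD⟩ := hg.bounded
  obtain ⟨r₁, r₂, h1, h2, h3⟩ := hg.band
  have h4 : MemLp g p (volume.restrict (annulus (m + 1) r₁ r₂)) :=
    MemLp.of_bound hg.measurable.aestronglyMeasurable D (Filter.Eventually.of_forall hD)
  rw [← memLp_indicator_iff_restrict (measurableSet_annulus _ _ _)] at h4
  rwa [Set.indicator_eq_self.2 fun η hη => by_contra fun h => hη (h3 η h)] at h4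

theorem integrable (hg : BandFun g) : Integrable g := memLp_one_iff_integrable.1 (hg.memLp 1)

end BandFun

/-- The unimodular multiplier of the propagator. -/
def phase {n : ℕ} [NeZero n] (a t : ℝ) (η : EuclideanSpace ℝ (Fin n)) : ℂ :=
  Complex.exp (-(Complex.I * ((t * (2 * Real.pi * η 0) * (2 * Real.pi * ‖η‖) ^ a : ℝ) : ℂ)))

theorem phase_eq {n : ℕ} [NeZero n] (a t : ℝ) (η : EuclideanSpace ℝ (Fin n)) :
    phase a t η = Complex.exp (Complex.I * ((-(t * disp a η) : ℝ) : ℂ)) := by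
  unfold phase disp
  congr 1; push_cast; ring

theorem norm_phase {n : ℕ} [NeZero n] (a t : ℝ) (η : EuclideanSpace ℝ (Fin n)) :
    ‖phase a t η‖ = 1 := by
  rw [phase_eq, norm_exp_I_mul_ofReal]

theorem measurable_phase {n : ℕ} [NeZero n] (a t : ℝ) : Measurable (phase (n := n) a t) := by
  unfold phase; fun_prop

/-- The Lipschitz constant in time is the dispersion relation, which is bounded on each annulus;
this gives continuity of the band-limited solutions in time. -/
theorem norm_phase_sub_le {n : ℕ} [NeZero n] (a t t' : ℝ) (η : EuclideanSpace ℝ (Fin n)) :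
    ‖phase a t η - phase a t' η‖ ≤ |t - t'| * |disp a η| := by
  have e : phase a t η - phase a t' η =
      phase a t' η * (Complex.exp (Complex.I * ((-((t - t') * disp a η) : ℝ) : ℂ)) - 1) := by
    rw [phase_eq, phase_eq, mul_sub, ← Complex.exp_add, mul_one]
    congr 2; push_cast; ring
  rw [e, norm_mul, norm_phase, one_mul]
  refine (Real.norm_exp_I_mul_ofReal_sub_one_le).trans (le_of_eq ?_)
  rw [Real.norm_eq_abs, abs_neg, abs_mul]

theorem exists_disp_le (a : ℝ) {r₁ r₂ : ℝ} (hr₁ : 0 < r₁) :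
    ∃ D : ℝ, ∀ η ∈ annulus (m + 1) r₁ r₂, |disp a η| ≤ D := by
  refine ⟨2 * Real.pi * r₂ * ((2 * Real.pi * r₁) ^ a + (2 * Real.pi * r₂) ^ a), fun η hη => ?_⟩
  have hpi := Real.pi_pos
  have h1 : r₁ ≤ ‖η‖ := hη.1
  have h2 : ‖η‖ ≤ r₂ := hη.2
  have h3 : |η 0| ≤ r₂ := (PiLp.norm_apply_le η 0).trans h2
  have h4 := rpow_le_add (w := a) (x := 2 * Real.pi * r₁) (y := 2 * Real.pi * r₂)
    (r := 2 * Real.pi * ‖η‖) (by positivity) (by gcongr) (by gcongr)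
  unfold disp
  rw [abs_mul, abs_mul, abs_of_pos (by positivity : 0 < 2 * Real.pi),
    abs_of_nonneg (by positivity : 0 ≤ (2 * Real.pi * ‖η‖) ^ a)]
  have : 0 ≤ r₂ := by linarith
  gcongr

/-- The Fourier transform of the solution with data `|ξ|^w g`. -/
def freqData (a w : ℝ) (g : EuclideanSpace ℝ (Fin (m + 1)) → ℂ) (t : ℝ)
    (η : EuclideanSpace ℝ (Fin (m + 1))) : ℂ :=
  phase a t η * ((((2 * Real.pi * ‖η‖) ^ w : ℝ) : ℂ) * g η)

theorem BandFun.smul_rpow {g : EuclideanSpace ℝ (Fin (m + 1)) → ℂ} (hg : BandFun g) (w : ℝ) :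
    BandFun fun η => (((2 * Real.pi * ‖η‖) ^ w : ℝ) : ℂ) * g η := by
  refine hg.mul_bounded (by fun_prop) fun r₁ r₂ h1 h2 =>
    ⟨(2 * Real.pi * r₁) ^ w + (2 * Real.pi * r₂) ^ w, fun η hη => ?_⟩
  have hpi := Real.pi_pos
  have h3 : r₁ ≤ ‖η‖ := hη.1
  have h4 : ‖η‖ ≤ r₂ := hη.2
  rw [Complex.norm_real, Real.norm_of_nonneg (by positivity)]
  exact rpow_le_add (by positivity) (by gcongr) (by gcongr)

theorem BandFun.freqData {g : EuclideanSpace ℝ (Fin (m + 1)) → ℂ} (hg : BandFun g) (a w t : ℝ) :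
    BandFun (freqData a w g t) :=
  (hg.smul_rpow w).mul_bounded (measurable_phase a t) fun _ _ _ _ =>
    ⟨1, fun η _ => (norm_phase a t η).le⟩

/-- The solution with data `|ξ|^w g`. -/
def sol (a w : ℝ) (g : EuclideanSpace ℝ (Fin (m + 1)) → ℂ) (t : ℝ)
    (x : EuclideanSpace ℝ (Fin (m + 1))) : ℂ := 𝓕⁻ (freqData a w g t) x

theorem wave_eq_sol (a w : ℝ) {r₁ r₂ : ℝ} {g : EuclideanSpace ℝ (Fin (m + 1)) → ℂ}
    (hg : ∀ η, η ∉ annulus (m + 1) r₁ r₂ → g η = 0) (t : ℝ)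
    (x : EuclideanSpace ℝ (Fin (m + 1))) : wave a w r₁ r₂ g (t, x) = sol a w g t x := by
  unfold wave sol
  rw [Real.fourierInv_eq', setIntegral_eq_integral_of_forall_compl_eq_zero
    (fun η hη => by rw [hg η hη, mul_zero])]
  refine integral_congr_ae (Filter.Eventually.of_forall fun η => ?_)
  simp only [freqData, smul_eq_mul]
  rw [kernelFun_ofReal, phase_eq, mul_assoc, ← mul_assoc (Complex.exp (_ * Complex.I)),
    ← Complex.exp_add, real_inner_comm]
  congr 2
  push_cast; ring

theorem enorm_fourierInv_le {E : Type*} [NormedAddCommGroup E] [InnerProductSpace ℝ E]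
    [FiniteDimensional ℝ E] [MeasurableSpace E] [BorelSpace E] (h : E → ℂ) (x : E) :
    ‖𝓕⁻ h x‖ₑ ≤ eLpNorm h 1 volume := by
  rw [Real.fourierInv_eq', eLpNorm_one_eq_lintegral_enorm]
  refine (enorm_integral_le_lintegral_enorm _).trans (le_of_eq (lintegral_congr fun v => ?_))
  rw [enorm_smul, ← ofReal_norm, Complex.norm_exp_ofReal_mul_I, ENNReal.ofReal_one, one_mul]

/-- An elementary case of the Hausdorff-Young inequality, by interpolation with the trivial
`L^∞` bound. -/
theorem memLp_fourierInv_of_two_le {E : Type*} [NormedAddCommGroup E] [InnerProductSpace ℝ E]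
    [FiniteDimensional ℝ E] [MeasurableSpace E] [BorelSpace E] {h : E → ℂ} {p : ℝ≥0∞}
    (hp : 2 ≤ p) (hp' : p ≠ ∞) (h1 : Integrable h) (h2 : MemLp h 2) :
    MemLp (𝓕⁻ h) p ∧ eLpNorm (𝓕⁻ h) p volume ≤ (eLpNorm h 1 volume ^ (p.toReal - 2) *
      eLpNorm h 2 volume ^ (2 : ℝ)) ^ (1 / p.toReal) := by
  obtain ⟨h3, h4⟩ := memLp_fourierInv h1 h2
  have hp2 : 2 ≤ p.toReal := by
    simpa using ENNReal.toReal_mono hp' hp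
  have hb : eLpNorm (𝓕⁻ h) p volume ≤ (eLpNorm h 1 volume ^ (p.toReal - 2) *
      eLpNorm h 2 volume ^ (2 : ℝ)) ^ (1 / p.toReal) := by
    rw [eLpNorm_eq_lintegral_rpow_enorm_toReal (by rintro rfl; simp at hp) hp']
    refine ENNReal.rpow_le_rpow ?_ (by positivity)
    rw [← h4, eLpNorm_eq_lintegral_rpow_enorm_toReal (p := 2) (f := 𝓕⁻ h) (by norm_num) (by norm_num),
      ENNReal.toReal_ofNat, ← ENNReal.rpow_mul, one_div, inv_mul_cancel₀ two_ne_zero,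
      ENNReal.rpow_one, ← lintegral_const_mul' _ _
        (ENNReal.rpow_ne_top_of_nonneg (by linarith) (memLp_one_iff_integrable.2 h1).2.ne)]
    refine lintegral_mono fun x => ?_
    calc ‖𝓕⁻ h x‖ₑ ^ p.toReal = ‖𝓕⁻ h x‖ₑ ^ (p.toReal - 2) * ‖𝓕⁻ h x‖ₑ ^ (2 : ℝ) := by
          rw [← ENNReal.rpow_add_of_nonneg _ _ (by linarith) (by norm_num), sub_add_cancel]
      _ ≤ _ := by
          gcongr
          exact enorm_fourierInv_le h x
  refine ⟨⟨h3.1, hb.trans_lt ?_⟩, hb⟩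
  refine (ENNReal.rpow_ne_top_of_nonneg (by positivity) (ENNReal.mul_ne_top
    (ENNReal.rpow_ne_top_of_nonneg (by linarith) (memLp_one_iff_integrable.2 h1).2.ne)
    (ENNReal.rpow_ne_top_of_nonneg (by norm_num) h2.2.ne))).lt_top

/-- A uniform bound for the inverse Fourier transform of functions supported in an annulus. -/
theorem exists_eLpNorm_fourierInv_le {p : ℝ≥0∞} (hp : 2 ≤ p) (hp' : p ≠ ∞) (r₁ r₂ : ℝ) :
    ∃ K : ℝ≥0, ∀ (h : EuclideanSpace ℝ (Fin (m + 1)) → ℂ) (D : ℝ≥0), Measurable h →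
      (∀ η, ‖h η‖ ≤ D) → (∀ η, η ∉ annulus (m + 1) r₁ r₂ → h η = 0) →
      eLpNorm (𝓕⁻ h) p volume ≤ K * D := by
  have hp2 : 2 ≤ p.toReal := by
    simpa using ENNReal.toReal_mono hp' hp
  set μA := (volume : Measure (EuclideanSpace ℝ (Fin (m + 1)))).restrict (annulus (m + 1) r₁ r₂)
  set V : ℝ≥0∞ := volume (annulus (m + 1) r₁ r₂) with hV
  have hVtop : V ≠ ∞ := (isCompact_annulus _ _ _).measure_lt_top.ne
  set Q : ℝ≥0∞ := ((V ^ (1 : ℝ)) ^ (p.toReal - 2) * (V ^ (1 / 2 : ℝ)) ^ (2 : ℝ)) ^ (1 / p.toReal)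
    with hQ
  have hQtop : Q ≠ ∞ := by
    refine ENNReal.rpow_ne_top_of_nonneg (by positivity) (ENNReal.mul_ne_top ?_ ?_)
    · exact ENNReal.rpow_ne_top_of_nonneg (by linarith)
        (ENNReal.rpow_ne_top_of_nonneg (by norm_num) hVtop)
    · exact ENNReal.rpow_ne_top_of_nonneg (by norm_num)
        (ENNReal.rpow_ne_top_of_nonneg (by norm_num) hVtop)
  refine ⟨Q.toNNReal, fun h D hm hD h0 => ?_⟩
  have hband : ∀ r : ℝ≥0∞, eLpNorm h r volume = eLpNorm h r μA := fun r => by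
    rw [← eLpNorm_indicator_eq_eLpNorm_restrict (measurableSet_annulus _ _ _),
      Set.indicator_eq_self.2 fun η hη => by_contra fun h => hη (h0 η h)]
  have hle : ∀ r : ℝ≥0∞, eLpNorm h r volume ≤ V ^ r.toReal⁻¹ * D := fun r => by
    rw [hband]
    refine (eLpNorm_le_of_ae_bound (Filter.Eventually.of_forall hD)).trans ?_
    rw [Measure.restrict_apply_univ, ENNReal.ofReal_coe_nnreal]
  have hmem : ∀ r : ℝ≥0∞, MemLp h r := fun r => ⟨hm.aestronglyMeasurable, (hle r).trans_lt
    (ENNReal.mul_ne_top (ENNReal.rpow_ne_top_of_nonneg (by positivity) hVtop)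
      ENNReal.coe_ne_top).lt_top⟩
  refine (memLp_fourierInv_of_two_le hp hp' (memLp_one_iff_integrable.1 (hmem 1)) (hmem 2)).2.trans
    ?_
  have e1 := hle 1
  have e2 := hle 2
  simp only [ENNReal.toReal_one, inv_one, ENNReal.toReal_ofNat] at e1 e2
  rw [ENNReal.coe_toNNReal hQtop, hQ]
  calc _ ≤ ((V ^ (1 : ℝ) * D) ^ (p.toReal - 2) * (V ^ (1 / 2 : ℝ) * D) ^ (2 : ℝ)) ^
        (1 / p.toReal) := by
        refine ENNReal.rpow_le_rpow (mul_le_mul' (ENNReal.rpow_le_rpow e1 (by linarith))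
          (ENNReal.rpow_le_rpow ?_ (by norm_num))) (by positivity)
        rw [one_div]; exact e2
    _ = _ := by
        rw [ENNReal.mul_rpow_of_nonneg _ _ (by linarith : 0 ≤ p.toReal - 2),
          ENNReal.mul_rpow_of_nonneg _ _ (by norm_num : (0 : ℝ) ≤ 2), mul_mul_mul_comm,
          ← ENNReal.rpow_add_of_nonneg _ _ (by linarith) (by norm_num), sub_add_cancel,
          ENNReal.mul_rpow_of_nonneg _ _ (by positivity), ← ENNReal.rpow_mul (D : ℝ≥0∞),
          mul_one_div_cancel (by linarith), ENNReal.rpow_one, ENNReal.rpow_one]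

end

/-! ### Band-limited solutions as curves in L^p -/

section

variable {m : ℕ} {p q : ℝ≥0∞} {a w : ℝ} {g h : EuclideanSpace ℝ (Fin (m + 1)) → ℂ}

theorem memLp_sol (hp : 2 ≤ p) (hp' : p ≠ ∞) (hg : BandFun g) (a w t : ℝ) :
    MemLp (sol a w g t) p :=
  (memLp_fourierInv_of_two_le hp hp' (hg.freqData a w t).integrable
    ((hg.freqData a w t).memLp 2)).1

/-- `sol` as a curve in `L^p`. -/
def solLp (hp : 2 ≤ p) (hp' : p ≠ ∞) (hg : BandFun g) (a w t : ℝ) :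
    Lp ℂ p (volume : Measure (EuclideanSpace ℝ (Fin (m + 1)))) :=
  (memLp_sol hp hp' hg a w t).toLp _

theorem fourierInv_sub {E : Type*} [NormedAddCommGroup E] [InnerProductSpace ℝ E]
    [FiniteDimensional ℝ E] [MeasurableSpace E] [BorelSpace E] {f h : E → ℂ} (hf : Integrable f)
    (hh : Integrable h) : (𝓕⁻ fun x => f x - h x : E → ℂ) = fun x => 𝓕⁻ f x - 𝓕⁻ h x := by
  ext x
  simp only [Real.fourierInv_eq_fourier_neg, Real.fourier_eq, smul_sub]
  exact integral_sub ((Real.fourierIntegral_convergent_iff (-x)).2 hf)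
    ((Real.fourierIntegral_convergent_iff (-x)).2 hh)

theorem sol_sub (hg : BandFun g) (hh : BandFun h) (a w t : ℝ) :
    sol a w (fun η => g η - h η) t = fun x => sol a w g t x - sol a w h t x := by
  unfold sol
  rw [← fourierInv_sub (hg.freqData a w t).integrable (hh.freqData a w t).integrable]
  refine congrArg (fun k : EuclideanSpace ℝ (Fin (m + 1)) → ℂ =>
    (𝓕⁻ k : EuclideanSpace ℝ (Fin (m + 1)) → ℂ)) (funext fun η => ?_)
  simp only [freqData]; ring

theorem solLp_sub (hp : 2 ≤ p) (hp' : p ≠ ∞) (hg : BandFun g) (hh : BandFun h) (a w t : ℝ) :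
    solLp hp hp' (hg.sub hh) a w t = solLp hp hp' hg a w t - solLp hp hp' hh a w t := by
  unfold solLp
  rw [← MemLp.toLp_sub]
  exact MemLp.toLp_congr _ _ (Filter.Eventually.of_forall fun x => congrFun (sol_sub hg hh a w t) x)

/-- On a fixed annulus the multiplier is Lipschitz in t uniformly in frequency, and the uniform
bound for inverse transforms of functions supported there carries this to L^p. Continuity supplies
the strong measurability that the mixed norm demands. -/
theorem continuous_solLp [Fact (1 ≤ p)] (hp : 2 ≤ p) (hp' : p ≠ ∞) (hg : BandFun g) (a w : ℝ) :
    Continuous (solLp hp hp' hg a w) := by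
  obtain ⟨D, hD⟩ := (hg.smul_rpow w).bounded
  obtain ⟨r₁, r₂, h1, h2, h3⟩ := hg.band
  obtain ⟨D', hD'⟩ := exists_disp_le (m := m) a h1 (r₂ := r₂)
  obtain ⟨K, hK⟩ := exists_eLpNorm_fourierInv_le (m := m) hp hp' r₁ r₂
  have hD0 : 0 ≤ D := (norm_nonneg _).trans (hD 0)
  refine LipschitzWith.continuous (K := K * (D'.toNNReal * D.toNNReal)) fun t t' => ?_
  have hdiff : solLp hp hp' hg a w t - solLp hp hp' hg a w t' =
      ((memLp_sol hp hp' hg a w t).sub (memLp_sol hp hp' hg a w t')).toLp _ :=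
    (MemLp.toLp_sub _ _).symm
  rw [edist_eq_enorm_sub, hdiff, Lp.enorm_toLp]
  have e : (sol a w g t - sol a w g t') =
      𝓕⁻ (fun η => freqData a w g t η - freqData a w g t' η) := by
    rw [fourierInv_sub (hg.freqData a w t).integrable (hg.freqData a w t').integrable]
    rfl
  rw [e]
  refine (hK _ (D'.toNNReal * D.toNNReal * ‖t - t'‖₊)
    ((hg.freqData a w t).measurable.sub (hg.freqData a w t').measurable) (fun η => ?_)
    fun η hη => ?_).trans (le_of_eq ?_)
  · by_cases hη : η ∈ annulus (m + 1) r₁ r₂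
    · simp only [freqData, Pi.sub_apply]
      rw [← sub_mul, norm_mul]
      calc _ ≤ (|t - t'| * |disp a η|) * D :=
            mul_le_mul (norm_phase_sub_le a t t' η) (hD η) (norm_nonneg _) (by positivity)
        _ ≤ (|t - t'| * D'.toNNReal) * D := by
            gcongr
            exact (hD' η hη).trans (Real.le_coe_toNNReal _)
        _ = _ := by
            push_cast
            rw [Real.coe_toNNReal D hD0, Real.norm_eq_abs]
            ring
    · simp only [freqData, Pi.sub_apply]
      rw [h3 η hη]
      simp only [mul_zero, sub_self, norm_zero]
      positivity
  · simp only [freqData, Pi.sub_apply]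
    rw [h3 η hη]
    simp
  · rw [edist_eq_enorm_sub]
    push_cast
    rw [← mul_assoc]
    rfl

theorem two_div_toReal_add (hp : 2 ≤ p) (hq : 2 ≤ q) (hp' : p ≠ ∞) (hq' : q ≠ ∞)
    (hpq : 2 / q + 2 / p = 1) : 2 / q.toReal + 2 / p.toReal = 1 := by
  have hp0 : p ≠ 0 := by rintro rfl; simp at hp
  have hq0 : q ≠ 0 := by rintro rfl; simp at hq
  have h := congrArg ENNReal.toReal hpq
  rw [ENNReal.toReal_add (ENNReal.div_ne_top (by simp) hq0) (ENNReal.div_ne_top (by simp) hp0),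
    ENNReal.toReal_div, ENNReal.toReal_div] at h
  simpa using h

/-- The homogeneous Strichartz estimate for data that are localized in frequency. -/
theorem exists_solLp_bound (hm : 2 ≤ m) (ha : 1 ≤ a) (ha' : a ≤ 2) (hp : 2 ≤ p)
    (hq : 2 ≤ q) (hp' : p ≠ ∞) (hpq : 2 / q + 2 / p = 1) {s : ℝ}
    (hs : s = ((m + 1 : ℕ) : ℝ) * (1 / 2 - (p⁻¹).toReal) - (a + 1) * (q⁻¹).toReal) :
    ∃ K : ℝ≥0, ∀ (g : EuclideanSpace ℝ (Fin (m + 1)) → ℂ) (hg : BandFun g),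
      eLpNorm (solLp hp hp' hg a (-s)) q volume ≤ K * eLpNorm g 2 volume := by
  have hp0 : p ≠ 0 := by rintro rfl; simp at hp
  have hq0 : q ≠ 0 := by rintro rfl; simp at hq
  rcases eq_or_ne q ∞ with rfl | hq'
  -- At q = ∞ the scaling relation forces p = 2 and s = 0, and the multiplier is unimodular at each
  -- time.
  · have hp2 : p = 2 := by
      simp only [ENNReal.div_top, zero_add] at hpq
      rw [ENNReal.div_eq_one_iff hp0 hp'] at hpq
      exact hpq.symm
    subst hp2
    have hs0 : -s = 0 := by rw [hs]; simp
    rw [hs0]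
    refine ⟨1, fun g hg => ?_⟩
    rw [eLpNorm_exponent_top, ENNReal.coe_one, one_mul]
    refine eLpNormEssSup_le_of_ae_enorm_bound (Filter.Eventually.of_forall fun t => ?_)
    rw [solLp, Lp.enorm_toLp]
    have hb := hg.freqData a 0 t
    refine ((memLp_fourierInv hb.integrable (hb.memLp 2)).2).le.trans (le_of_eq ?_)
    refine eLpNorm_congr_norm_ae (Filter.Eventually.of_forall fun η => ?_)
    simp [freqData, norm_phase]
  · have hsum := two_div_toReal_add hp hq hp' hq' hpq
    set P := p.toReal with hP
    set Q := q.toReal with hQ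
    have hP0 : 0 < P := ENNReal.toReal_pos hp0 hp'
    have hQ0 : 0 < Q := ENNReal.toReal_pos hq0 hq'
    set θ := 2 / Q with hθ
    have hθ₀ : 0 < θ := by positivity
    have hθ₁ : θ < 1 := by
      have : 0 < 2 / P := by positivity
      linarith
    have h1θ : 0 < 1 - θ := by linarith
    have hPθ : P = 2 / (1 - θ) := by
      rw [eq_div_iff h1θ.ne', ← hsum]; field_simp; ring
    have hQθ : Q = 2 / θ := by rw [hθ]; field_simp
    obtain ⟨K, hK0, hK⟩ := exists_wave_bound hm ha ha' hθ₀ hθ₁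
    refine ⟨K.toNNReal, fun g hg => ?_⟩
    obtain ⟨D, hD⟩ := hg.bounded
    obtain ⟨r₁, r₂, h1, h2, h3⟩ := hg.band
    -- Since 1/2 − 1/p = 1/q, s reduces to (m + 1 − a − 1)/q = θ(m − a)/2.
    have hsθ : -s = -(θ * (m - a) / 2) := by
      rw [hs, ENNReal.toReal_inv, ENNReal.toReal_inv, ← hP, ← hQ, hPθ, hQθ]
      push_cast
      field_simp
      ring
    have h4 := hK r₁ r₂ D g h1 h2 hg.measurable hD
    simp only [wave_eq_sol a _ h3, ← hsθ, ← hPθ, ← hQθ] at h4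
    have h5 : ENNReal.ofReal ((∫ η in annulus (m + 1) r₁ r₂, ‖g η‖ ^ (2 : ℝ)) ^ (1 / 2 : ℝ)) =
        eLpNorm g 2 volume := by
      rw [(hg.memLp 2).eLpNorm_eq_integral_rpow_norm (by norm_num) (by norm_num),
        setIntegral_eq_integral_of_forall_compl_eq_zero fun η hη => by rw [h3 η hη]; simp]
      simp
    rw [eLpNorm_eq_lintegral_rpow_enorm_toReal hq0 hq', ← hQ, ← h5]
    -- The outer exponent (1 − θ)/θ is Q/P.
    have h6 : ∀ t, ‖solLp hp hp' hg a (-s) t‖ₑ ^ Q =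
        (∫⁻ x, ‖sol a (-s) g t x‖ₑ ^ P) ^ ((1 - θ) / θ) := by
      intro t
      rw [solLp, Lp.enorm_toLp, eLpNorm_eq_lintegral_rpow_enorm_toReal hp0 hp', ← hP,
        ← ENNReal.rpow_mul]
      congr 1
      rw [hQθ, hPθ]; field_simp
    simp only [h6]
    refine (ENNReal.rpow_le_rpow h4 (by positivity)).trans (le_of_eq ?_)
    have h7 : 0 ≤ (∫ η in annulus (m + 1) r₁ r₂, ‖g η‖ ^ (2 : ℝ)) ^ (1 / 2 : ℝ) :=
      Real.rpow_nonneg (integral_nonneg fun η => by positivity) _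
    rw [← ENNReal.ofReal_rpow_of_nonneg (mul_nonneg hK0 h7) hQ0.le, ← ENNReal.rpow_mul,
      mul_one_div_cancel hQ0.ne', ENNReal.rpow_one, ENNReal.ofReal_mul hK0]
    rfl

end

/-! ### Approximation of general data -/

section

section General

variable {n : ℕ}

theorem distOf_apply {g : EuclideanSpace ℝ (Fin n) → ℂ} (hg : IsTemperedFun g)
    (φ : 𝓢(EuclideanSpace ℝ (Fin n), ℂ)) : distOf g φ = ∫ x, φ x * g x := by
  unfold distOf
  rw [dif_pos hg, distOfTempered_apply]

theorem fourierFun_spec {f : 𝓢'(EuclideanSpace ℝ (Fin n), ℂ)} (hf : FourierIsFun f) :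
    IsTemperedFun (fourierFun f) ∧ 𝓕 f = distOf (fourierFun f) := by
  unfold fourierFun
  rw [dif_pos hf]
  exact hf.choose_spec

theorem IsTemperedFun.phase_mul [NeZero n] {g : EuclideanSpace ℝ (Fin n) → ℂ}
    (hg : IsTemperedFun g) (a t : ℝ) : IsTemperedFun fun η => phase a t η * g η := by
  obtain ⟨hm, k, hk⟩ := hg
  refine ⟨(measurable_phase a t).aestronglyMeasurable.mul hm, k, ?_⟩
  simpa [norm_phase] using hk

theorem propagator_apply [NeZero n] {f : 𝓢'(EuclideanSpace ℝ (Fin n), ℂ)} (hf : FourierIsFun f)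
    (a t : ℝ) (φ : 𝓢(EuclideanSpace ℝ (Fin n), ℂ)) :
    propagator a t f φ = ∫ η, (𝓕⁻ φ) η * (phase a t η * fourierFun f η) := by
  unfold propagator
  rw [TemperedDistribution.fourierInv_apply]
  exact distOf_apply ((fourierFun_spec hf).1.phase_mul a t) _

theorem mixedNorm_le {q p : ℝ≥0∞} [Fact (1 ≤ p)] {I : Set ℝ}
    {U : ℝ → 𝓢'(EuclideanSpace ℝ (Fin n), ℂ)}
    {u : ℝ → Lp ℂ p (volume : Measure (EuclideanSpace ℝ (Fin n)))}
    (h1 : AEStronglyMeasurable u (volume.restrict I))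
    (h2 : ∀ᵐ t ∂(volume.restrict I), Lp.toTemperedDistribution (u t) = U t) :
    mixedNorm q p I U ≤ eLpNorm u q (volume.restrict I) :=
  iInf_le_of_le u (iInf_le_of_le h1 (iInf_le _ h2))

theorem mixedNorm_univ_le {q p : ℝ≥0∞} [Fact (1 ≤ p)]
    {U : ℝ → 𝓢'(EuclideanSpace ℝ (Fin n), ℂ)}
    {u : ℝ → Lp ℂ p (volume : Measure (EuclideanSpace ℝ (Fin n)))}
    (h1 : AEStronglyMeasurable u) (h2 : ∀ᵐ t, Lp.toTemperedDistribution (u t) = U t) :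
    mixedNorm q p Set.univ U ≤ eLpNorm u q volume := by
  rw [← Measure.restrict_univ (μ := (volume : Measure ℝ))] at h1 h2 ⊢
  rw [Measure.restrict_univ (μ := (volume : Measure ℝ))]
  exact (mixedNorm_le h1 h2).trans (by rw [Measure.restrict_univ])

theorem continuous_toTemperedDistribution_apply {p : ℝ≥0∞} [Fact (1 ≤ p)]
    (φ : 𝓢(EuclideanSpace ℝ (Fin n), ℂ)) :
    Continuous fun u : Lp ℂ p (volume : Measure (EuclideanSpace ℝ (Fin n))) =>
      Lp.toTemperedDistribution u φ :=
  ((PointwiseConvergenceCLM.evalCLM (RingHom.id ℂ) ℂ φ).continuous.comp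
    (Lp.toTemperedDistributionCLM ℂ volume p).continuous)

/-- Every competitor in the infimum over J is a competitor over I, with no larger norm. -/
theorem mixedNorm_mono {q p : ℝ≥0∞} [Fact (1 ≤ p)] {I J : Set ℝ} (hIJ : I ⊆ J)
    (U : ℝ → 𝓢'(EuclideanSpace ℝ (Fin n), ℂ)) : mixedNorm q p I U ≤ mixedNorm q p J U := by
  have h := Measure.restrict_mono_set volume hIJ
  refine le_iInf fun u => le_iInf fun h1 => le_iInf fun h2 => ?_
  exact (mixedNorm_le (h1.mono_measure h) (ae_mono h h2)).trans (eLpNorm_mono_measure _ h)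

end General

variable {m : ℕ}

/-- The truncation of `g` to an annulus and to bounded values. -/
def bandTrunc (g : EuclideanSpace ℝ (Fin (m + 1)) → ℂ) (k : ℕ) :
    EuclideanSpace ℝ (Fin (m + 1)) → ℂ :=
  (annulus (m + 1) (1 / ((k : ℝ) + 1)) (k + 1) ∩ {η | ‖g η‖ ≤ k}).indicator g

theorem bandFun_bandTrunc {g : EuclideanSpace ℝ (Fin (m + 1)) → ℂ} (hg : Measurable g) (k : ℕ) :
    BandFun (bandTrunc g k) := by
  have hk : (0 : ℝ) < k + 1 := by positivity
  refine ⟨hg.indicator ((measurableSet_annulus _ _ _).inter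
    (measurableSet_le hg.norm measurable_const)), ⟨k, fun η => ?_⟩, 1 / ((k : ℝ) + 1), k + 1,
    by positivity, ?_, fun η hη => Set.indicator_of_notMem (fun h => hη h.1) _⟩
  · unfold bandTrunc Set.indicator
    split_ifs with h
    · exact h.2
    · simp
  · rw [div_le_iff₀ hk]
    nlinarith [(Nat.cast_nonneg k : (0 : ℝ) ≤ k)]

theorem eventually_bandTrunc_eq (g : EuclideanSpace ℝ (Fin (m + 1)) → ℂ)
    {η : EuclideanSpace ℝ (Fin (m + 1))} (hη : η ≠ 0) :
    ∀ᶠ k in Filter.atTop, bandTrunc g k η = g η := by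
  have h1 : Filter.Tendsto (fun k : ℕ => (k : ℝ)) Filter.atTop Filter.atTop :=
    tendsto_natCast_atTop_atTop
  filter_upwards [h1.eventually_ge_atTop ‖η‖, h1.eventually_ge_atTop ‖g η‖,
    (tendsto_one_div_add_atTop_nhds_zero_nat (𝕜 := ℝ)).eventually_le_const (norm_pos_iff.2 hη)]
    with k h2 h3 h4
  have h5 : η ∈ annulus (m + 1) (1 / ((k : ℝ) + 1)) (k + 1) := ⟨h4, by linarith⟩
  exact Set.indicator_of_mem (Set.mem_inter h5 h3) _

theorem norm_bandTrunc_le (g : EuclideanSpace ℝ (Fin (m + 1)) → ℂ) (k : ℕ)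
    (η : EuclideanSpace ℝ (Fin (m + 1))) : ‖bandTrunc g k η‖ ≤ ‖g η‖ :=
  norm_indicator_le_norm_self _ _

theorem ae_ne_zero : ∀ᵐ η : EuclideanSpace ℝ (Fin (m + 1)), η ≠ 0 := by
  simp [ae_iff]

theorem tendsto_eLpNorm_bandTrunc_sub {g : EuclideanSpace ℝ (Fin (m + 1)) → ℂ} (hg : Measurable g)
    (hg2 : MemLp g 2) :
    Filter.Tendsto (fun k => eLpNorm (bandTrunc g k - g) 2 volume) Filter.atTop (nhds 0) := by
  have h1 : Filter.Tendsto (fun k => ∫⁻ η, ‖(bandTrunc g k - g) η‖ₑ ^ (2 : ℝ)) Filter.atTop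
      (nhds (∫⁻ _ : EuclideanSpace ℝ (Fin (m + 1)), 0)) := by
    refine tendsto_lintegral_of_dominated_convergence (fun η => ‖g η‖ₑ ^ (2 : ℝ)) (fun k => ?_)
      (fun k => Filter.Eventually.of_forall fun η => ?_) ?_ ?_
    · have := (bandFun_bandTrunc hg k).measurable
      exact (this.sub hg).enorm.pow_const _
    · refine ENNReal.rpow_le_rpow ?_ (by norm_num)
      simp only [Pi.sub_apply, bandTrunc, Set.indicator]
      split_ifs <;> simp
    · have := hg2.2
      have h2 := (eLpNorm_lt_top_iff_lintegral_rpow_enorm_lt_top (p := 2) (f := g) (μ := volume)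
        (by norm_num) (by norm_num)).1 this
      simpa using h2.ne
    · filter_upwards [ae_ne_zero (m := m)] with η hη
      refine tendsto_const_nhds.congr' ?_
      filter_upwards [eventually_bandTrunc_eq g hη] with k hk
      simp [hk]
  rw [lintegral_zero] at h1
  have h2 := (ENNReal.continuous_rpow_const (y := (1 / 2 : ℝ))).tendsto 0 |>.comp h1
  rw [ENNReal.zero_rpow_of_pos (by norm_num)] at h2
  refine h2.congr fun k => ?_
  rw [eLpNorm_eq_lintegral_rpow_enorm_toReal (by norm_num) (by norm_num)]
  simp

theorem solLp_apply {p : ℝ≥0∞} [Fact (1 ≤ p)] (hp : 2 ≤ p) (hp' : p ≠ ∞)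
    {g : EuclideanSpace ℝ (Fin (m + 1)) → ℂ} (hg : BandFun g) (a w t : ℝ)
    (φ : 𝓢(EuclideanSpace ℝ (Fin (m + 1)), ℂ)) :
    Lp.toTemperedDistribution (solLp hp hp' hg a w t) φ = ∫ η, (𝓕⁻ φ) η * freqData a w g t η := by
  rw [Lp.toTemperedDistribution_apply, integral_schwartz_fourierInv_mul φ
    (hg.freqData a w t).integrable]
  refine integral_congr_ae ?_
  filter_upwards [(memLp_sol hp hp' hg a w t).coeFn_toLp] with x hx
  rw [solLp, hx, smul_eq_mul]
  rfl

/-- With g = |ξ|^s f̂ the weight |ξ|^(−s) of the solution restores f̂ away from the origin. The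
truncations are dominated by |f̂|, which is integrable against a Schwartz function because f̂ is a
tempered function. -/
theorem tendsto_solLp_apply {p : ℝ≥0∞} [Fact (1 ≤ p)] (hp : 2 ≤ p) (hp' : p ≠ ∞) (a s t : ℝ)
    {f : 𝓢'(EuclideanSpace ℝ (Fin (m + 1)), ℂ)} (hf : FourierIsFun f)
    {g : EuclideanSpace ℝ (Fin (m + 1)) → ℂ} (hg : Measurable g)
    (hgf : ∀ᵐ η, g η = (2 * Real.pi * ‖η‖) ^ s • fourierFun f η)
    (φ : 𝓢(EuclideanSpace ℝ (Fin (m + 1)), ℂ)) :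
    Filter.Tendsto (fun k => Lp.toTemperedDistribution
      (solLp hp hp' (bandFun_bandTrunc hg k) a (-s) t) φ) Filter.atTop
      (nhds (propagator a t f φ)) := by
  have hpi := Real.pi_pos
  simp only [solLp_apply]
  rw [propagator_apply hf]
  have hinv : ∀ η : EuclideanSpace ℝ (Fin (m + 1)), η ≠ 0 →
      g η = (2 * Real.pi * ‖η‖) ^ s • fourierFun f η →
      (((2 * Real.pi * ‖η‖) ^ (-s) : ℝ) : ℂ) * g η = fourierFun f η := fun η hη h => by
    have h0 : 0 < 2 * Real.pi * ‖η‖ := by have := norm_pos_iff.2 hη; positivity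
    rw [h, Complex.real_smul, ← mul_assoc, ← Complex.ofReal_mul, ← Real.rpow_add h0,
      neg_add_cancel, Real.rpow_zero, Complex.ofReal_one, one_mul]
  refine tendsto_integral_of_dominated_convergence (fun η => ‖(𝓕⁻ φ) η * fourierFun f η‖)
    (fun k => ?_) ?_ (fun k => ?_) ?_
  · exact (𝓕⁻ φ).continuous.aestronglyMeasurable.mul
      ((bandFun_bandTrunc hg k).freqData a (-s) t).measurable.aestronglyMeasurable
  · exact ((fourierFun_spec hf).1.integrable _).norm
  · filter_upwards [ae_ne_zero (m := m), hgf] with η hη h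
    rw [norm_mul, norm_mul]
    refine mul_le_mul_of_nonneg_left ?_ (norm_nonneg _)
    rw [freqData, norm_mul, norm_phase, one_mul, ← hinv η hη h, norm_mul, norm_mul]
    exact mul_le_mul_of_nonneg_left (norm_bandTrunc_le _ _ _) (norm_nonneg _)
  · filter_upwards [ae_ne_zero (m := m), hgf] with η hη h
    refine tendsto_const_nhds.congr' ?_
    filter_upwards [eventually_bandTrunc_eq g hη] with k hk
    rw [freqData, hk, hinv η hη h]

/-- The mixed norm bound of the propagator, from the bound for data localized in frequency. -/
theorem mixedNorm_propagator_le {p q : ℝ≥0∞} [Fact (1 ≤ p)] (hp : 2 ≤ p) (hp' : p ≠ ∞)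
    (hq : 2 ≤ q) (a s : ℝ) {K : ℝ≥0}
    (hK : ∀ (g : EuclideanSpace ℝ (Fin (m + 1)) → ℂ) (hg : BandFun g),
      eLpNorm (solLp hp hp' hg a (-s)) q volume ≤ K * eLpNorm g 2 volume)
    {f : 𝓢'(EuclideanSpace ℝ (Fin (m + 1)), ℂ)} (hf : MemHomSobolev s f) :
    mixedNorm q p Set.univ (fun t => propagator a t f) ≤ K * homSobolevNorm s f := by
  have : Fact (1 ≤ q) := ⟨le_trans (by norm_num) hq⟩
  obtain ⟨hf1, hf2⟩ := hf
  -- Band functions are measurable, not merely almost everywhere so; hence the passage to a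
  -- measurable representative.
  set g : EuclideanSpace ℝ (Fin (m + 1)) → ℂ := hf2.1.mk _ with hgdef
  have hg : Measurable g := hf2.1.stronglyMeasurable_mk.measurable
  have hgf : g =ᵐ[volume] fun η => (2 * Real.pi * ‖η‖) ^ s • fourierFun f η := hf2.1.ae_eq_mk.symm
  have hg2 : MemLp g 2 := (memLp_congr_ae hgf).2 hf2
  have hnorm : homSobolevNorm s f = eLpNorm g 2 volume := (eLpNorm_congr_ae hgf).symm
  rw [hnorm]
  set b := fun k => bandFun_bandTrunc hg k with hb
  have hW : ∀ k, MemLp (solLp hp hp' (b k) a (-s)) q := fun k =>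
    ⟨(continuous_solLp hp hp' (b k) a (-s)).aestronglyMeasurable, (hK _ (b k)).trans_lt
      (ENNReal.mul_ne_top ENNReal.coe_ne_top ((b k).memLp 2).2.ne).lt_top⟩
  set W : ℕ → Lp (Lp ℂ p (volume : Measure (EuclideanSpace ℝ (Fin (m + 1))))) q
    (volume : Measure ℝ) := fun k => (hW k).toLp _ with hWdef
  -- The solution is linear in its data, so the estimate applies to differences of truncations,
  -- which tend to 0 in L².
  have hcauchy : CauchySeq W := by
    rw [EMetric.cauchySeq_iff]
    intro ε hε
    have hδ : 0 < ε / (2 * (K + 1)) := ENNReal.div_pos hε.ne' (by finiteness)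
    obtain ⟨N, hN⟩ := Filter.eventually_atTop.1
      ((tendsto_eLpNorm_bandTrunc_sub hg hg2).eventually_lt_const hδ)
    refine ⟨N, fun k hk l hl => ?_⟩
    simp only [hWdef]
    rw [Lp.edist_toLp_toLp]
    have e1 : solLp hp hp' (b k) a (-s) - solLp hp hp' (b l) a (-s) =
        solLp hp hp' ((b k).sub (b l)) a (-s) := by
      ext1 t
      rw [solLp_sub]; rfl
    rw [e1]
    have e2 : (fun η => bandTrunc g k η - bandTrunc g l η) =
        (bandTrunc g k - g) - (bandTrunc g l - g) := by
      ext η; simp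
    have hmk : ∀ k, AEStronglyMeasurable (bandTrunc g k - g) volume := fun k =>
      ((b k).measurable.sub hg).aestronglyMeasurable
    have h3 : eLpNorm (fun η => bandTrunc g k η - bandTrunc g l η) 2 volume ≤
        2 * max (eLpNorm (bandTrunc g k - g) 2 volume) (eLpNorm (bandTrunc g l - g) 2 volume) := by
      rw [e2, two_mul]
      exact (eLpNorm_sub_le (hmk k) (hmk l) (by norm_num)).trans
        (add_le_add (le_max_left _ _) (le_max_right _ _))
    calc _ ≤ K * eLpNorm (fun η => bandTrunc g k η - bandTrunc g l η) 2 volume := hK _ _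
      _ ≤ (K + 1) * (2 * max (eLpNorm (bandTrunc g k - g) 2 volume)
          (eLpNorm (bandTrunc g l - g) 2 volume)) := by
          gcongr
          exact le_self_add
      _ = max (eLpNorm (bandTrunc g k - g) 2 volume)
          (eLpNorm (bandTrunc g l - g) 2 volume) * (2 * (K + 1)) := by ring
      _ < ε := ENNReal.mul_lt_of_lt_div (max_lt (hN k hk) (hN l hl))
  obtain ⟨U, hU⟩ := cauchySeq_tendsto_of_complete hcauchy
  obtain ⟨ns, hns, hae⟩ := (tendstoInMeasure_of_tendsto_Lp hU).exists_seq_tendsto_ae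
  have hWae : ∀ᵐ t, ∀ k, W k t = solLp hp hp' (b k) a (-s) t :=
    ae_all_iff.2 fun k => (hW k).coeFn_toLp
  have hUnorm : eLpNorm U q volume ≤ K * eLpNorm g 2 volume := by
    rw [← Lp.enorm_def]
    refine le_of_tendsto ((continuous_enorm.tendsto U).comp hU)
      (Filter.Eventually.of_forall fun k => ?_)
    simp only [Function.comp_apply, hWdef]
    rw [Lp.enorm_toLp]
    refine (hK _ (b k)).trans ?_
    gcongr
    exact eLpNorm_mono (norm_bandTrunc_le g k)
  -- Along a subsequence the curves converge in L^p for almost every t, hence as distributions; the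
  -- limit there is already known to be the propagator.
  have hUae : ∀ᵐ t, Lp.toTemperedDistribution (U t) = propagator a t f := by
    filter_upwards [hae, hWae] with t ht hWt
    ext φ
    have h1 := ((continuous_toTemperedDistribution_apply φ).tendsto (U t)).comp ht
    refine tendsto_nhds_unique h1 ?_
    refine ((tendsto_solLp_apply hp hp' a s t hf1 hg hgf φ).comp hns.tendsto_atTop).congr
      fun i => ?_
    simp only [Function.comp_apply, hWt]
  exact (mixedNorm_univ_le (Lp.aestronglyMeasurable U) hUae).trans hUnorm

end

/-! ### Inhomogeneous Sobolev spaces -/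

section

variable {n : ℕ}

theorem IsTemperedFun.locallyIntegrable {g : EuclideanSpace ℝ (Fin n) → ℂ} (hg : IsTemperedFun g) :
    LocallyIntegrable g := by
  obtain ⟨hm, k, hk⟩ := hg
  rw [locallyIntegrable_iff]
  intro K hK
  have h1 : IntegrableOn (fun x => (1 + ‖x‖) ^ k * ((1 + ‖x‖) ^ (-(k : ℝ)) * ‖g x‖)) K :=
    hk.integrableOn.continuousOn_mul (by fun_prop) hK
  refine (integrable_norm_iff hm.restrict).1 (h1.congr (Filter.Eventually.of_forall fun x => ?_))
  have hx : (0 : ℝ) < 1 + ‖x‖ := by positivity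
  simp only
  rw [Real.rpow_neg hx.le, Real.rpow_natCast, mul_inv_cancel_left₀ (by positivity)]

/-- Cauchy–Schwarz against (1 + |x|)^(−(n+1)), which is square integrable because 2(n + 1) > n. -/
theorem isTemperedFun_of_memLp_two {g : EuclideanSpace ℝ (Fin n) → ℂ} (hg : MemLp g 2) :
    IsTemperedFun g := by
  refine ⟨hg.1, n + 1, ?_⟩
  have h1 : MemLp (fun x : EuclideanSpace ℝ (Fin n) => (1 + ‖x‖) ^ (-((n + 1 : ℕ) : ℝ))) 2 := by
    have hc : Continuous fun x : EuclideanSpace ℝ (Fin n) =>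
        (1 + ‖x‖) ^ (-((n + 1 : ℕ) : ℝ)) :=
      (by fun_prop : Continuous fun x : EuclideanSpace ℝ (Fin n) => 1 + ‖x‖).rpow_const
        fun x => Or.inl (by positivity)
    rw [memLp_two_iff_integrable_sq hc.aestronglyMeasurable]
    refine (integrable_one_add_norm (r := 2 * (n + 1)) (by simp; linarith)).congr
      (Filter.Eventually.of_forall fun x => ?_)
    simp only
    rw [← Real.rpow_mul_natCast (by positivity)]
    congr 1; push_cast; ring
  exact MemLp.integrable_mul h1 hg.norm

theorem eq_of_distOf_eq {g h : EuclideanSpace ℝ (Fin n) → ℂ} (hg : IsTemperedFun g)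
    (hh : IsTemperedFun h) (e : distOf g = distOf h) : g =ᵐ[volume] h :=
  ae_eq_of_integral_schwartz_mul_eq hg.locallyIntegrable hh.locallyIntegrable fun φ => by
    rw [← distOf_apply hg, ← distOf_apply hh, e]

/-- The Fourier transform of a function in an inhomogeneous Sobolev space of nonnegative order is a
square integrable function. -/
theorem exists_fourier_eq_distOf {s : ℝ} (hs : 0 ≤ s) {f : 𝓢'(EuclideanSpace ℝ (Fin n), ℂ)}
    (hf : TemperedDistribution.MemSobolev s 2 f) :
    ∃ h : Lp ℂ 2 (volume : Measure (EuclideanSpace ℝ (Fin n))),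
      IsTemperedFun (fun x => (((1 + ‖x‖ ^ 2) ^ (-(s / 2)) : ℝ) : ℂ) * h x) ∧
      𝓕 f = distOf fun x => (((1 + ‖x‖ ^ 2) ^ (-(s / 2)) : ℝ) : ℂ) * h x := by
  obtain ⟨h, hh⟩ := TemperedDistribution.memSobolev_iff_exists_smulLeftCLM_fourier.1 hf
  have hmem : MemLp (fun x => (((1 + ‖x‖ ^ 2) ^ (-(s / 2)) : ℝ) : ℂ) * h x) 2 := by
    refine (Lp.memLp h).of_le (((by fun_prop : Measurable fun x : EuclideanSpace ℝ (Fin n) =>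
      (((1 + ‖x‖ ^ 2) ^ (-(s / 2)) : ℝ) : ℂ)).aestronglyMeasurable).mul (Lp.aestronglyMeasurable h))
      (Filter.Eventually.of_forall fun x => ?_)
    rw [norm_mul, Complex.norm_real, Real.norm_of_nonneg (by positivity)]
    refine mul_le_of_le_one_left (norm_nonneg _) (Real.rpow_le_one_of_one_le_of_nonpos ?_ ?_)
    · nlinarith [norm_nonneg x]
    · linarith
  have htemp := isTemperedFun_of_memLp_two hmem
  refine ⟨h, htemp, ?_⟩
  have h1 : (𝓕 f : 𝓢'(EuclideanSpace ℝ (Fin n), ℂ)) = TemperedDistribution.smulLeftCLM ℂ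
      (fun x => (((1 + ‖x‖ ^ 2) ^ (-(s / 2)) : ℝ) : ℂ)) (Lp.toTemperedDistribution h) := by
    rw [← hh, TemperedDistribution.smulLeftCLM_smulLeftCLM_apply (by fun_prop) (by fun_prop)]
    have e : ((fun x : EuclideanSpace ℝ (Fin n) => (((1 + ‖x‖ ^ 2) ^ (s / 2) : ℝ) : ℂ)) *
        fun x => (((1 + ‖x‖ ^ 2) ^ (-(s / 2)) : ℝ) : ℂ)) = fun _ => 1 := by
      ext x
      simp only [Pi.mul_apply]
      rw [← Complex.ofReal_mul, ← Real.rpow_add (by positivity), add_neg_cancel, Real.rpow_zero,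
        Complex.ofReal_one]
    rw [e]
    simp
  rw [h1]
  ext φ
  rw [TemperedDistribution.smulLeftCLM_apply_apply, Lp.toTemperedDistribution_apply,
    distOf_apply htemp]
  refine integral_congr_ae (Filter.Eventually.of_forall fun x => ?_)
  simp only
  rw [SchwartzMap.smulLeftCLM_apply_apply (by fun_prop), smul_eq_mul, smul_eq_mul]
  ring

/-- For s ≥ 0 the homogeneous weight is dominated by the inhomogeneous one. `MemSobolev` uses the
frequency η without 2π, which accounts for the constant (2π)^s. -/
theorem memHomSobolev_of_memSobolev {s : ℝ} (hs : 0 ≤ s) {f : 𝓢'(EuclideanSpace ℝ (Fin n), ℂ)}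
    (hf : TemperedDistribution.MemSobolev s 2 f) : MemHomSobolev s f := by
  obtain ⟨h, h1, h2⟩ := exists_fourier_eq_distOf hs hf
  have hF : FourierIsFun f := ⟨_, h1, h2⟩
  refine ⟨hF, ?_⟩
  obtain ⟨h3, h4⟩ := fourierFun_spec hF
  have hae := eq_of_distOf_eq h3 h1 (h4.symm.trans h2)
  have hpi := Real.pi_pos
  refine (Lp.memLp h).of_le_mul (c := (2 * Real.pi) ^ s)
    ((by fun_prop : Measurable fun η : EuclideanSpace ℝ (Fin n) =>
      (2 * Real.pi * ‖η‖) ^ s).aestronglyMeasurable.smul h3.1) ?_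
  filter_upwards [hae] with η hη
  have hle : ‖η‖ ^ s ≤ (1 + ‖η‖ ^ 2) ^ (s / 2) := by
    calc ‖η‖ ^ s = (‖η‖ ^ 2) ^ (s / 2) := by
          rw [← Real.rpow_natCast_mul (norm_nonneg _)]; congr 1; push_cast; ring
      _ ≤ _ := by gcongr; linarith
  have h0 : (0 : ℝ) < 1 + ‖η‖ ^ 2 := by positivity
  rw [hη, norm_smul, norm_mul, Complex.norm_real, Real.norm_of_nonneg (by positivity),
    Real.norm_of_nonneg (by positivity), Real.mul_rpow (by positivity) (norm_nonneg _), ← mul_assoc]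
  refine mul_le_mul_of_nonneg_right ?_ (norm_nonneg _)
  rw [mul_assoc]
  refine mul_le_of_le_one_right (by positivity) ?_
  calc _ ≤ (1 + ‖η‖ ^ 2) ^ (s / 2) * (1 + ‖η‖ ^ 2) ^ (-(s / 2)) := by gcongr
    _ = 1 := by rw [← Real.rpow_add h0, add_neg_cancel, Real.rpow_zero]

theorem homSobolevNorm_le_sobolevNorm {s : ℝ} (hs : 0 ≤ s)
    (f : 𝓢'(EuclideanSpace ℝ (Fin n), ℂ)) : homSobolevNorm s f ≤ sobolevNorm s f := by
  refine eLpNorm_mono fun η => ?_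
  have hpi := Real.pi_pos
  rw [norm_smul, norm_smul, Real.norm_of_nonneg (by positivity), Real.norm_of_nonneg (by positivity)]
  refine mul_le_mul_of_nonneg_right ?_ (norm_nonneg _)
  calc (2 * Real.pi * ‖η‖) ^ s = ((2 * Real.pi * ‖η‖) ^ 2) ^ (s / 2) := by
        rw [← Real.rpow_natCast_mul (by positivity)]; congr 1; push_cast; ring
    _ ≤ _ := by gcongr; linarith

/-- The expression equals (n − a − 1)/q, and n ≥ 3 with a ≤ 2 makes it nonnegative. Working with
inverses covers q = ∞ as well. -/
theorem regularity_nonneg {p q : ℝ≥0∞} (hn : 3 ≤ n) {a : ℝ} (ha₂ : a ≤ 2) (hp : 2 ≤ p)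
    (hq : 2 ≤ q) (hpq : 2 / q + 2 / p = 1) :
    0 ≤ (n : ℝ) * (1 / 2 - (p⁻¹).toReal) - (a + 1) * (q⁻¹).toReal := by
  have hp0 : p ≠ 0 := by rintro rfl; simp at hp
  have hq0 : q ≠ 0 := by rintro rfl; simp at hq
  have h := congrArg ENNReal.toReal hpq
  rw [ENNReal.toReal_add (ENNReal.div_ne_top (by simp) hq0) (ENNReal.div_ne_top (by simp) hp0),
    div_eq_mul_inv, div_eq_mul_inv, ENNReal.toReal_mul, ENNReal.toReal_mul, ENNReal.toReal_ofNat,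
    ENNReal.toReal_one] at h
  have h1 : 1 / 2 - (p⁻¹).toReal = (q⁻¹).toReal := by linarith
  rw [h1, ← sub_mul]
  have h2 : (3 : ℝ) ≤ n := by exact_mod_cast hn
  exact mul_nonneg (by linarith) ENNReal.toReal_nonneg

end

end FractionalZK

end

theorem proposition1p3 (n : ℕ) [NeZero n] (hn : 3 ≤ n) (a : ℝ) (ha₁ : 1 ≤ a) (ha₂ : a ≤ 2)
    (p q : ℝ≥0∞) [Fact (1 ≤ p)] (hp : 2 ≤ p) (hq : 2 ≤ q) (hp' : p ≠ ∞)
    (hpq : 2 / q + 2 / p = 1) (s : ℝ)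
    (hs : s = n * (1 / 2 - (p⁻¹).toReal) - (a + 1) * (q⁻¹).toReal) :
    (∃ C : ℝ≥0, ∀ f : 𝓢'(EuclideanSpace ℝ (Fin n), ℂ), FractionalZK.MemHomSobolev s f →
      FractionalZK.mixedNorm q p Set.univ (fun t => FractionalZK.propagator a t f) ≤
        C * FractionalZK.homSobolevNorm s f) ∧
    (∀ T : ℝ, 0 < T → ∃ C : ℝ≥0, ∀ f : 𝓢'(EuclideanSpace ℝ (Fin n), ℂ),
      TemperedDistribution.MemSobolev s 2 f →
      FractionalZK.mixedNorm q p (Set.Icc 0 T) (fun t => FractionalZK.propagator a t f) ≤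
        C * FractionalZK.sobolevNorm s f) := by
  obtain ⟨m, rfl⟩ : ∃ m, n = m + 1 := ⟨n - 1, by omega⟩
  have hs0 : 0 ≤ s := hs ▸ FractionalZK.regularity_nonneg hn ha₂ hp hq hpq
  obtain ⟨K, hK⟩ := FractionalZK.exists_solLp_bound (m := m) (by omega) ha₁ ha₂ hp hq hp' hpq hs
  have main : ∀ f : 𝓢'(EuclideanSpace ℝ (Fin (m + 1)), ℂ), FractionalZK.MemHomSobolev s f →
      FractionalZK.mixedNorm q p Set.univ (fun t => FractionalZK.propagator a t f) ≤
        K * FractionalZK.homSobolevNorm s f := fun f hf =>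
    FractionalZK.mixedNorm_propagator_le hp hp' hq a s hK hf
  refine ⟨⟨K, main⟩, fun T _ => ⟨K, fun f hf => ?_⟩⟩
  -- The bound on [0, T] is a restriction of the global one, so its constant does not depend on T.
  calc _ ≤ FractionalZK.mixedNorm q p Set.univ (fun t => FractionalZK.propagator a t f) :=
        FractionalZK.mixedNorm_mono (Set.subset_univ _) _
    _ ≤ K * FractionalZK.homSobolevNorm s f :=
        main f (FractionalZK.memHomSobolev_of_memSobolev hs0 hf)
    _ ≤ _ := by
        gcongr
        exact FractionalZK.homSobolevNorm_le_sobolevNorm hs0 f
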